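/- **Setting.** Let $a,b,c,d,t\in\mathbb C^{\times}$ be generic: $t^n\neq 1$ for all $n\ge 1$ and $abcd\,t^n\neq 1$ for all $n\ge 0$. For $N\ge 0$ a configuration of length $N$ is a word $w=w_1\cdots w_N$ in the letters $\circ,\ast,\bullet$, identified with $-1,0,1$; $\mathcal Q(N,m)$ is the set of those with exactly $m$ letters $\ast$. Let $H_{N,m}$ be the complex vector space with basis $\mathcal Q(N,m)$. On neighbouring sites $i,i+1$ let $\mathbf e_i$ be the generator that exchanges unequal neighbours $xy\to yx$ at rate $t^{1/2}$ if $x>y$ and $t^{-1/2}$ if $x<y$, and let $\mathbf f_i(\rho,\sigma)$ be the generator on site $i$ with transitions $\bullet\to\circ$ at rate $\rho$ and $\circ\to\bullet$ at rate $\sigma$ (diagonal entries make all column sums $0$). Put $$\check R_i(x)=1+\tfrac{x-1}{t^{1/2}x-t^{-1/2}}\mathbf e_i,\quad K_1(x)=1+\tfrac{x^2-1}{(x-a)(x-b)}\mathbf f_1(1,-ab),\quad K_N(x)=1+\tfrac{1-x^2}{(cx-1)(dx-1)}\mathbf f_N(-cd,1).$$ Let $\mathbf s_i$ ($1\le i\le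 N-1$) exchange the variables $z_i,z_{i+1}$ and let $\mathbf s_0,\mathbf s_N$ invert $z_1$, respectively $z_N$. Consider vectors $\Psi_{N,m}(\mathbf z)=\sum_{w\in\mathcal Q(N,m)}\psi_w(\mathbf z)\,w$ of Laurent polynomials in $\mathbf z=(z_1,\dots,z_N)$ that solve $$\check R_i(z_i/z_{i+1})\Psi_{N,m}=\mathbf s_i\Psi_{N,m}\ (1\le i\le N-1),\qquad K_1(z_1)\Psi_{N,m}=\mathbf s_0\Psi_{N,m},\qquad K_N(z_N)\Psi_{N,m}=\mathbf s_N\Psi_{N,m},$$ normalized by $\psi_{\circ^{k}\ast^{m}}=E_{\mu}$, where $k=N-m$ and $E_\mu$ is the nonsymmetric Koornwinder polynomial at $q=1$ with index $\mu=(-1,\dots,-1,0,\dots,0)$ ($k$ entries $-1$). That is, $E_\mu=\mathbf z^{\mu}+\sum_{\beta\prec\mu}c_\beta\mathbf z^\beta$ is a common eigenfunction of $Y_i=(T_i\cdots T_{N-1})(T_N\cdots T_0)(T_1^{-1}\cdots T_{i-1}^{-1})$, $1\le i\le N$, where, with $t_0=-ab$, $t_N=-cd$, $$t^{1/2}T_i=t-(tz_i-z_{i+1})\tfrac{1-\mathbf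 s_i}{z_i-z_{i+1}},\qquad t_0^{1/2}T_0=t_0-\tfrac{(z_1-a)(z_1-b)}{z_1}\,\tfrac{1-\mathbf s_0}{z_1-z_1^{-1}},\qquad t_N^{1/2}T_N=t_N+\tfrac{(1-cz_N)(1-dz_N)}{z_N}\,\tfrac{1-\mathbf s_N}{z_N-z_N^{-1}}.$$ Here $\alpha\le\beta$ means $\sum_{i\le j}\alpha_i\le\sum_{i\le j}\beta_i$ for all $j$, $\alpha^+$ is the partition obtained by sorting the $|\alpha_i|$, and $\alpha\prec\beta$ means $\alpha^+<\beta^+$, or $\alpha^+=\beta^+$ and $\alpha<\beta$. **Theorem.** For all $0\le m\le N$ there is exactly one such normalized solution $\Psi_{N,m}(\mathbf z;a,b,c,d)$; denote its components by $\psi_w(\mathbf z;a,b,c,d)$ (parameters that are not displayed are $a,b,c,d$). For every configuration $w$, with $m$ the number of letters $\ast$ in $w$, and with $\mathbf z_{\widehat j}$ denoting $\mathbf z$ with the variable $z_j$ removed ($N$ being one more than the length of $w$): 1. $$\psi_{w\ast}(\mathbf z;a,b,c,d)=\psi_w(\mathbf z_{\widehat N};a,b,tc,td),\qquad \psi_{\ast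 w}(\mathbf z;a,b,c,d)=\psi_w(\mathbf z_{\widehat 1};ta,tb,c,d).$$ 2. $$\psi_{w\circ}(\mathbf z)+cd\,\psi_{w\bullet}(\mathbf z)=\frac{(1-cz_N)(1-dz_N)}{z_N}\psi_w(\mathbf z_{\widehat N}),\qquad ab\,\psi_{\circ w}(\mathbf z)+\psi_{\bullet w}(\mathbf z)=\frac{(a-z_1)(b-z_1)}{z_1}\psi_w(\mathbf z_{\widehat 1}).$$ 3. At the right boundary $$\psi_{w\circ}|_{z_N=c^{-1}}=K_R(c)\,\psi_w(\mathbf z_{\widehat N};a,b,tc,d),\qquad \psi_{w\circ}|_{z_N=d^{-1}}=K_R(d)\,\psi_w(\mathbf z_{\widehat N};a,b,c,td),$$ $$\psi_{w\bullet}|_{z_N=c^{-1}}=-\frac{K_R(c)}{cd}\,\psi_w(\mathbf z_{\widehat N};a,b,tc,d),\qquad \psi_{w\bullet}|_{z_N=d^{-1}}=-\frac{K_R(d)}{cd}\,\psi_w(\mathbf z_{\widehat N};a,b,c,td),$$ and at the left boundary $$\psi_{\circ w}|_{z_1=a}=K_L(a)\,\psi_w(\mathbf z_{\widehat 1};ta,b,c,d),\qquad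 \psi_{\circ w}|_{z_1=b}=K_L(b)\,\psi_w(\mathbf z_{\widehat 1};a,tb,c,d),$$ $$\psi_{\bullet w}|_{z_1=a}=-ab\,K_L(a)\,\psi_w(\mathbf z_{\widehat 1};ta,b,c,d),\qquad \psi_{\bullet w}|_{z_1=b}=-ab\,K_L(b)\,\psi_w(\mathbf z_{\widehat 1};a,tb,c,d),$$ where $$K_R(x)=-\frac{(1-axt^m)(1-bxt^m)\,cd\,x^{-1}}{1-abcd\,t^{2m}},\qquad K_L(x)=\frac{(1-cxt^m)(1-dxt^m)\,x^{-1}}{1-abcd\,t^{2m}}.$$ -/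

import Mathlib

namespace OpenASEP

noncomputable section

/-- The boundary parameters `a, b, c, d` and the asymmetry parameter `t`, all nonzero complex
numbers. -/
structure Params where
  a : ℂˣ
  b : ℂˣ
  c : ℂˣ
  d : ℂˣ
  t : ℂˣ

/-- Particle configurations on `N` sites: `-1` is an empty site `∘`, `0` a second class
particle `∗`, and `1` a first class particle `•`. -/
abbrev Config (N : ℕ) : Type := Fin N → SignType

/-- The number of second class particles of a configuration. -/
def stars {N : ℕ} (w : Config N) : ℕ := (Finset.univ.filter fun i => w i = 0).card

/-- Laurent polynomials in `z_1, …, z_N` over `ℂ`, the exponents being vectors in `ℤ^N`. -/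
abbrev Laurent (N : ℕ) : Type := AddMonoidAlgebra ℂ (Fin N → ℤ)

/-- The value of a Laurent polynomial at a point with nonzero coordinates. -/
def eval {N : ℕ} (f : Laurent N) (z : Fin N → ℂˣ) : ℂ :=
  f.coeff.sum fun α r => r * ∏ i, ((z i ^ α i : ℂˣ) : ℂ)

/-! ### The exchange-reflection equations -/

/-- Exchange of the entries at the sites `i` and `j` (the action of `s_i` when `j = i + 1`). -/
def swapAt {N : ℕ} {X : Type} (i j : Fin N) (x : Fin N → X) : Fin N → X :=
  fun k => x (Equiv.swap i j k)

/-- `t^{1/2}` times the rate of the exchange `x y → y x` of two neighbouring particles: the rate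
is `t^{1/2}` if `x > y` and `t^{-1/2}` if `x < y` (the value at `x = y` is irrelevant). -/
def rate (t : ℂ) (x y : SignType) : ℂ := if y < x then t else 1

/-- The operator `t^{1/2} 𝐞` acting on the neighbouring sites `i, j` of a vector
`v = ∑ v_w w` of `H_N`. -/
def bulkGen (t : ℂ) {N : ℕ} (i j : Fin N) (v : Config N → ℂ) : Config N → ℂ :=
  fun w => rate t (w j) (w i) * v (swapAt i j w) - rate t (w i) (w j) * v w

/-- The operator `𝐟(ρ, σ)` acting on the site `i`: a first class particle is removed at rate `ρ`
and injected at rate `σ`. -/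
def bdryGen (ρ σ : ℂ) {N : ℕ} (i : Fin N) (v : Config N → ℂ) : Config N → ℂ :=
  fun w =>
    if w i = -1 then ρ * v (Function.update w i 1) - σ * v w
    else if w i = 1 then σ * v (Function.update w i (-1)) - ρ * v w
    else 0

/-- The matrix `Ř(x) = 1 + (x - 1) / (t^{1/2} x - t^{-1/2}) 𝐞` on the sites `i, j`; numerator and
denominator are multiplied by `t^{1/2}`. -/
def Rmat (p : Params) {N : ℕ} (i j : Fin N) (x : ℂ) (v : Config N → ℂ) : Config N → ℂ :=
  fun w => v w + (x - 1) / (p.t * x - 1) * bulkGen p.t i j v w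

/-- The left reflection matrix `K_1(x | a, b)`; here `γ⁻¹ 𝐟(γ, α) = 𝐟(1, -ab)`. -/
def KLeft (p : Params) {N : ℕ} (i : Fin N) (x : ℂ) (v : Config N → ℂ) : Config N → ℂ :=
  fun w => v w + (x ^ 2 - 1) / ((x - p.a) * (x - p.b)) * bdryGen 1 (-(p.a * p.b)) i v w

/-- The right reflection matrix `K_N(x | c, d)`; here `δ⁻¹ 𝐟(β, δ) = 𝐟(-cd, 1)`. -/
def KRight (p : Params) {N : ℕ} (i : Fin N) (x : ℂ) (v : Config N → ℂ) : Config N → ℂ :=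
  fun w => v w + (1 - x ^ 2) / ((p.c * x - 1) * (p.d * x - 1)) * bdryGen (-(p.c * p.d)) 1 i v w

/-- The value at `z` of a vector of Laurent polynomials. -/
def evalVec {N : ℕ} (Ψ : Config N → Laurent N) (z : Fin N → ℂˣ) : Config N → ℂ :=
  fun w => eval (Ψ w) z

/-- The exchange-reflection equations `Ř_i(z_i / z_{i+1}) Ψ = s_i Ψ`, `K_1(z_1) Ψ = s_0 Ψ` and
`K_N(z_N) Ψ = s_N Ψ`, at all points where the matrices have no pole. -/
structure ExchangeReflection (p : Params) {N : ℕ} (Ψ : Config N → Laurent N) : Prop where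
  bulk : ∀ (i j : Fin N), (i : ℕ) + 1 = j → ∀ z : Fin N → ℂˣ, p.t * z i ≠ z j →
    Rmat p i j (z i / z j) (evalVec Ψ z) = evalVec Ψ (swapAt i j z)
  left : ∀ i : Fin N, (i : ℕ) = 0 → ∀ z : Fin N → ℂˣ, z i ≠ p.a → z i ≠ p.b →
    KLeft p i (z i) (evalVec Ψ z) = evalVec Ψ (Function.update z i (z i)⁻¹)
  right : ∀ i : Fin N, (i : ℕ) + 1 = N → ∀ z : Fin N → ℂˣ, p.c * z i ≠ 1 → p.d * z i ≠ 1 →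
    KRight p i (z i) (evalVec Ψ z) = evalVec Ψ (Function.update z i (z i)⁻¹)

/-! ### Nonsymmetric Koornwinder polynomials at `q = 1` -/

/-- The variable `z_i`. -/
def X {N : ℕ} (i : Fin N) : Laurent N := AddMonoidAlgebra.single (Pi.single i 1) 1

/-- The inverse `z_i⁻¹`. -/
def Xinv {N : ℕ} (i : Fin N) : Laurent N := AddMonoidAlgebra.single (Pi.single i (-1)) 1

/-- Exchange of the variables `z_i` and `z_j`. -/
def swapVar {N : ℕ} (i j : Fin N) (f : Laurent N) : Laurent N :=
  AddMonoidAlgebra.mapDomain (swapAt i j) f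

/-- Inversion `z_i ↦ z_i⁻¹`. -/
def invVar {N : ℕ} (i : Fin N) (f : Laurent N) : Laurent N :=
  AddMonoidAlgebra.mapDomain (fun α => Function.update α i (-α i)) f

open Classical in
/-- Exact division of Laurent polynomials: the `h` with `g * h = f` (and `0` if there is none). -/
def exactDiv {N : ℕ} (f g : Laurent N) : Laurent N :=
  if h : ∃ q, g * q = f then h.choose else 0

/-- The operator `t^{1/2} T̂ = t - (t z_i - z_j) (1 - s) / (z_i - z_j)`. -/
def noumiBulk (p : Params) {N : ℕ} (i j : Fin N) (f : Laurent N) : Laurent N :=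
  (p.t : ℂ) • f - ((p.t : ℂ) • X i - X j) * exactDiv (f - swapVar i j f) (X i - X j)

/-- The operator
`t_0^{1/2} T̂_0 = t_0 - (z_1 - a) (z_1 - b) z_1⁻¹ (1 - s_0) / (z_1 - z_1⁻¹)`, `t_0 = -ab`. -/
def noumiLeft (p : Params) {N : ℕ} (i : Fin N) (f : Laurent N) : Laurent N :=
  (-(p.a * p.b) : ℂ) • f - (X i - (p.a : ℂ) • 1) * (X i - (p.b : ℂ) • 1) * Xinv i *
    exactDiv (f - invVar i f) (X i - Xinv i)

/-- The operator
`t_N^{1/2} T̂_N = t_N + (1 - c z_N) (1 - d z_N) z_N⁻¹ (1 - s_N) / (z_N - z_N⁻¹)`, `t_N = -cd`. -/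
def noumiRight (p : Params) {N : ℕ} (i : Fin N) (f : Laurent N) : Laurent N :=
  (-(p.c * p.d) : ℂ) • f + (1 - (p.c : ℂ) • X i) * (1 - (p.d : ℂ) • X i) * Xinv i *
    exactDiv (f - invVar i f) (X i - Xinv i)

/-- The operators `t_j^{1/2} T̂_j`, `0 ≤ j ≤ N`, of the Noumi representation at `q = 1`. -/
def noumi (p : Params) (N j : ℕ) (f : Laurent N) : Laurent N :=
  if h : 0 < j ∧ j < N then noumiBulk p ⟨j - 1, by omega⟩ ⟨j, h.2⟩ f
  else if h : j = 0 ∧ 0 < N then noumiLeft p ⟨0, h.2⟩ f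
  else if h : j = N ∧ 0 < N then noumiRight p ⟨N - 1, by omega⟩ f
  else f

/-- For `1 ≤ j ≤ N - 1`, the operator `t^{1/2} T̂_j⁻¹ = t^{1/2} T̂_j - (t - 1)`. -/
def noumiInv (p : Params) (N j : ℕ) (f : Laurent N) : Laurent N :=
  noumi p N j f - ((p.t : ℂ) - 1) • f

/-- The operator `Y_i = (T_i ⋯ T_{N-1}) (T_N ⋯ T_0) (T_1⁻¹ ⋯ T_{i-1}⁻¹)`, `1 ≤ i ≤ N`, up to the
nonzero scalar coming from the factors `t_j^{1/2}`. -/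
def lusztigY (p : Params) (N i : ℕ) (f : Laurent N) : Laurent N :=
  let f₁ := (List.range' 1 (i - 1)).foldr (noumiInv p N) f
  let f₂ := (List.range (N + 1)).reverse.foldr (noumi p N) f₁
  (List.range' i (N - i)).foldr (noumi p N) f₂

/-- The dominance order on `ℤ^N`. -/
def Dominated {N : ℕ} (α β : Fin N → ℤ) : Prop :=
  ∀ j : Fin N, ∑ i ∈ Finset.Iic j, α i ≤ ∑ i ∈ Finset.Iic j, β i

/-- `α⁺`: the absolute values of the entries of `α` in weakly decreasing order, that is the
partition in the orbit of `α` under permutations and sign changes. -/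
def plusPart {N : ℕ} (α : Fin N → ℤ) : Fin N → ℤ :=
  fun i => |α (Tuple.sort (fun k => -|α k|) i)|

/-- The strict order `α ≺ β`: `α⁺ < β⁺`, or `α⁺ = β⁺` and `α < β`, in dominance order. -/
def Below {N : ℕ} (α β : Fin N → ℤ) : Prop :=
  (Dominated (plusPart α) (plusPart β) ∧ plusPart α ≠ plusPart β) ∨
    (plusPart α = plusPart β ∧ Dominated α β ∧ α ≠ β)

/-- `E` is the nonsymmetric Koornwinder polynomial `E_α` at `q = 1`: it is `z^α` plus a
combination of `z^β` with `β ≺ α`, and a common eigenfunction of `Y_1, …, Y_N`. -/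
structure IsKoornwinder (p : Params) {N : ℕ} (α : Fin N → ℤ) (E : Laurent N) : Prop where
  monic : E.coeff α = 1
  triangular : ∀ β, β ≠ α → E.coeff β ≠ 0 → Below β α
  eigen : ∀ i, 1 ≤ i → i ≤ N → ∃ y : ℂ, lusztigY p N i E = y • E

/-! ### The inhomogeneous stationary vector -/

/-- The configuration `∘^k ∗^m` with `k + m = N`. -/
def refConfig (N m : ℕ) : Config N := fun i => if (i : ℕ) < N - m then -1 else 0

/-- `Ψ` is the vector `Ψ_{N,m}` of the sector with `m` second class particles: it lies in
`H_{N,m}`, it solves the exchange-reflection equations, and its component at `∘^k ∗^m` is the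
nonsymmetric Koornwinder polynomial with index `(-1, …, -1, 0, …, 0)`. -/
structure IsStationary (p : Params) {N : ℕ} (m : ℕ) (Ψ : Config N → Laurent N) : Prop where
  sector : ∀ w, stars w ≠ m → Ψ w = 0
  exchange : ExchangeReflection p Ψ
  reference : IsKoornwinder p (fun i => (refConfig N m i : ℤ)) (Ψ (refConfig N m))

open Classical in
/-- The vector `Ψ_{N,m}(𝐳; a, b, c, d)`. -/
def stationary (p : Params) (N m : ℕ) : Config N → Laurent N :=
  if h : ∃ Ψ : Config N → Laurent N, IsStationary p m Ψ then h.choose else 0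

/-- The value `ψ_w(𝐳; a, b, c, d)` of the component of `Ψ_{N,m}` at `w`, where `m` is the number
of second class particles of `w`. -/
def psi (p : Params) {N : ℕ} (w : Config N) (z : Fin N → ℂˣ) : ℂ :=
  eval (stationary p N (stars w) w) z

/-- The sequence `x` with `y` appended on the right. -/
def addRight {N : ℕ} {X : Type} (x : Fin N → X) (y : X) : Fin (N + 1) → X :=
  Fin.snoc (α := fun _ => X) x y

/-- The sequence `x` with `y` added on the left. -/
def addLeft {N : ℕ} {X : Type} (y : X) (x : Fin N → X) : Fin (N + 1) → X :=
  Fin.cons (α := fun _ => X) y x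

/-- The constant `K_R(x)` in the sector with `m` second class particles. -/
def constR (p : Params) (m : ℕ) (x : ℂ) : ℂ :=
  -((1 - p.a * x * p.t ^ m) * (1 - p.b * x * p.t ^ m) * (p.c * p.d * x⁻¹) /
    (1 - p.a * p.b * p.c * p.d * p.t ^ (2 * m)))

/-- The constant `K_L(x)` in the sector with `m` second class particles. -/
def constL (p : Params) (m : ℕ) (x : ℂ) : ℂ :=
  (1 - p.c * x * p.t ^ m) * (1 - p.d * x * p.t ^ m) * x⁻¹ /
    (1 - p.a * p.b * p.c * p.d * p.t ^ (2 * m))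

end

end OpenASEP

namespace OpenASEP

noncomputable section

/-! Existence comes from a matrix product. Replace • by `z + 𝐝`, ∘ by `z⁻¹ + 𝐞` and ∗ by `A`, with
`𝐞𝐝 = t𝐝𝐞 + (1 - t)`, `𝐞A = tA𝐞`, `A𝐝 = t𝐝A`, and sandwich between `⟨W|` and `|V⟩` with `⟨W|(𝐝 + ab𝐞
+ a + b) = 0` and `(𝐞 + cd𝐝 + c + d)|V⟩ = 0`. The bulk relations give the exchange equations
(`letterOp_exchange`), the boundary relations the reflection equations (`letterOp_left`,
`letterOp_right`). No representation has to be constructed: a vector `X|V⟩` is recorded by the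
numbers `⟨W| A^m 𝐞^j X |V⟩`, on which the letters act as operators, and `|V⟩` is the array solving
the right boundary relation, a recursion in `j` with denominators `1 - abcd t^(2m+j)`.

The normalization holds for two reasons. For any solution, the Noumi operators act on components by
moving letters, so `Y_i` carries the `i`-th letter of `∘^k ∗^m` once around the system and returns a
multiple of the same component (`lusztigY_insertLetter`). And the matrix product for `∘^k ∗^m`
expands into monomials `∏_{i ∈ S} z_i⁻¹` with `S ⊆ {1, …, k}`; the full `S` has coefficient 1, the
others are lower terms.

Uniqueness: the difference of two normalized solutions has reference component supported in the box
of exponents in `{-1, 0, 1}` with fewer than `k` nonzero entries. Boxes of this kind are convex and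
invariant under permutations and sign changes, so the support bound spreads from the reference
component to the whole sector (`SuppInBox.of_bulk`, `SuppInBox.of_bdry`). Now look at coefficients
with the maximal number of nonzero entries. Some site carries ∘ and exponent 0. Taking this letter
around the system multiplies the coefficient by `abcd t^e ≠ 1`, so the coefficient is 0
(`top_insertAt_zero`). The box shrinks until it is empty.

With `ψ_w` identified with the matrix product, the recursions are statements about the boundary
vectors: `A|V⟩`, `(c + 𝐞)|V⟩`, `⟨W|A` and `⟨W|(a⁻¹ + 𝐞)` are again boundary vectors, for shifted
parameters. A solution of the right boundary relation is determined by its entries at `j = 0`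
(`IsVacuum.eq_mul_vacuum`), which produces the constants `K_R` and `K_L`. -/

/-! ### Laurent polynomials: evaluation and coefficients -/

/-- The character `z ↦ ∏ z_i ^ α_i`. -/
def monomialChar {N : ℕ} (α : Fin N → ℤ) : (Fin N → ℂˣ) →* ℂ where
  toFun z := ∏ i, ((z i ^ α i : ℂˣ) : ℂ)
  map_one' := by simp
  map_mul' x y := by simp [mul_zpow, Finset.prod_mul_distrib]

/-- The point with one coordinate 2 and all others 1 reads off `2 ^ α i`, and distinct powers of 2
differ. -/
theorem monomialChar_injective {N : ℕ} :
    Function.Injective (monomialChar : (Fin N → ℤ) → (Fin N → ℂˣ) →* ℂ) := by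
  intro α β h
  funext i
  have h2 : (2 : ℂ) ≠ 0 := two_ne_zero
  have := DFunLike.congr_fun h (Function.update (1 : Fin N → ℂˣ) i (Units.mk0 2 h2))
  simp only [monomialChar, MonoidHom.coe_mk, OneHom.coe_mk] at this
  rw [Finset.prod_eq_single i, Finset.prod_eq_single i] at this
  · simp only [Function.update_self, Units.val_zpow_eq_zpow_val, Units.val_mk0] at this
    have h3 : ((2 : ℝ) : ℂ) ^ α i = ((2 : ℝ) : ℂ) ^ β i := by simpa using this
    have h4 : (2 : ℝ) ^ α i = (2 : ℝ) ^ β i := by exact_mod_cast h3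
    exact zpow_right_injective₀ (by norm_num) (by norm_num) h4
  all_goals simp +contextual [Function.update_of_ne]

/-- Evaluation of Laurent polynomials as an algebra homomorphism. -/
def evalHom {N : ℕ} (z : Fin N → ℂˣ) : Laurent N →ₐ[ℂ] ℂ :=
  AddMonoidAlgebra.lift ℂ ℂ (Fin N → ℤ)
    { toFun := fun α => ∏ i, ((z i ^ (α.toAdd i) : ℂˣ) : ℂ)
      map_one' := by simp
      map_mul' := fun x y => by simp [zpow_add, Finset.prod_mul_distrib] }

theorem eval_eq_evalHom {N : ℕ} (f : Laurent N) (z : Fin N → ℂˣ) : eval f z = evalHom z f := by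
  simp [eval, evalHom, AddMonoidAlgebra.lift_apply]

theorem eval_single {N : ℕ} (α : Fin N → ℤ) (r : ℂ) (z : Fin N → ℂˣ) :
    eval (AddMonoidAlgebra.single α r) z = r * ∏ i, ((z i ^ α i : ℂˣ) : ℂ) := by
  simp [eval_eq_evalHom, evalHom, AddMonoidAlgebra.lift_single]

/-- Dedekind's independence of characters, applied to the monomials on the torus. Identities of
Laurent polynomials may therefore be checked pointwise. -/
theorem eval_injective {N : ℕ} {f g : Laurent N} (h : ∀ z, eval f z = eval g z) : f = g := by
  have hli : LinearIndependent ℂ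
      (fun α : Fin N → ℤ => (monomialChar α : (Fin N → ℂˣ) → ℂ)) :=
    (linearIndependent_monoidHom (Fin N → ℂˣ) ℂ).comp monomialChar monomialChar_injective
  rw [← sub_eq_zero, ← AddMonoidAlgebra.coeff_eq_zero]
  refine linearIndependent_iff.1 hli _ ?_
  funext z
  have h0 : eval (f - g) z = 0 := by
    rw [eval_eq_evalHom, map_sub, ← eval_eq_evalHom, ← eval_eq_evalHom, h, sub_self]
  rw [Finsupp.linearCombination_apply, Finsupp.sum, Finset.sum_apply]
  simpa [eval, Finsupp.sum, monomialChar] using h0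

theorem eval_X {N : ℕ} (i : Fin N) (z : Fin N → ℂˣ) : eval (X i) z = z i := by
  rw [X, eval_single, Finset.prod_eq_single i]
  · simp
  · intro j _ hj
    simp [Pi.single_eq_of_ne hj]
  · simp

theorem X_mul_Xinv {N : ℕ} (i : Fin N) : X i * Xinv i = 1 := by
  rw [X, Xinv, AddMonoidAlgebra.single_mul_single, ← Pi.single_add, AddMonoidAlgebra.one_def]
  simp

/-- The variable `z_i` as a unit. -/
def unitX {N : ℕ} (i : Fin N) : (Laurent N)ˣ where
  val := X i
  inv := Xinv i
  val_inv := X_mul_Xinv i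
  inv_val := by rw [mul_comm, X_mul_Xinv]

theorem eval_swapVar {N : ℕ} (i j : Fin N) (f : Laurent N) (z : Fin N → ℂˣ) :
    eval (swapVar i j f) z = eval f (swapAt i j z) := by
  rw [eval_eq_evalHom, eval_eq_evalHom]
  induction f using AddMonoidAlgebra.induction_linear with
  | zero => simp [swapVar]
  | add f g hf hg =>
    simp only [swapVar, AddMonoidAlgebra.mapDomain_add, map_add] at hf hg ⊢
    rw [hf, hg]
  | single α r =>
    rw [swapVar, AddMonoidAlgebra.mapDomain_single, ← eval_eq_evalHom, ← eval_eq_evalHom,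
      eval_single, eval_single]
    congr 1
    rw [← Equiv.prod_comp (Equiv.swap i j)]
    simp [swapAt]

theorem eval_invVar {N : ℕ} (i : Fin N) (f : Laurent N) (z : Fin N → ℂˣ) :
    eval (invVar i f) z = eval f (Function.update z i (z i)⁻¹) := by
  rw [eval_eq_evalHom, eval_eq_evalHom]
  induction f using AddMonoidAlgebra.induction_linear with
  | zero => simp [invVar]
  | add f g hf hg =>
    simp only [invVar, AddMonoidAlgebra.mapDomain_add, map_add] at hf hg ⊢
    rw [hf, hg]
  | single α r =>
    rw [invVar, AddMonoidAlgebra.mapDomain_single, ← eval_eq_evalHom, ← eval_eq_evalHom,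
      eval_single, eval_single]
    congr 1
    refine Finset.prod_congr rfl fun k _ => ?_
    by_cases hk : k = i
    · subst hk; simp
    · simp [Function.update_of_ne hk]

theorem swapAt_swapAt {N : ℕ} {Y : Type} (i j : Fin N) (x : Fin N → Y) :
    swapAt i j (swapAt i j x) = x := by
  funext k; simp [swapAt]

theorem coeff_swapVar {N : ℕ} (i j : Fin N) (f : Laurent N) (α : Fin N → ℤ) :
    (swapVar i j f).coeff α = f.coeff (swapAt i j α) := by
  have hinj : Function.Injective (swapAt i j : (Fin N → ℤ) → Fin N → ℤ) :=
    Function.LeftInverse.injective (swapAt_swapAt i j)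
  conv_lhs => rw [← swapAt_swapAt i j α]
  exact Finsupp.mapDomain_apply hinj _ _

theorem coeff_invVar {N : ℕ} (i : Fin N) (f : Laurent N) (α : Fin N → ℤ) :
    (invVar i f).coeff α = f.coeff (Function.update α i (-α i)) := by
  have hinv : Function.LeftInverse (fun α : Fin N → ℤ => Function.update α i (-α i))
      (fun α : Fin N → ℤ => Function.update α i (-α i)) := fun α => by simp
  conv_lhs => rw [← hinv α]
  exact Finsupp.mapDomain_apply hinv.injective _ _

theorem coeff_X_mul {N : ℕ} (i : Fin N) (f : Laurent N) (α : Fin N → ℤ) :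
    (X i * f).coeff α = f.coeff (α - Pi.single i 1) := by
  rw [X, AddMonoidAlgebra.coeff_single_mul_apply, one_mul, neg_add_eq_sub]

theorem X_sub_X_ne_zero {N : ℕ} {i j : Fin N} (h : i ≠ j) : X i - X j ≠ 0 := by
  rw [sub_ne_zero, X, X, Ne, AddMonoidAlgebra.single_left_inj one_ne_zero]
  intro h'
  have := congrFun h' i
  simp [Pi.single_eq_of_ne h] at this

theorem X_sub_Xinv_ne_zero {N : ℕ} (i : Fin N) : X i - Xinv i ≠ 0 := by
  rw [sub_ne_zero, X, Xinv, Ne, AddMonoidAlgebra.single_left_inj one_ne_zero]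
  intro h'
  have := congrFun h' i
  simp at this

instance {N : ℕ} : NoZeroDivisors (Laurent N) := inferInstance

/-- Modulo `u - 1` the unit `u` becomes 1, hence so does each of its powers, negative ones included.
-/
theorem sub_one_dvd_zpow_sub_one {R : Type*} [CommRing R] (u : Rˣ) (n : ℤ) :
    (u : R) - 1 ∣ ((u ^ n : Rˣ) : R) - 1 := by
  rw [← Ideal.mem_span_singleton, ← Ideal.Quotient.eq_zero_iff_mem, map_sub, map_one]
  set I := Ideal.span {(u : R) - 1}
  have h1 : Units.map (Ideal.Quotient.mk I : R →* R ⧸ I) u = 1 := by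
    ext
    have : Ideal.Quotient.mk I ((u : R) - 1) = 0 :=
      Ideal.Quotient.eq_zero_iff_mem.2 (Ideal.mem_span_singleton_self _)
    rw [map_sub, map_one, sub_eq_zero] at this
    simpa using this
  have h2 : (Units.map (Ideal.Quotient.mk I : R →* R ⧸ I) (u ^ n) : R ⧸ I) = 1 := by
    rw [map_zpow, h1, one_zpow, Units.val_one]
  rw [Units.coe_map, MonoidHom.coe_coe] at h2
  rw [h2, sub_self]

theorem single_sub_one_dvd {N : ℕ} (v : Fin N → ℤ) (n : ℤ) :
    (AddMonoidAlgebra.single v 1 - 1 : Laurent N) ∣ AddMonoidAlgebra.single (n • v) 1 - 1 := by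
  let φ : Multiplicative (Fin N → ℤ) →* Laurent N := AddMonoidAlgebra.of ℂ (Fin N → ℤ)
  let u : (Laurent N)ˣ := Units.map φ (toUnits (Multiplicative.ofAdd v))
  have := sub_one_dvd_zpow_sub_one u n
  have h : ((u ^ n : (Laurent N)ˣ) : Laurent N) = AddMonoidAlgebra.single (n • v) 1 := by
    simp only [u, ← map_zpow, Units.coe_map]
    simp [φ, AddMonoidAlgebra.of]
  rw [h] at this
  exact this

/-- The exchange multiplies a monomial by a power of `z_i / z_j`. This divisibility and its analogue
for inversion ensure that `exactDiv` never takes its default value in the Noumi operators. -/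
theorem X_sub_X_dvd_sub_swapVar {N : ℕ} (i j : Fin N) (f : Laurent N) :
    X i - X j ∣ f - swapVar i j f := by
  induction f using AddMonoidAlgebra.induction_linear with
  | zero => simp [swapVar]
  | add f g hf hg =>
    have : f + g - swapVar i j (f + g) = (f - swapVar i j f) + (g - swapVar i j g) := by
      simp only [swapVar, AddMonoidAlgebra.mapDomain_add]; ring
    rw [this]
    exact dvd_add hf hg
  | single α r =>
    by_cases hij : i = j
    · subst hij
      have : swapAt i i α = α := by funext k; simp [swapAt]
      simp [swapVar, this]
    have hs : swapAt i j α = α + (α j - α i) • (Pi.single i 1 - Pi.single j 1) := by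
      funext k
      by_cases hi : k = i
      · subst hi; simp [swapAt, Pi.single_eq_of_ne hij]
      · by_cases hj : k = j
        · subst hj; simp [swapAt, Pi.single_eq_of_ne hi]
        · simp [swapAt, Equiv.swap_apply_of_ne_of_ne hi hj, Pi.single_eq_of_ne hi,
            Pi.single_eq_of_ne hj]
    have h1 : (AddMonoidAlgebra.single (Pi.single i 1 - Pi.single j 1) 1 - 1 : Laurent N) =
        Xinv j * (X i - X j) := by
      rw [mul_sub, mul_comm _ (X j), X_mul_Xinv, X, Xinv, AddMonoidAlgebra.single_mul_single]
      congr 2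
      · rw [sub_eq_add_neg, add_comm, ← Pi.single_neg]
      · simp
    have h2 := single_sub_one_dvd (Pi.single i 1 - Pi.single j 1 : Fin N → ℤ) (α j - α i)
    rw [h1] at h2
    have h3 : AddMonoidAlgebra.single α r - swapVar i j (AddMonoidAlgebra.single α r) =
        -AddMonoidAlgebra.single α r *
          (AddMonoidAlgebra.single ((α j - α i) • (Pi.single i 1 - Pi.single j 1)) 1 - 1) := by
      rw [swapVar, AddMonoidAlgebra.mapDomain_single, hs, mul_sub, neg_mul,
        AddMonoidAlgebra.single_mul_single]
      simp
      ring
    rw [h3]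
    exact ((Dvd.intro_left _ rfl).trans h2).mul_left _

theorem X_sub_Xinv_dvd_sub_invVar {N : ℕ} (i : Fin N) (f : Laurent N) :
    X i - Xinv i ∣ f - invVar i f := by
  induction f using AddMonoidAlgebra.induction_linear with
  | zero => simp [invVar]
  | add f g hf hg =>
    have : f + g - invVar i (f + g) = (f - invVar i f) + (g - invVar i g) := by
      simp only [invVar, AddMonoidAlgebra.mapDomain_add]; ring
    rw [this]
    exact dvd_add hf hg
  | single α r =>
    have hs : Function.update α i (-α i) = α + (-α i) • Pi.single i 2 := by
      funext k
      by_cases hi : k = i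
      · subst hi; simp; ring
      · simp [Function.update_of_ne hi, Pi.single_eq_of_ne hi]
    have h1 : (AddMonoidAlgebra.single (Pi.single i 2) 1 - 1 : Laurent N) =
        X i * (X i - Xinv i) := by
      rw [mul_sub, X_mul_Xinv, X, AddMonoidAlgebra.single_mul_single, ← Pi.single_add]
      simp
    have h2 := single_sub_one_dvd (Pi.single i 2 : Fin N → ℤ) (-α i)
    rw [h1] at h2
    have h3 : AddMonoidAlgebra.single α r - invVar i (AddMonoidAlgebra.single α r) =
        -AddMonoidAlgebra.single α r *
          (AddMonoidAlgebra.single ((-α i) • Pi.single i 2) 1 - 1) := by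
      rw [invVar, AddMonoidAlgebra.mapDomain_single, hs, mul_sub, neg_mul,
        AddMonoidAlgebra.single_mul_single]
      simp
      ring
    rw [h3]
    exact ((Dvd.intro_left _ rfl).trans h2).mul_left _

theorem mul_exactDiv {N : ℕ} {f g : Laurent N} (h : g ∣ f) : g * exactDiv f g = f := by
  have h' : ∃ q, g * q = f := h.imp fun _ hq => hq.symm
  rw [exactDiv, dif_pos h']
  exact h'.choose_spec

/-! ### The matrix product

Operators on the functions `f m j = ⟨W| A^m e^j X |V⟩`, where `X` ranges over the algebra generated
by `A` and the `t`-oscillators `d, e`. -/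

section Operators

variable {R : Type} [CommRing R] [Algebra ℂ R]

/-- Multiplication by `e`. -/
def opE : (ℕ → ℕ → R) →ₗ[R] (ℕ → ℕ → R) where
  toFun f := fun m j => f m (j + 1)
  map_add' _ _ := rfl
  map_smul' _ _ := rfl

/-- Multiplication by `d`, rewritten by means of `⟨W| (d + a b e + a + b) = 0`. -/
def opD (p : Params) : (ℕ → ℕ → R) →ₗ[R] (ℕ → ℕ → R) where
  toFun f := fun m j =>
    -- Move `𝐝` to the left: `𝐞^j 𝐝 = t^j 𝐝 𝐞^j + (1 - t^j) 𝐞^(j-1)` and `A^m 𝐝 = t^m 𝐝 A^m`. Then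
    -- replace `⟨W|𝐝` by `-⟨W|(ab𝐞 + a + b)`; bringing that `𝐞` back past `A^m` costs another `t^m`.
    -- At `j = 0` the truncated `j - 1` is harmless because its coefficient is 0.
    algebraMap ℂ R (-(p.a * p.b * p.t ^ (2 * m + j))) * f m (j + 1) -
      algebraMap ℂ R ((p.a + p.b) * p.t ^ (m + j)) * f m j +
      algebraMap ℂ R (1 - p.t ^ j) * f m (j - 1)
  map_add' f g := by funext m j; simp only [Pi.add_apply]; ring
  map_smul' r f := by funext m j; simp only [Pi.smul_apply, smul_eq_mul, RingHom.id_apply]; ring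

/-- Multiplication by `A`. -/
def opA (p : Params) : (ℕ → ℕ → R) →ₗ[R] (ℕ → ℕ → R) where
  toFun f := fun m j => algebraMap ℂ R (p.t ^ j) * f (m + 1) j
  map_add' f g := by funext m j; simp only [Pi.add_apply]; ring
  map_smul' r f := by funext m j; simp only [Pi.smul_apply, smul_eq_mul, RingHom.id_apply]; ring

/-- The matrix attached to a site: `z + d`, `z⁻¹ + e` or `A`. -/
def letterOp (p : Params) (x : SignType) (z : Rˣ) : (ℕ → ℕ → R) →ₗ[R] (ℕ → ℕ → R) :=
  match x with
  | .pos => (z : R) • LinearMap.id + opD p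
  | .neg => ((z⁻¹ : Rˣ) : R) • LinearMap.id + opE
  | .zero => opA p

/-- The matrix product of a configuration applied to the vector `V`. -/
def matProd (p : Params) : {N : ℕ} → Config N → (Fin N → Rˣ) → (ℕ → ℕ → R) → (ℕ → ℕ → R)
  | 0, _, _, V => V
  | _ + 1, w, z, V => letterOp p (w 0) (z 0) (matProd p (Fin.tail w) (Fin.tail z) V)

theorem letterOp_one (p : Params) (z : Rˣ) (f : ℕ → ℕ → R) (m j : ℕ) :
    letterOp p 1 z f m j = z * f m j + opD p f m j := rfl

theorem letterOp_neg_one (p : Params) (z : Rˣ) (f : ℕ → ℕ → R) (m j : ℕ) :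
    letterOp p (-1) z f m j = ((z⁻¹ : Rˣ) : R) * f m j + f m (j + 1) := rfl

theorem letterOp_zero (p : Params) (z : Rˣ) (f : ℕ → ℕ → R) (m j : ℕ) :
    letterOp p 0 z f m j = algebraMap ℂ R (p.t ^ j) * f (m + 1) j := rfl

theorem letterOp_zero' (p : Params) (z : Rˣ) : letterOp p 0 z = opA p := rfl

theorem matProd_addLeft (p : Params) {N : ℕ} (x : SignType) (w : Config N) (u : Rˣ)
    (z : Fin N → Rˣ) (V : ℕ → ℕ → R) :
    matProd p (addLeft x w) (addLeft u z) V = letterOp p x u (matProd p w z V) := rfl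

theorem addRight_addLeft {N : ℕ} {Y : Type} (x y : Y) (w : Fin N → Y) :
    addRight (addLeft x w) y = addLeft x (addRight w y) :=
  (Fin.cons_snoc_eq_snoc_cons (β := Y) x w y).symm

/-- `matProd` peels off the first site. The right boundary needs the last one, whose matrix acts
directly on `V`. -/
theorem matProd_addRight (p : Params) {N : ℕ} (w : Config N) (x : SignType) (z : Fin N → Rˣ)
    (u : Rˣ) (V : ℕ → ℕ → R) :
    matProd p (addRight w x) (addRight z u) V = matProd p w z (letterOp p x u V) := by
  induction N with
  | zero =>
    change letterOp p (addRight w x 0) (addRight z u 0) V = letterOp p x u V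
    rfl
  | succ N ih =>
    have hw : w = addLeft (w 0) (Fin.tail w) := (Fin.cons_self_tail w).symm
    have hz : z = (Fin.cons (z 0) (Fin.tail z) : Fin (N + 1) → Rˣ) := (Fin.cons_self_tail z).symm
    have h1 : addRight w x 0 = w 0 := Fin.snoc_castSucc (α := fun _ => SignType) x w 0
    have h2 : addRight z u 0 = z 0 := Fin.snoc_castSucc (α := fun _ => Rˣ) u z 0
    have h3 : Fin.tail (addRight w x) = addRight (Fin.tail w) x := by
      conv_lhs => rw [hw, addRight_addLeft]
      rfl
    have h4 : Fin.tail (addRight z u) = addRight (Fin.tail z) u := by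
      conv_lhs => rw [hz]
      exact congrArg Fin.tail (Fin.cons_snoc_eq_snoc_cons (β := Rˣ) _ _ _).symm
    change letterOp p (addRight w x 0) (addRight z u 0)
      (matProd p (Fin.tail (addRight w x)) (Fin.tail (addRight z u)) V) = _
    rw [h1, h2, h3, h4, ih]
    rfl

end Operators

/-- Links the product over Laurent polynomials, which defines the solution, to the product over `ℂ`,
in which all relations are verified. -/
theorem matProd_map {R S : Type} [CommRing R] [Algebra ℂ R] [CommRing S] [Algebra ℂ S]
    (φ : R →ₐ[ℂ] S) (p : Params) {N : ℕ} (w : Config N) (z : Fin N → Rˣ) (V : ℕ → ℕ → R) (m j : ℕ) :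
    φ (matProd p w z V m j) =
      matProd p w (fun i => Units.map (φ : R →* S) (z i)) (fun m j => φ (V m j)) m j := by
  induction N generalizing m j with
  | zero => rfl
  | succ N ih =>
    have hl : ∀ (x : SignType) (u : Rˣ) (f : ℕ → ℕ → R), φ (letterOp p x u f m j) =
        letterOp p x (Units.map (φ : R →* S) u) (fun m j => φ (f m j)) m j := by
      intro x u f
      cases x <;> simp [letterOp, opA, opD, opE]
    change φ (letterOp p _ _ _ m j) = letterOp p _ _ _ m j
    rw [hl]
    have := funext fun m => funext fun j => ih (Fin.tail w) (Fin.tail z) m j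
    rw [this]
    rfl

/-! ### The exchange relations -/

/-- The oscillator relation `𝐞𝐝 = t𝐝𝐞 + (1 - t)`: applying `opE` to `opD f` represents the product
`𝐞𝐝`, in this order. -/
theorem opE_opD (p : Params) (f : ℕ → ℕ → ℂ) (m j : ℕ) :
    opE (opD p f) m j = p.t * opD p (opE f) m j - (p.t - 1) * f m j := by
  rcases j with _ | j <;> simp [opE, opD] <;> ring

theorem opA_opD (p : Params) (f : ℕ → ℕ → ℂ) (m j : ℕ) :
    opA p (opD p f) m j = p.t * opD p (opA p f) m j := by
  rcases j with _ | j <;> simp [opA, opD] <;> ring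

theorem opE_opA (p : Params) (f : ℕ → ℕ → ℂ) (m j : ℕ) :
    opE (opA p f) m j = p.t * opA p (opE f) m j := by
  simp [opA, opE]; ring

/-- Equal letters give commuting matrices. For unequal letters, each case reduces by one of the
three quadratic relations to a rational identity in `u`, `v`, `t`. -/
theorem letterOp_exchange (p : Params) (x y : SignType) (u v : ℂˣ) (h : p.t * u ≠ v)
    (f : ℕ → ℕ → ℂ) :
    letterOp p x v (letterOp p y u f) = letterOp p x u (letterOp p y v f) +
      (((u : ℂ) / v - 1) / (p.t * ((u : ℂ) / v) - 1)) •
        (rate p.t y x • letterOp p y u (letterOp p x v f) -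
          rate p.t x y • letterOp p x u (letterOp p y v f)) := by
  have hu : (u : ℂ) ≠ 0 := u.ne_zero
  have hv : (v : ℂ) ≠ 0 := v.ne_zero
  have h' : (p.t * u - v : ℂ) ≠ 0 := fun h0 => h (Units.ext (by
    push_cast; exact sub_eq_zero.1 h0))
  have hx : ((u : ℂ) / v - 1) / (p.t * ((u : ℂ) / v) - 1) = (u - v) / (p.t * u - v) := by
    have : (p.t * ((u : ℂ) / v) - 1) = (p.t * u - v) / v := by field_simp
    rw [this]; field_simp
  rw [hx]
  funext m j
  have h1 := opE_opD p f m j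
  have h2 := opA_opD p f m j
  have h3 := opE_opA p f m j
  simp only [Pi.add_apply, Pi.smul_apply, Pi.sub_apply, smul_eq_mul]
  cases x <;> cases y <;>
    simp only [letterOp, rate, LinearMap.add_apply, LinearMap.smul_apply, LinearMap.id_apply,
      map_add, map_smul, Pi.add_apply, Pi.smul_apply, smul_eq_mul, Units.val_inv_eq_inv_val,
      h1, h2, h3]
  clear hx h1 h2 h3 h
  all_goals
    generalize (u : ℂ) = u, (v : ℂ) = v, (p.t : ℂ) = t at *
    have h'' : u * t - v ≠ 0 := by rwa [mul_comm]
    simp only [show ¬((SignType.zero : SignType) < SignType.zero) by decide,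
      show ¬((SignType.neg : SignType) < SignType.neg) by decide,
      show ¬((SignType.pos : SignType) < SignType.pos) by decide,
      show ((SignType.neg : SignType) < SignType.zero) by decide,
      show ¬((SignType.zero : SignType) < SignType.neg) by decide,
      show ((SignType.neg : SignType) < SignType.pos) by decide,
      show ¬((SignType.pos : SignType) < SignType.neg) by decide,
      show ((SignType.zero : SignType) < SignType.pos) by decide,
      show ¬((SignType.pos : SignType) < SignType.zero) by decide, if_true, if_false]
    field_simp
    ring

theorem swapAt_succ {N : ℕ} {Y : Type} (i j : Fin N) (x : Fin (N + 1) → Y) :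
    Fin.tail (swapAt i.succ j.succ x) = swapAt i j (Fin.tail x) := by
  funext k
  simp only [swapAt, Fin.tail]
  congr 1
  exact (Fin.succ_injective N).swap_apply i j k

theorem swapAt_succ_zero {N : ℕ} {Y : Type} (i j : Fin N) (x : Fin (N + 1) → Y) :
    swapAt i.succ j.succ x 0 = x 0 := by
  simp only [swapAt]
  rw [Equiv.swap_apply_of_ne_of_ne (Fin.succ_ne_zero i).symm (Fin.succ_ne_zero j).symm]

/-- The exchange is local: the matrices to the left of the pair act linearly, so induction strips
them off until the pair stands in front. -/
theorem matProd_bulk (p : Params) {N : ℕ} (w : Config N) (z : Fin N → ℂˣ) (V : ℕ → ℕ → ℂ)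
    (i j : Fin N) (hij : (i : ℕ) + 1 = j) (hz : p.t * z i ≠ z j) :
    matProd p w (swapAt i j z) V = matProd p w z V +
      (((z i : ℂ) / z j - 1) / (p.t * ((z i : ℂ) / z j) - 1)) •
        (rate p.t (w j) (w i) • matProd p (swapAt i j w) z V -
          rate p.t (w i) (w j) • matProd p w z V) := by
  induction N with
  | zero => exact i.elim0
  | succ N ih =>
    induction i using Fin.cases with
    | zero =>
      obtain ⟨n, rfl⟩ : ∃ n, N = n + 1 := ⟨N - 1, by have := j.2; simp at hij; omega⟩
      obtain rfl : j = 1 := Fin.ext (by simpa using hij.symm)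
      have ht : ∀ {Y : Type} (x : Fin (n + 2) → Y),
          Fin.tail (Fin.tail (swapAt 0 1 x)) = Fin.tail (Fin.tail x) := by
        intro Y x
        funext k
        simp only [Fin.tail, swapAt]
        rw [Equiv.swap_apply_of_ne_of_ne (Fin.succ_ne_zero _)]
        exact fun h => Fin.succ_ne_zero k (Fin.succ_injective _ h)
      have h0 : ∀ {Y : Type} (x : Fin (n + 2) → Y), swapAt 0 1 x 0 = x 1 := by
        intro Y x; simp [swapAt]
      have h1 : ∀ {Y : Type} (x : Fin (n + 2) → Y), Fin.tail (swapAt 0 1 x) 0 = x 0 := by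
        intro Y x; simp [swapAt, Fin.tail]
      simp only [matProd, ht, h0, h1]
      exact letterOp_exchange p (w 0) (w 1) (z 0) (z 1) hz _
    | succ i =>
      obtain ⟨j', rfl⟩ : ∃ j', j = Fin.succ j' :=
        Fin.exists_succ_eq.2 (by rintro rfl; simp at hij) |>.imp fun _ h => h.symm
      have := ih (Fin.tail w) (Fin.tail z) i j' (by simpa using hij) hz
      simp only [matProd, swapAt_succ, swapAt_succ_zero, this, map_add, map_smul, map_sub]
      rfl

/-! ### The boundary vector and the boundary relations -/

/-- Genericity of the parameters. -/
def Generic (p : Params) : Prop := ∀ n : ℕ, p.a * p.b * p.c * p.d * p.t ^ n ≠ 1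

theorem Generic.sub_ne_zero {p : Params} (hp : Generic p) (n : ℕ) :
    (1 - p.a * p.b * p.c * p.d * p.t ^ n : ℂ) ≠ 0 := fun h =>
  hp n (Units.ext (by push_cast; exact (_root_.sub_eq_zero.1 h).symm))

/-- The vector `|V⟩`, normalized by `⟨W| A^m |V⟩ = 1` for all `m`. -/
def vacuum (p : Params) (m : ℕ) : ℕ → ℂ
  | 0 => 1
  | 1 => -(p.c + p.d - p.c * p.d * (p.a + p.b) * p.t ^ m) /
      (1 - p.a * p.b * p.c * p.d * p.t ^ (2 * m))
  | j + 2 => -(vacuum p m (j + 1) * (p.c + p.d - p.c * p.d * (p.a + p.b) * p.t ^ (m + (j + 1))) +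
      p.c * p.d * (1 - p.t ^ (j + 1)) * vacuum p m j) /
      (1 - p.a * p.b * p.c * p.d * p.t ^ (2 * m + (j + 1)))

/-- The relation `(e + c d 𝐝 + c + d) f = 0`. -/
def IsVacuum (p : Params) (f : ℕ → ℕ → ℂ) : Prop :=
  ∀ m j, f m (j + 1) + p.c * p.d * opD p f m j + (p.c + p.d) * f m j = 0

theorem isVacuum_vacuum {p : Params} (hp : Generic p) : IsVacuum p (vacuum p) := by
  intro m j
  have h := hp.sub_ne_zero (2 * m + j)
  rcases j with _ | j
  · simp only [Nat.add_zero] at h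
    have : vacuum p m 1 * (1 - p.a * p.b * p.c * p.d * p.t ^ (2 * m)) =
        -(p.c + p.d - p.c * p.d * (p.a + p.b) * p.t ^ m) := by
      rw [vacuum, div_mul_cancel₀ _ h]
    have h0 : vacuum p m 0 = 1 := rfl
    simp only [opD, LinearMap.coe_mk, AddHom.coe_mk, Algebra.algebraMap_self, RingHom.id_apply,
      Nat.zero_add, Nat.add_zero, pow_zero, sub_self, h0]
    linear_combination this
  · have : vacuum p m (j + 2) * (1 - p.a * p.b * p.c * p.d * p.t ^ (2 * m + (j + 1))) =
        -(vacuum p m (j + 1) * (p.c + p.d - p.c * p.d * (p.a + p.b) * p.t ^ (m + (j + 1))) +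
      p.c * p.d * (1 - p.t ^ (j + 1)) * vacuum p m j) := by
      rw [vacuum, div_mul_cancel₀ _ h]
    simp only [opD, LinearMap.coe_mk, AddHom.coe_mk, Algebra.algebraMap_self, RingHom.id_apply,
      Nat.add_sub_cancel]
    linear_combination this

theorem IsVacuum.eq_zero {p : Params} (hp : Generic p) {f : ℕ → ℕ → ℂ} (hf : IsVacuum p f)
    {m : ℕ} (h0 : f m 0 = 0) (j : ℕ) : f m j = 0 := by
  induction j using Nat.strong_induction_on with
  | _ j ih =>
    rcases j with _ | j
    · exact h0
    · have h := hp.sub_ne_zero (2 * m + j)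
      have h1 := hf m j
      simp only [opD, LinearMap.coe_mk, AddHom.coe_mk, Algebra.algebraMap_self, RingHom.id_apply,
        ih j (by omega), ih (j - 1) (by omega)] at h1
      have h2 : f m (j + 1) * (1 - p.a * p.b * p.c * p.d * p.t ^ (2 * m + j)) = 0 := by
        linear_combination h1
      exact (mul_eq_zero.1 h2).resolve_right h

/-- The relation never mixes different `m`, and genericity lets it be solved for the entry at `j +
1`; so each row is determined by its entry at `j = 0`. The recursions use this to recognize a
transformed boundary vector as the one with shifted parameters. -/
theorem IsVacuum.eq_mul_vacuum {p : Params} (hp : Generic p) {f : ℕ → ℕ → ℂ} (hf : IsVacuum p f)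
    (m j : ℕ) : f m j = f m 0 * vacuum p m j := by
  let g : ℕ → ℕ → ℂ := fun m j => f m j - f m 0 * vacuum p m j
  have hg : IsVacuum p g := by
    intro m j
    have h1 := hf m j
    have h2 := isVacuum_vacuum hp m j
    simp only [opD, LinearMap.coe_mk, AddHom.coe_mk, Algebra.algebraMap_self, RingHom.id_apply, g]
      at h1 h2 ⊢
    linear_combination h1 - f m 0 * h2
  have h0 : g m 0 = 0 := by simp [g, vacuum]
  exact sub_eq_zero.1 (hg.eq_zero hp h0 j)

theorem vacuum_one (p : Params) (m : ℕ) : vacuum p m 1 =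
    -(p.c + p.d - p.c * p.d * (p.a + p.b) * p.t ^ m) /
      (1 - p.a * p.b * p.c * p.d * p.t ^ (2 * m)) := rfl

/-- On `V` the combination `(u⁻¹ + 𝐞) + cd(u + 𝐝)` is the scalar `(1 - cu)(1 - du)/u`. Eliminating
`𝐞` in this way turns the claim into a rational identity. -/
theorem letterOp_right {p : Params} {V : ℕ → ℕ → ℂ} (hV : IsVacuum p V) (x : SignType) (u : ℂˣ)
    (h1 : p.c * u ≠ 1) (h2 : p.d * u ≠ 1) :
    letterOp p x u⁻¹ V = letterOp p x u V +
      ((1 - (u : ℂ) ^ 2) / ((p.c * u - 1) * (p.d * u - 1))) •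
        (if x = -1 then (-(p.c * p.d) : ℂ) • letterOp p 1 u V - (1 : ℂ) • letterOp p (-1) u V
         else if x = 1 then (1 : ℂ) • letterOp p (-1) u V - (-(p.c * p.d) : ℂ) • letterOp p 1 u V
         else 0) := by
  have h1' : (p.c * u - 1 : ℂ) ≠ 0 := fun h => h1 (Units.ext (by push_cast; exact sub_eq_zero.1 h))
  have h2' : (p.d * u - 1 : ℂ) ≠ 0 := fun h => h2 (Units.ext (by push_cast; exact sub_eq_zero.1 h))
  have hu : (u : ℂ) ≠ 0 := u.ne_zero
  funext m j
  have hv : V m (j + 1) = -(p.c * p.d * opD p V m j + (p.c + p.d) * V m j) := by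
    linear_combination hV m j
  cases x
  · change letterOp p 0 u⁻¹ V m j = letterOp p 0 u V m j + _ * 0
    simp only [letterOp_zero, mul_zero, add_zero]
  · change letterOp p (-1) u⁻¹ V m j = letterOp p (-1) u V m j +
      (1 - (u : ℂ) ^ 2) / ((p.c * u - 1) * (p.d * u - 1)) *
        ((-(p.c * p.d) : ℂ) * letterOp p 1 u V m j - (1 : ℂ) * letterOp p (-1) u V m j)
    simp only [letterOp_one, letterOp_neg_one, hv, Units.val_inv_eq_inv_val, inv_inv]
    generalize (u : ℂ) = u, (p.c : ℂ) = c, (p.d : ℂ) = d at *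
    have h1'' : u * c - 1 ≠ 0 := by rwa [mul_comm]
    have h2'' : u * d - 1 ≠ 0 := by rwa [mul_comm]
    field_simp
    ring
  · change letterOp p 1 u⁻¹ V m j = letterOp p 1 u V m j +
      (1 - (u : ℂ) ^ 2) / ((p.c * u - 1) * (p.d * u - 1)) *
        ((1 : ℂ) * letterOp p (-1) u V m j - (-(p.c * p.d) : ℂ) * letterOp p 1 u V m j)
    simp only [letterOp_one, letterOp_neg_one, hv, Units.val_inv_eq_inv_val]
    generalize (u : ℂ) = u, (p.c : ℂ) = c, (p.d : ℂ) = d at *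
    have h1'' : u * c - 1 ≠ 0 := by rwa [mul_comm]
    have h2'' : u * d - 1 ≠ 0 := by rwa [mul_comm]
    field_simp
    ring

/-- At `m = j = 0` the relation for `⟨W|` is built into `opD`, so `f` is arbitrary. -/
theorem letterOp_left (p : Params) (f : ℕ → ℕ → ℂ) (x : SignType) (u : ℂˣ)
    (h1 : u ≠ p.a) (h2 : u ≠ p.b) :
    letterOp p x u⁻¹ f 0 0 = letterOp p x u f 0 0 +
      (((u : ℂ) ^ 2 - 1) / ((u - p.a) * (u - p.b))) *
        (if x = -1 then (1 : ℂ) * letterOp p 1 u f 0 0 - (-(p.a * p.b) : ℂ) * letterOp p (-1) u f 0 0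
         else if x = 1 then (-(p.a * p.b) : ℂ) * letterOp p (-1) u f 0 0 -
          (1 : ℂ) * letterOp p 1 u f 0 0
         else 0) := by
  have h1' : (u - p.a : ℂ) ≠ 0 := fun h => h1 (Units.ext (sub_eq_zero.1 h))
  have h2' : (u - p.b : ℂ) ≠ 0 := fun h => h2 (Units.ext (sub_eq_zero.1 h))
  have hu : (u : ℂ) ≠ 0 := u.ne_zero
  have hv : opD p f 0 0 = -(p.a * p.b) * f 0 1 - (p.a + p.b) * f 0 0 := by
    simp [opD]
  cases x
  · change letterOp p 0 u⁻¹ f 0 0 = letterOp p 0 u f 0 0 + _ * 0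
    simp only [letterOp_zero, mul_zero, add_zero]
  · change letterOp p (-1) u⁻¹ f 0 0 = letterOp p (-1) u f 0 0 +
      ((u : ℂ) ^ 2 - 1) / ((u - p.a) * (u - p.b)) *
        ((1 : ℂ) * letterOp p 1 u f 0 0 - (-(p.a * p.b) : ℂ) * letterOp p (-1) u f 0 0)
    simp only [letterOp_one, letterOp_neg_one, hv, Units.val_inv_eq_inv_val, inv_inv]
    generalize (u : ℂ) = u, (p.a : ℂ) = a, (p.b : ℂ) = b at *
    field_simp
    ring
  · change letterOp p 1 u⁻¹ f 0 0 = letterOp p 1 u f 0 0 +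
      ((u : ℂ) ^ 2 - 1) / ((u - p.a) * (u - p.b)) *
        ((-(p.a * p.b) : ℂ) * letterOp p (-1) u f 0 0 - (1 : ℂ) * letterOp p 1 u f 0 0)
    simp only [letterOp_one, letterOp_neg_one, hv, Units.val_inv_eq_inv_val]
    generalize (u : ℂ) = u, (p.a : ℂ) = a, (p.b : ℂ) = b at *
    field_simp
    ring

/-! ### The matrix product solution -/

/-- The matrix product `⟨W| ∏ A_{w_i}(z_i) |V⟩`. -/
def ansatzVal (p : Params) {N : ℕ} (w : Config N) (z : Fin N → ℂˣ) : ℂ :=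
  matProd p w z (vacuum p) 0 0

/-- The matrix product in the sector with `m` second class particles, as a vector of Laurent
polynomials. -/
def ansatz (p : Params) {N : ℕ} (m : ℕ) (w : Config N) : Laurent N :=
  if stars w = m then
    matProd p w unitX (fun m j => algebraMap ℂ (Laurent N) (vacuum p m j)) 0 0
  else 0

theorem eval_ansatz (p : Params) {N : ℕ} (m : ℕ) (w : Config N) (z : Fin N → ℂˣ) :
    eval (ansatz p m w) z = if stars w = m then ansatzVal p w z else 0 := by
  rw [eval_eq_evalHom, ansatz]
  split_ifs
  · rw [matProd_map]
    have h1 : (fun i => Units.map (evalHom z : Laurent N →* ℂ) (unitX i)) = z := by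
      funext i
      refine Units.ext ?_
      change evalHom z (X i) = z i
      rw [← eval_eq_evalHom, eval_X]
    have h2 : (fun m j => evalHom z (algebraMap ℂ (Laurent N) (vacuum p m j))) = vacuum p := by
      funext m j
      exact AlgHom.commutes _ _
    rw [h1, h2, ansatzVal]
  · exact map_zero _

theorem stars_swapAt {N : ℕ} (i j : Fin N) (w : Config N) : stars (swapAt i j w) = stars w := by
  unfold stars
  refine Finset.card_bij (fun k _ => Equiv.swap i j k) ?_ ?_ ?_
  · intro k hk
    rw [Finset.mem_filter] at hk ⊢
    exact ⟨Finset.mem_univ _, hk.2⟩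
  · intro k _ l _ h
    exact (Equiv.swap i j).injective h
  · intro k hk
    rw [Finset.mem_filter] at hk
    refine ⟨Equiv.swap i j k, ?_, by simp⟩
    rw [Finset.mem_filter]
    exact ⟨Finset.mem_univ _, by simpa [swapAt] using hk.2⟩

theorem stars_update {N : ℕ} (i : Fin N) (w : Config N) (x : SignType) (h : w i ≠ 0) (hx : x ≠ 0) :
    stars (Function.update w i x) = stars w := by
  unfold stars
  congr 1
  ext k
  by_cases hk : k = i
  · subst hk; simp [h, hx]
  · simp [Function.update_of_ne hk]

theorem eq_addLeft {N : ℕ} {Y : Type} (w : Fin (N + 1) → Y) : w = addLeft (w 0) (Fin.tail w) :=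
  (Fin.cons_self_tail w).symm

theorem eq_addRight {N : ℕ} {Y : Type} (w : Fin (N + 1) → Y) :
    w = addRight (Fin.init w) (w (Fin.last N)) :=
  (Fin.snoc_init_self w).symm

theorem update_addLeft {N : ℕ} {Y : Type} (x y : Y) (w : Fin N → Y) :
    Function.update (addLeft x w) 0 y = addLeft y w :=
  Fin.update_cons_zero (α := fun _ => Y) x w y

theorem update_addRight {N : ℕ} {Y : Type} (x y : Y) (w : Fin N → Y) :
    Function.update (addRight w x) (Fin.last N) y = addRight w y :=
  Fin.update_snoc_last (α := fun _ => Y) x w y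

theorem addLeft_zero {N : ℕ} {Y : Type} (x : Y) (w : Fin N → Y) : addLeft x w 0 = x := rfl

theorem addRight_last {N : ℕ} {Y : Type} (x : Y) (w : Fin N → Y) :
    addRight w x (Fin.last N) = x := Fin.snoc_last (α := fun _ => Y) x w

theorem ansatzVal_left (p : Params) {N : ℕ} (i : Fin N) (hi : (i : ℕ) = 0) (w : Config N)
    (z : Fin N → ℂˣ) (h1 : z i ≠ p.a) (h2 : z i ≠ p.b) :
    ansatzVal p w (Function.update z i (z i)⁻¹) =
      KLeft p i (z i) (fun w => ansatzVal p w z) w := by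
  obtain ⟨n, rfl⟩ : ∃ n, N = n + 1 := ⟨N - 1, by have := i.2; omega⟩
  obtain rfl : i = 0 := Fin.ext hi
  obtain ⟨x, w, rfl⟩ : ∃ x w', w = addLeft x w' := ⟨_, _, eq_addLeft w⟩
  obtain ⟨u, z, rfl⟩ : ∃ x z', z = addLeft x z' := ⟨_, _, eq_addLeft z⟩
  have := letterOp_left p (matProd p w z (vacuum p)) x u h1 h2
  simp only [update_addLeft, addLeft_zero, ansatzVal, KLeft, bdryGen, matProd_addLeft]
  rw [this]
  split_ifs with h3 h4
  · rw [h3]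
  · rw [h4]
  · rfl

theorem matProd_add (p : Params) {N : ℕ} (w : Config N) (z : Fin N → ℂˣ) (f g : ℕ → ℕ → ℂ) :
    matProd p w z (f + g) = matProd p w z f + matProd p w z g := by
  induction N with
  | zero => rfl
  | succ N ih => simp only [matProd, ih, map_add]

theorem matProd_smul (p : Params) {N : ℕ} (w : Config N) (z : Fin N → ℂˣ) (r : ℂ) (f : ℕ → ℕ → ℂ) :
    matProd p w z (r • f) = r • matProd p w z f := by
  induction N with
  | zero => rfl
  | succ N ih => simp only [matProd, ih, map_smul]

theorem matProd_sub (p : Params) {N : ℕ} (w : Config N) (z : Fin N → ℂˣ) (f g : ℕ → ℕ → ℂ) :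
    matProd p w z (f - g) = matProd p w z f - matProd p w z g := by
  induction N with
  | zero => rfl
  | succ N ih => simp only [matProd, ih, map_sub]

theorem matProd_zero (p : Params) {N : ℕ} (w : Config N) (z : Fin N → ℂˣ) :
    matProd p w z 0 = 0 := by
  induction N with
  | zero => rfl
  | succ N ih => simp only [matProd, ih, map_zero]

theorem ansatzVal_right {p : Params} (hp : Generic p) {N : ℕ} (i : Fin N) (hi : (i : ℕ) + 1 = N)
    (w : Config N) (z : Fin N → ℂˣ) (h1 : p.c * z i ≠ 1) (h2 : p.d * z i ≠ 1) :
    ansatzVal p w (Function.update z i (z i)⁻¹) =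
      KRight p i (z i) (fun w => ansatzVal p w z) w := by
  obtain ⟨n, rfl⟩ : ∃ n, N = n + 1 := ⟨N - 1, by have := i.2; omega⟩
  obtain rfl : i = Fin.last n := Fin.ext (by simpa using hi)
  obtain ⟨x, w, rfl⟩ : ∃ x w', w = addRight w' x := ⟨_, _, eq_addRight w⟩
  obtain ⟨u, z, rfl⟩ : ∃ x z', z = addRight z' x := ⟨_, _, eq_addRight z⟩
  rw [addRight_last] at h1 h2
  have := letterOp_right (isVacuum_vacuum hp) x u h1 h2
  simp only [update_addRight, addRight_last, ansatzVal, KRight, bdryGen, matProd_addRight]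
  rw [this, matProd_add, matProd_smul]
  split_ifs with h3 h4
  · simp only [matProd_sub, matProd_smul, h3]; rfl
  · simp only [matProd_sub, matProd_smul, h4]; rfl
  · simp [matProd_zero]

theorem ansatzVal_bulk (p : Params) {N : ℕ} (i j : Fin N) (hij : (i : ℕ) + 1 = j) (w : Config N)
    (z : Fin N → ℂˣ) (h : p.t * z i ≠ z j) :
    ansatzVal p w (swapAt i j z) = Rmat p i j (z i / z j) (fun w => ansatzVal p w z) w := by
  simp only [ansatzVal, Rmat, bulkGen]
  rw [matProd_bulk p w z _ i j hij h]
  rfl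

theorem exchangeReflection_ansatz {p : Params} (hp : Generic p) (N m : ℕ) :
    ExchangeReflection p (ansatz p m : Config N → Laurent N) where
  bulk i j hij z hz := by
    funext w
    simp only [evalVec, eval_ansatz, Rmat, bulkGen, stars_swapAt]
    split_ifs with hw
    · exact (ansatzVal_bulk p i j hij w z hz).symm
    · simp
  left i hi z h1 h2 := by
    funext w
    simp only [evalVec, eval_ansatz, KLeft, bdryGen]
    have h3 := ansatzVal_left p i hi w z h1 h2
    simp only [KLeft, bdryGen] at h3
    rcases eq_or_ne (w i) 0 with h0 | h0
    · simp only [h0, if_false, mul_zero, add_zero, show ¬((0 : SignType) = -1) by decide,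
        show ¬((0 : SignType) = 1) by decide] at h3 ⊢
      rw [h3]
    · rw [stars_update i w 1 h0 (by decide), stars_update i w (-1) h0 (by decide)]
      split_ifs at h3 ⊢ <;> simp_all
  right i hi z h1 h2 := by
    funext w
    simp only [evalVec, eval_ansatz, KRight, bdryGen]
    have h3 := ansatzVal_right hp i hi w z h1 h2
    simp only [KRight, bdryGen] at h3
    rcases eq_or_ne (w i) 0 with h0 | h0
    · simp only [h0, if_false, mul_zero, add_zero, show ¬((0 : SignType) = -1) by decide,
        show ¬((0 : SignType) = 1) by decide] at h3 ⊢
      rw [h3]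
    · rw [stars_update i w 1 h0 (by decide), stars_update i w (-1) h0 (by decide)]
      split_ifs at h3 ⊢ <;> simp_all

/-! ### Recursions of the matrix product -/

theorem matProd_congr_right {p q : Params} (ha : p.a = q.a) (hb : p.b = q.b) (ht : p.t = q.t)
    {N : ℕ} (w : Config N) (z : Fin N → ℂˣ) (V : ℕ → ℕ → ℂ) :
    matProd p w z V = matProd q w z V := by
  induction N with
  | zero => rfl
  | succ N ih =>
    have hl : ∀ (x : SignType) (u : ℂˣ) (f : ℕ → ℕ → ℂ), letterOp p x u f = letterOp q x u f := by
      intro x u f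
      funext m j
      cases x <;> simp [letterOp, opA, opD, opE, ha, hb, ht]
    simp only [matProd, ih, hl]

theorem stars_eq_tail {N : ℕ} (w : Config (N + 1)) :
    stars w = (if w 0 = 0 then 1 else 0) + stars (Fin.tail w) := by
  simp only [stars, Finset.card_filter, Fin.sum_univ_succ]
  rfl

/-- The matrix product depends on `V m j` only for `m` the number of second class particles
to the right of the current site. -/
theorem matProd_of_eq_mul (p : Params) {N : ℕ} (w : Config N) (z : Fin N → ℂˣ)
    {V V' : ℕ → ℕ → ℂ} {k : ℕ → ℂ} (h : ∀ m j, V m j = k m * V' m j) (m j : ℕ) :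
    matProd p w z V m j = k (m + stars w) * matProd p w z V' m j := by
  induction N generalizing m j with
  | zero =>
    have hw : stars w = 0 := by simp [stars]
    rw [hw]
    exact h m j
  | succ N ih =>
    rw [stars_eq_tail]
    have ih' := ih (Fin.tail w) (Fin.tail z)
    simp only [matProd]
    generalize matProd p (Fin.tail w) (Fin.tail z) V = f at ih' ⊢
    generalize matProd p (Fin.tail w) (Fin.tail z) V' = g at ih' ⊢
    rcases hx : w 0
    · change letterOp p 0 _ f m j = _ * letterOp p 0 _ g m j
      rw [letterOp_zero, letterOp_zero, ih', show (SignType.zero = 0) from rfl, if_pos rfl,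
        ← add_assoc]
      ring
    · change letterOp p (-1) _ f m j = _ * letterOp p (-1) _ g m j
      rw [letterOp_neg_one, letterOp_neg_one, ih', ih', if_neg (by decide), zero_add]
      ring
    · change letterOp p 1 _ f m j = _ * letterOp p 1 _ g m j
      rw [letterOp_one, letterOp_one, if_neg (by decide), zero_add]
      simp only [opD, LinearMap.coe_mk, AddHom.coe_mk, ih']
      ring

/-- `(𝐞 + t²cd𝐝 + tc + td)A = tA(𝐞 + cd𝐝 + c + d)`. -/
theorem isVacuum_opA {p : Params} (hp : Generic p) :
    IsVacuum ⟨p.a, p.b, p.t * p.c, p.t * p.d, p.t⟩ (opA p (vacuum p)) := by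
  intro m j
  have h := isVacuum_vacuum hp (m + 1) j
  rcases j with _ | j
  · simp only [opD, opA, LinearMap.coe_mk, AddHom.coe_mk, Algebra.algebraMap_self, RingHom.id_apply,
      Units.val_mul] at h ⊢
    linear_combination p.t * h
  · simp only [opD, opA, LinearMap.coe_mk, AddHom.coe_mk, Algebra.algebraMap_self, RingHom.id_apply,
      Units.val_mul, Nat.add_sub_cancel] at h ⊢
    linear_combination p.t ^ (j + 2) * h

theorem Generic.mul_cd {p : Params} (hp : Generic p) :
    Generic ⟨p.a, p.b, p.t * p.c, p.t * p.d, p.t⟩ := fun n h => hp (n + 2) (by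
  rw [← h]; simp only [pow_succ]; ac_rfl)

theorem Generic.mul_c {p : Params} (hp : Generic p) :
    Generic ⟨p.a, p.b, p.t * p.c, p.d, p.t⟩ := fun n h => hp (n + 1) (by
  rw [← h]; simp only [pow_succ]; ac_rfl)

theorem Generic.mul_d {p : Params} (hp : Generic p) :
    Generic ⟨p.a, p.b, p.c, p.t * p.d, p.t⟩ := fun n h => hp (n + 1) (by
  rw [← h]; simp only [pow_succ]; ac_rfl)

theorem Generic.mul_ab {p : Params} (hp : Generic p) :
    Generic ⟨p.t * p.a, p.t * p.b, p.c, p.d, p.t⟩ := fun n h => hp (n + 2) (by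
  rw [← h]; simp only [pow_succ]; ac_rfl)

theorem Generic.mul_a {p : Params} (hp : Generic p) :
    Generic ⟨p.t * p.a, p.b, p.c, p.d, p.t⟩ := fun n h => hp (n + 1) (by
  rw [← h]; simp only [pow_succ]; ac_rfl)

theorem Generic.mul_b {p : Params} (hp : Generic p) :
    Generic ⟨p.a, p.t * p.b, p.c, p.d, p.t⟩ := fun n h => hp (n + 1) (by
  rw [← h]; simp only [pow_succ]; ac_rfl)

theorem ansatzVal_addRight_zero {p : Params} (hp : Generic p) {N : ℕ} (w : Config N)
    (z : Fin N → ℂˣ) (x : ℂˣ) :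
    ansatzVal p (addRight w 0) (addRight z x) =
      ansatzVal ⟨p.a, p.b, p.t * p.c, p.t * p.d, p.t⟩ w z := by
  rw [ansatzVal, matProd_addRight, letterOp_zero']
  have h : opA p (vacuum p) = vacuum ⟨p.a, p.b, p.t * p.c, p.t * p.d, p.t⟩ := by
    funext m j
    rw [(isVacuum_opA hp).eq_mul_vacuum hp.mul_cd]
    simp [opA, vacuum]
  rw [h, ansatzVal]
  exact congrFun (congrFun (matProd_congr_right (by rfl) (by rfl) (by rfl) w z _) 0) 0

/-- Shifting the number of second class particles amounts to scaling `a` and `b`. -/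
theorem matProd_succ (p : Params) {N : ℕ} (w : Config N) (z : Fin N → ℂˣ) (V : ℕ → ℕ → ℂ)
    (m j : ℕ) :
    matProd p w z V (m + 1) j =
      matProd ⟨p.t * p.a, p.t * p.b, p.c, p.d, p.t⟩ w z (fun m j => V (m + 1) j) m j := by
  induction N generalizing m j with
  | zero => rfl
  | succ N ih =>
    simp only [matProd]
    have ih' := funext fun m => funext fun j => ih (Fin.tail w) (Fin.tail z) m j
    rw [← ih']
    generalize matProd p (Fin.tail w) (Fin.tail z) V = f
    cases w 0 <;> simp [letterOp, opA, opD, opE]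
    ring

/-- `⟨W|A` moves the row index from `m` to `m + 1`. The shifted array `V` solves the relation for
`ta, tb`, and its entries at `j = 0` are still 1 because `vacuum` is normalized in every row. -/
theorem ansatzVal_addLeft_zero {p : Params} (hp : Generic p) {N : ℕ} (w : Config N)
    (z : Fin N → ℂˣ) (x : ℂˣ) :
    ansatzVal p (addLeft 0 w) (addLeft x z) =
      ansatzVal ⟨p.t * p.a, p.t * p.b, p.c, p.d, p.t⟩ w z := by
  rw [ansatzVal, matProd_addLeft, letterOp_zero, matProd_succ]
  have h : (fun m j => vacuum p (m + 1) j) = vacuum ⟨p.t * p.a, p.t * p.b, p.c, p.d, p.t⟩ := by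
    have hv : IsVacuum ⟨p.t * p.a, p.t * p.b, p.c, p.d, p.t⟩ (fun m j => vacuum p (m + 1) j) := by
      intro m j
      have h := isVacuum_vacuum hp (m + 1) j
      simp only [opD, LinearMap.coe_mk, AddHom.coe_mk, Algebra.algebraMap_self, RingHom.id_apply,
        Units.val_mul] at h ⊢
      linear_combination h
    funext m j
    rw [hv.eq_mul_vacuum hp.mul_ab]
    simp [vacuum]
  rw [h]
  simp [ansatzVal]

theorem ansatzVal_right_combination {p : Params} (hp : Generic p) {N : ℕ} (w : Config N)
    (z : Fin N → ℂˣ) (x : ℂˣ) :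
    ansatzVal p (addRight w (-1)) (addRight z x) +
        p.c * p.d * ansatzVal p (addRight w 1) (addRight z x) =
      (1 - p.c * x) * (1 - p.d * x) / x * ansatzVal p w z := by
  have h : letterOp p (-1) x (vacuum p) = ((1 - p.c * x) * (1 - p.d * x) / x : ℂ) • vacuum p -
      (p.c * p.d : ℂ) • letterOp p 1 x (vacuum p) := by
    funext m j
    have := isVacuum_vacuum hp m j
    have hx : (x : ℂ) ≠ 0 := x.ne_zero
    simp only [Pi.sub_apply, Pi.smul_apply, smul_eq_mul, letterOp_neg_one, letterOp_one,
      Units.val_inv_eq_inv_val]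
    field_simp
    linear_combination x * this
  simp only [ansatzVal, matProd_addRight]
  rw [h, matProd_sub, matProd_smul, matProd_smul]
  simp only [Pi.sub_apply, Pi.smul_apply, smul_eq_mul]
  ring

theorem ansatzVal_left_combination (p : Params) {N : ℕ} (w : Config N)
    (z : Fin N → ℂˣ) (x : ℂˣ) :
    p.a * p.b * ansatzVal p (addLeft (-1) w) (addLeft x z) +
        ansatzVal p (addLeft 1 w) (addLeft x z) =
      (p.a - x) * (p.b - x) / x * ansatzVal p w z := by
  have hx : (x : ℂ) ≠ 0 := x.ne_zero
  simp only [ansatzVal, matProd_addLeft, letterOp_neg_one, letterOp_one, Units.val_inv_eq_inv_val,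
    opD, LinearMap.coe_mk, AddHom.coe_mk, Algebra.algebraMap_self, RingHom.id_apply, pow_zero,
    mul_zero, add_zero, sub_self]
  field_simp
  ring

/-- `(𝐞 + tcd𝐝 + tc + d)(c + 𝐞) = (𝐞 + tc)(𝐞 + cd𝐝 + c + d)`, by the oscillator relation. -/
theorem isVacuum_letterOp_inv_c {p : Params} (hp : Generic p) :
    IsVacuum ⟨p.a, p.b, p.t * p.c, p.d, p.t⟩ (letterOp p (-1) p.c⁻¹ (vacuum p)) := by
  intro m j
  have h1 := isVacuum_vacuum hp m j
  have h2 := isVacuum_vacuum hp m (j + 1)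
  have h3 := isVacuum_vacuum hp m (j - 1)
  rcases j with _ | j
  · simp only [opD, letterOp_neg_one, LinearMap.coe_mk, AddHom.coe_mk, Algebra.algebraMap_self,
      RingHom.id_apply, Units.val_mul, inv_inv, Nat.add_sub_cancel]
      at h1 h2 h3 ⊢
    linear_combination h2 + p.t * p.c * h1
  · simp only [opD, letterOp_neg_one, LinearMap.coe_mk, AddHom.coe_mk, Algebra.algebraMap_self,
      RingHom.id_apply, Units.val_mul, inv_inv, Nat.add_sub_cancel]
      at h1 h2 h3 ⊢
    linear_combination h2 + p.t * p.c * h1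

/-- Exchange of `c` and `d`. -/
def Params.swapCD (p : Params) : Params := ⟨p.a, p.b, p.d, p.c, p.t⟩

theorem vacuum_swapCD {p : Params} (hp : Generic p) : vacuum p.swapCD = vacuum p := by
  have hp' : Generic p.swapCD := fun n h => hp n (by
    rw [← h]; simp only [Params.swapCD]; ac_rfl)
  have h : IsVacuum p (vacuum p.swapCD) := by
    intro m j
    have := isVacuum_vacuum hp' m j
    simp only [opD, LinearMap.coe_mk, AddHom.coe_mk, Algebra.algebraMap_self, RingHom.id_apply,
      Params.swapCD] at this ⊢
    linear_combination this
  funext m j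
  rw [h.eq_mul_vacuum hp]
  simp [vacuum]

/-- At `z = c⁻¹` the last matrix is `c + 𝐞`. The constant is the entry of `(c + 𝐞)V` at `j = 0`,
namely `c + vacuum p m 1`. It varies with the row `m`, and `matProd_of_eq_mul` selects the row `m =
stars w`. -/
theorem ansatzVal_inv_c {p : Params} (hp : Generic p) {N : ℕ} (w : Config N)
    (z : Fin N → ℂˣ) :
    ansatzVal p (addRight w (-1)) (addRight z p.c⁻¹) =
      constR p (stars w) p.c * ansatzVal ⟨p.a, p.b, p.t * p.c, p.d, p.t⟩ w z := by
  have h : ∀ m j, letterOp p (-1) p.c⁻¹ (vacuum p) m j =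
      constR p m p.c * vacuum ⟨p.a, p.b, p.t * p.c, p.d, p.t⟩ m j := by
    intro m j
    rw [(isVacuum_letterOp_inv_c hp).eq_mul_vacuum hp.mul_c]
    congr 1
    rw [letterOp_neg_one, vacuum_one, vacuum, constR]
    have h1 := hp.sub_ne_zero (2 * m)
    have hc : (p.c : ℂ) ≠ 0 := p.c.ne_zero
    simp only [inv_inv, pow_mul] at h1 ⊢
    generalize (p.t : ℂ) = t, (p.a : ℂ) = a, (p.b : ℂ) = b, (p.c : ℂ) = c, (p.d : ℂ) = d at *
    generalize hK : 1 - a * b * c * d * (t ^ 2) ^ m = K at *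
    field_simp
    linear_combination (-c) * hK
  rw [ansatzVal, matProd_addRight, matProd_of_eq_mul p w z h, zero_add, ansatzVal]
  congr 1
  exact congrFun (congrFun (matProd_congr_right (by rfl) (by rfl) (by rfl) w z _) 0) 0

theorem ansatzVal_swapCD {p : Params} (hp : Generic p) {N : ℕ} (w : Config N) (z : Fin N → ℂˣ) :
    ansatzVal p.swapCD w z = ansatzVal p w z := by
  rw [ansatzVal, vacuum_swapCD hp, ansatzVal]
  exact congrFun (congrFun (matProd_congr_right (by rfl) (by rfl) (by rfl) w z _) 0) 0

theorem ansatzVal_inv_d {p : Params} (hp : Generic p) {N : ℕ} (w : Config N)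
    (z : Fin N → ℂˣ) :
    ansatzVal p (addRight w (-1)) (addRight z p.d⁻¹) =
      constR p (stars w) p.d * ansatzVal ⟨p.a, p.b, p.c, p.t * p.d, p.t⟩ w z := by
  have hp' : Generic p.swapCD := fun n h => hp n (by
    rw [← h]; simp only [Params.swapCD]; ac_rfl)
  have h := ansatzVal_inv_c hp' w z
  rw [ansatzVal_swapCD hp] at h
  have h1 : constR p.swapCD (stars w) p.swapCD.c = constR p (stars w) p.d := by
    simp only [constR, Params.swapCD]
    ring
  rw [h1] at h
  exact h.trans (congrArg _ (ansatzVal_swapCD hp.mul_d w z))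

/-- The intertwiner attached to `⟨W| (a⁻¹ + e)`. -/
def leftShift (p : Params) (f : ℕ → ℕ → ℂ) : ℕ → ℕ → ℂ :=
  fun m j => (p.a : ℂ)⁻¹ * f m j + p.t ^ m * f m (j + 1)

/-- Since `𝐞A^m = t^m A^m 𝐞`, the shift replaces `⟨W|` by `⟨W|(a⁻¹ + 𝐞)`. This row vector satisfies
the left boundary relation with `ta` in place of `a`, so the shift intertwines the two actions of
every letter. -/
theorem matProd_leftShift (p : Params) {N : ℕ} (w : Config N) (z : Fin N → ℂˣ) (V : ℕ → ℕ → ℂ) :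
    matProd ⟨p.t * p.a, p.b, p.c, p.d, p.t⟩ w z (leftShift p V) = leftShift p (matProd p w z V) := by
  induction N with
  | zero => rfl
  | succ N ih =>
    simp only [matProd, ih]
    generalize matProd p (Fin.tail w) (Fin.tail z) V = f
    have ha : (p.a : ℂ) ≠ 0 := p.a.ne_zero
    funext m j
    rcases w 0
    · simp only [letterOp, leftShift, opA, LinearMap.coe_mk, AddHom.coe_mk,
        Algebra.algebraMap_self, RingHom.id_apply]
      ring
    · simp only [letterOp, leftShift, opE, LinearMap.coe_mk, AddHom.coe_mk, LinearMap.add_apply,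
        LinearMap.smul_apply, LinearMap.id_apply, Pi.add_apply, Pi.smul_apply, smul_eq_mul]
      ring
    · simp only [letterOp, leftShift, opD, LinearMap.coe_mk, AddHom.coe_mk, LinearMap.add_apply,
        LinearMap.smul_apply, LinearMap.id_apply, Pi.add_apply, Pi.smul_apply, smul_eq_mul,
        Algebra.algebraMap_self, RingHom.id_apply, Units.val_mul]
      rcases j with _ | j
      · simp only [Nat.zero_add, pow_zero, sub_self, zero_mul]
        field_simp
        ring
      · simp only [Nat.add_sub_cancel]
        field_simp
        ring

theorem isVacuum_leftShift {p : Params} (hp : Generic p) :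
    IsVacuum ⟨p.t * p.a, p.b, p.c, p.d, p.t⟩ (leftShift p (vacuum p)) := by
  intro m j
  have ha : (p.a : ℂ) ≠ 0 := p.a.ne_zero
  have h1 := isVacuum_vacuum hp m j
  have h2 := isVacuum_vacuum hp m (j + 1)
  rcases j with _ | j
  · simp only [opD, leftShift, LinearMap.coe_mk, AddHom.coe_mk, Algebra.algebraMap_self,
      RingHom.id_apply, Units.val_mul, Nat.add_sub_cancel] at h1 h2 ⊢
    field_simp
    linear_combination h1 + p.a * p.t ^ m * h2
  · simp only [opD, leftShift, LinearMap.coe_mk, AddHom.coe_mk, Algebra.algebraMap_self,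
      RingHom.id_apply, Units.val_mul, Nat.add_sub_cancel] at h1 h2 ⊢
    field_simp
    linear_combination h1 + p.a * p.t ^ m * h2

/-- A leading ∘ at `z_1 = a` inserts `a⁻¹ + 𝐞` next to `⟨W|`. The intertwiner carries it through to
`V`, where it produces the row constants `a⁻¹ + t^m vacuum p m 1 = constL p m a`. -/
theorem ansatzVal_a {p : Params} (hp : Generic p) {N : ℕ} (w : Config N) (z : Fin N → ℂˣ) :
    ansatzVal p (addLeft (-1) w) (addLeft p.a z) =
      constL p (stars w) p.a * ansatzVal ⟨p.t * p.a, p.b, p.c, p.d, p.t⟩ w z := by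
  have h : ∀ m j, leftShift p (vacuum p) m j =
      constL p m p.a * vacuum ⟨p.t * p.a, p.b, p.c, p.d, p.t⟩ m j := by
    intro m j
    rw [(isVacuum_leftShift hp).eq_mul_vacuum hp.mul_a]
    congr 1
    rw [leftShift, vacuum_one, vacuum, constL]
    have h1 := hp.sub_ne_zero (2 * m)
    have ha : (p.a : ℂ) ≠ 0 := p.a.ne_zero
    simp only [pow_mul] at h1 ⊢
    generalize (p.t : ℂ) = t, (p.a : ℂ) = a, (p.b : ℂ) = b, (p.c : ℂ) = c, (p.d : ℂ) = d at *
    generalize hK : 1 - a * b * c * d * (t ^ 2) ^ m = K at *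
    field_simp
    linear_combination (-1 : ℂ) * hK
  have h2 := congrFun (congrFun (matProd_leftShift p w z (vacuum p)) 0) 0
  rw [matProd_of_eq_mul _ w z h, zero_add] at h2
  rw [ansatzVal, matProd_addLeft, letterOp_neg_one, ansatzVal, h2, leftShift]
  simp

/-- Exchange of `a` and `b`. -/
def Params.swapAB (p : Params) : Params := ⟨p.b, p.a, p.c, p.d, p.t⟩

theorem ansatzVal_swapAB {p : Params} (hp : Generic p) {N : ℕ} (w : Config N) (z : Fin N → ℂˣ) :
    ansatzVal p.swapAB w z = ansatzVal p w z := by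
  have hD : ∀ f : ℕ → ℕ → ℂ, opD p.swapAB f = opD p f := by
    intro f; funext m j
    simp only [opD, LinearMap.coe_mk, AddHom.coe_mk, Params.swapAB, Algebra.algebraMap_self,
      RingHom.id_apply]
    ring
  have hp' : Generic p.swapAB := fun n h => hp n (by
    rw [← h]; simp only [Params.swapAB]; ac_rfl)
  have hv : vacuum p.swapAB = vacuum p := by
    have h : IsVacuum p (vacuum p.swapAB) := fun m j => by
      have := isVacuum_vacuum hp' m j
      rwa [hD] at this
    funext m j
    rw [h.eq_mul_vacuum hp]
    simp [vacuum]
  have hm : ∀ V : ℕ → ℕ → ℂ, matProd p.swapAB w z V = matProd p w z V := by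
    intro V
    induction N with
    | zero => rfl
    | succ N ih =>
      have hl : ∀ (x : SignType) (u : ℂˣ) (f : ℕ → ℕ → ℂ),
          letterOp p.swapAB x u f = letterOp p x u f := by
        intro x u f
        cases x
        · rfl
        · rfl
        · simp [letterOp, hD]
      simp only [matProd, ih, hl]
  rw [ansatzVal, hv, hm, ansatzVal]

theorem ansatzVal_b {p : Params} (hp : Generic p) {N : ℕ} (w : Config N) (z : Fin N → ℂˣ) :
    ansatzVal p (addLeft (-1) w) (addLeft p.b z) =
      constL p (stars w) p.b * ansatzVal ⟨p.a, p.t * p.b, p.c, p.d, p.t⟩ w z := by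
  have hp' : Generic p.swapAB := fun n h => hp n (by
    rw [← h]; simp only [Params.swapAB]; ac_rfl)
  have h := ansatzVal_a hp' w z
  rw [ansatzVal_swapAB hp] at h
  have h1 : constL p.swapAB (stars w) p.swapAB.a = constL p (stars w) p.b := by
    simp only [constL, Params.swapAB]
    ring
  rw [h1] at h
  exact h.trans (congrArg _ (ansatzVal_swapAB hp.mul_b w z))

/-! ### The exchange-reflection equations as identities of Laurent polynomials -/

/-- The operator `t^{1/2} 𝐞` on vectors of Laurent polynomials. -/
def bulkLaurent (p : Params) {N : ℕ} (i j : Fin N) (Ψ : Config N → Laurent N) (w : Config N) :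
    Laurent N :=
  rate p.t (w j) (w i) • Ψ (swapAt i j w) - rate p.t (w i) (w j) • Ψ w

/-- The operator `𝐟(ρ, σ)` on vectors of Laurent polynomials. -/
def bdryLaurent (ρ σ : ℂ) {N : ℕ} (i : Fin N) (Ψ : Config N → Laurent N) (w : Config N) :
    Laurent N :=
  if w i = -1 then ρ • Ψ (Function.update w i 1) - σ • Ψ w
  else if w i = 1 then σ • Ψ (Function.update w i (-1)) - ρ • Ψ w
  else 0

theorem evalHom_bulkLaurent (p : Params) {N : ℕ} (i j : Fin N) (Ψ : Config N → Laurent N)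
    (w : Config N) (z : Fin N → ℂˣ) :
    evalHom z (bulkLaurent p i j Ψ w) = bulkGen p.t i j (evalVec Ψ z) w := by
  simp [bulkLaurent, bulkGen, evalVec, eval_eq_evalHom]

theorem evalHom_bdryLaurent (ρ σ : ℂ) {N : ℕ} (i : Fin N) (Ψ : Config N → Laurent N)
    (w : Config N) (z : Fin N → ℂˣ) :
    evalHom z (bdryLaurent ρ σ i Ψ w) = bdryGen ρ σ i (evalVec Ψ z) w := by
  simp only [bdryLaurent, bdryGen, evalVec, eval_eq_evalHom]
  split_ifs <;> simp

theorem evalHom_X {N : ℕ} (i : Fin N) (z : Fin N → ℂˣ) : evalHom z (X i) = z i := by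
  rw [← eval_eq_evalHom, eval_X]

theorem coeff_X {N : ℕ} (i j : Fin N) :
    (X i).coeff (Pi.single j 1) = if i = j then 1 else 0 := by
  rw [X, AddMonoidAlgebra.coeff_single, Finsupp.single_apply]
  congr 1
  rw [eq_iff_iff]
  refine ⟨fun h => ?_, fun h => by rw [h]⟩
  by_contra hij
  have := congrFun h i
  simp [Pi.single_eq_of_ne hij] at this

theorem coeff_one_single {N : ℕ} (j : Fin N) : (1 : Laurent N).coeff (Pi.single j 1) = 0 := by
  rw [AddMonoidAlgebra.one_def, AddMonoidAlgebra.coeff_single, Finsupp.single_apply, if_neg]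
  intro h
  have := congrFun h j
  simp at this

theorem smul_X_sub_X_ne_zero {N : ℕ} {i j : Fin N} (h : i ≠ j) (t : ℂˣ) :
    (t : ℂ) • X i - X j ≠ 0 := by
  intro h'
  have := congrArg (fun f : Laurent N => f.coeff (Pi.single i 1)) h'
  simp [coeff_X, h.symm] at this

theorem X_sub_smul_one_ne_zero {N : ℕ} (i : Fin N) (r : ℂ) : X i - r • 1 ≠ 0 := by
  intro h'
  have := congrArg (fun f : Laurent N => f.coeff (Pi.single i 1)) h'
  simp [coeff_X, coeff_one_single] at this

theorem smul_X_sub_one_ne_zero {N : ℕ} (i : Fin N) (c : ℂˣ) : (c : ℂ) • X i - 1 ≠ 0 := by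
  intro h'
  have := congrArg (fun f : Laurent N => f.coeff (Pi.single i 1)) h'
  simp [coeff_X, coeff_one_single] at this

theorem swapAt_eq_self {N : ℕ} {Y : Type} {i j : Fin N} {x : Fin N → Y} (h : x i = x j) :
    swapAt i j x = x := by
  funext k
  simp only [swapAt]
  by_cases h1 : k = i
  · subst h1; simp [h]
  · by_cases h2 : k = j
    · subst h2; simp [h]
    · rw [Equiv.swap_apply_of_ne_of_ne h1 h2]

namespace ExchangeReflection

variable {p : Params} {N : ℕ} {Ψ : Config N → Laurent N}

theorem bulk_identity (h : ExchangeReflection p Ψ) {i j : Fin N} (hij : (i : ℕ) + 1 = j)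
    (w : Config N) :
    ((p.t : ℂ) • X i - X j) * (swapVar i j (Ψ w) - Ψ w) = (X i - X j) * bulkLaurent p i j Ψ w := by
  have hne : i ≠ j := fun h => by rw [h] at hij; omega
  -- The equations are known only away from the pole `t z_i = z_j`. An additional factor `t z_i -
  -- z_j` makes both sides vanish there, and it can be cancelled in the domain of Laurent
  -- polynomials.
  refine mul_left_cancel₀ (smul_X_sub_X_ne_zero hne p.t) (eval_injective fun z => ?_)
  simp only [eval_eq_evalHom, map_mul, map_sub, map_smul, evalHom_X, evalHom_bulkLaurent,
    smul_eq_mul]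
  rw [← eval_eq_evalHom, ← eval_eq_evalHom, eval_swapVar]
  by_cases hz : p.t * z i = z j
  · have : (p.t * z i : ℂ) = z j := by rw [← hz, Units.val_mul]
    rw [this]; ring
  · have h' : (p.t * z i - z j : ℂ) ≠ 0 := fun h0 => hz (Units.ext (by
      push_cast; exact sub_eq_zero.1 h0))
    have h1 : eval (Ψ w) (swapAt i j z) = _ := (congrFun (h.bulk i j hij z hz) w).symm
    have hv : (z j : ℂ) ≠ 0 := (z j).ne_zero
    rw [h1, Rmat, evalVec]
    have hx : ((z i : ℂ) / z j - 1) / (p.t * ((z i : ℂ) / z j) - 1) =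
        (z i - z j) / (p.t * z i - z j) := by
      have : (p.t * ((z i : ℂ) / z j) - 1) = (p.t * z i - z j) / z j := by field_simp
      rw [this]; field_simp
    rw [hx, add_sub_cancel_left, ← mul_assoc (p.t * z i - z j : ℂ) ((z i - z j) / _),
      mul_div_cancel₀ _ h']

theorem left_identity (h : ExchangeReflection p Ψ) {i : Fin N} (hi : (i : ℕ) = 0) (w : Config N) :
    (X i - (p.a : ℂ) • 1) * (X i - (p.b : ℂ) • 1) * (invVar i (Ψ w) - Ψ w) =
      (X i * X i - 1) * bdryLaurent 1 (-(p.a * p.b)) i Ψ w := by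
  refine mul_left_cancel₀ (mul_ne_zero (X_sub_smul_one_ne_zero i p.a)
    (X_sub_smul_one_ne_zero i p.b)) (eval_injective fun z => ?_)
  simp only [eval_eq_evalHom, map_mul, map_sub, map_smul, evalHom_X, evalHom_bdryLaurent,
    smul_eq_mul, map_one, mul_one]
  rw [← eval_eq_evalHom, ← eval_eq_evalHom, eval_invVar]
  by_cases h1 : z i = p.a
  · rw [h1]; ring
  by_cases h2 : z i = p.b
  · rw [h2]; ring
  have h1' : (z i - p.a : ℂ) ≠ 0 := fun h => h1 (Units.ext (sub_eq_zero.1 h))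
  have h2' : (z i - p.b : ℂ) ≠ 0 := fun h => h2 (Units.ext (sub_eq_zero.1 h))
  have h3 : eval (Ψ w) (Function.update z i (z i)⁻¹) = _ :=
    (congrFun (h.left i hi z h1 h2) w).symm
  rw [h3, KLeft, evalVec]
  field_simp
  ring

theorem right_identity (h : ExchangeReflection p Ψ) {i : Fin N} (hi : (i : ℕ) + 1 = N)
    (w : Config N) :
    ((p.c : ℂ) • X i - 1) * ((p.d : ℂ) • X i - 1) * (invVar i (Ψ w) - Ψ w) =
      (1 - X i * X i) * bdryLaurent (-(p.c * p.d)) 1 i Ψ w := by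
  refine mul_left_cancel₀ (mul_ne_zero (smul_X_sub_one_ne_zero i p.c)
    (smul_X_sub_one_ne_zero i p.d)) (eval_injective fun z => ?_)
  simp only [eval_eq_evalHom, map_mul, map_sub, map_smul, evalHom_X, evalHom_bdryLaurent,
    smul_eq_mul, map_one]
  rw [← eval_eq_evalHom, ← eval_eq_evalHom, eval_invVar]
  by_cases h1 : p.c * z i = 1
  · have : (p.c * z i : ℂ) = 1 := by rw [← Units.val_mul, h1, Units.val_one]
    rw [this]; ring
  by_cases h2 : p.d * z i = 1
  · have : (p.d * z i : ℂ) = 1 := by rw [← Units.val_mul, h2, Units.val_one]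
    rw [this]; ring
  have h1' : (p.c * z i - 1 : ℂ) ≠ 0 := fun h => h1 (Units.ext (by push_cast; exact sub_eq_zero.1 h))
  have h2' : (p.d * z i - 1 : ℂ) ≠ 0 := fun h => h2 (Units.ext (by push_cast; exact sub_eq_zero.1 h))
  have h3 : eval (Ψ w) (Function.update z i (z i)⁻¹) = _ :=
    (congrFun (h.right i hi z h1 h2) w).symm
  rw [h3, KRight, evalVec, add_sub_cancel_left,
    ← mul_assoc ((p.c * z i - 1) * (p.d * z i - 1) : ℂ) ((1 - (z i : ℂ) ^ 2) / _),
    mul_div_cancel₀ _ (mul_ne_zero h1' h2')]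
  ring

/-! ### The action of the Noumi representation on the components -/

/-- The exchange equation identifies the divided difference in `noumiBulk` with the generator.
Consequently the Noumi operator sends `Ψ w` to the swapped component if `w j < w i`, and to `t • Ψ
w` if the letters agree. -/
theorem noumiBulk_eq (h : ExchangeReflection p Ψ) {i j : Fin N} (hij : (i : ℕ) + 1 = j)
    (w : Config N) :
    noumiBulk p i j (Ψ w) = (p.t : ℂ) • Ψ w + bulkLaurent p i j Ψ w := by
  have hne : i ≠ j := fun h => by rw [h] at hij; omega
  have h1 := mul_exactDiv (X_sub_X_dvd_sub_swapVar i j (Ψ w))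
  have h2 := h.bulk_identity hij w
  rw [noumiBulk, sub_eq_add_neg]
  congr 1
  refine mul_left_cancel₀ (X_sub_X_ne_zero hne) ?_
  linear_combination (-((p.t : ℂ) • X i - X j)) * h1 + h2

theorem noumiLeft_eq (h : ExchangeReflection p Ψ) {i : Fin N} (hi : (i : ℕ) = 0) (w : Config N) :
    noumiLeft p i (Ψ w) = (-(p.a * p.b) : ℂ) • Ψ w + bdryLaurent 1 (-(p.a * p.b)) i Ψ w := by
  have h1 := mul_exactDiv (X_sub_Xinv_dvd_sub_invVar i (Ψ w))
  have h2 := h.left_identity hi w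
  have h3 := X_mul_Xinv i
  rw [noumiLeft, sub_eq_add_neg]
  congr 1
  refine mul_left_cancel₀ (X_sub_Xinv_ne_zero i) ?_
  linear_combination (-(X i - (p.a : ℂ) • 1) * (X i - (p.b : ℂ) • 1) * Xinv i) * h1 +
    Xinv i * h2 + X i * bdryLaurent 1 (-(p.a * p.b)) i Ψ w * h3

theorem noumiRight_eq (h : ExchangeReflection p Ψ) {i : Fin N} (hi : (i : ℕ) + 1 = N)
    (w : Config N) :
    noumiRight p i (Ψ w) = (-(p.c * p.d) : ℂ) • Ψ w + bdryLaurent (-(p.c * p.d)) 1 i Ψ w := by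
  have h1 := mul_exactDiv (X_sub_Xinv_dvd_sub_invVar i (Ψ w))
  have h2 := h.right_identity hi w
  have h3 := X_mul_Xinv i
  rw [noumiRight]
  congr 1
  refine mul_left_cancel₀ (X_sub_Xinv_ne_zero i) ?_
  linear_combination ((1 - (p.c : ℂ) • X i) * (1 - (p.d : ℂ) • X i) * Xinv i) * h1 -
    Xinv i * h2 + X i * bdryLaurent (-(p.c * p.d)) 1 i Ψ w * h3

theorem smul (h : ExchangeReflection p Ψ) (y : ℂ) : ExchangeReflection p (fun w => y • Ψ w) := by
  have he : ∀ z, evalVec (fun w => y • Ψ w) z = fun w => y * evalVec Ψ z w := by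
    intro z; funext w; simp [evalVec, eval_eq_evalHom]
  refine ⟨fun i j hij z hz => ?_, fun i hi z h1 h2 => ?_, fun i hi z h1 h2 => ?_⟩
  · funext w
    rw [he, he, ← h.bulk i j hij z hz]
    simp only [Rmat, bulkGen]
    ring
  · funext w
    rw [he, he, ← h.left i hi z h1 h2]
    simp only [KLeft, bdryGen]
    split_ifs <;> ring
  · funext w
    rw [he, he, ← h.right i hi z h1 h2]
    simp only [KRight, bdryGen]
    split_ifs <;> ring

theorem sub {Φ : Config N → Laurent N} (h : ExchangeReflection p Ψ) (h' : ExchangeReflection p Φ) :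
    ExchangeReflection p (Ψ - Φ) := by
  have he : ∀ z, evalVec (Ψ - Φ) z = fun w => evalVec Ψ z w - evalVec Φ z w := by
    intro z; funext w; simp [evalVec, eval_eq_evalHom]
  refine ⟨fun i j hij z hz => ?_, fun i hi z h1 h2 => ?_, fun i hi z h1 h2 => ?_⟩
  · funext w
    rw [he, he, ← h.bulk i j hij z hz, ← h'.bulk i j hij z hz]
    simp only [Rmat, bulkGen]
    ring
  · funext w
    rw [he, he, ← h.left i hi z h1 h2, ← h'.left i hi z h1 h2]
    simp only [KLeft, bdryGen]
    split_ifs <;> ring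
  · funext w
    rw [he, he, ← h.right i hi z h1 h2, ← h'.right i hi z h1 h2]
    simp only [KRight, bdryGen]
    split_ifs <;> ring

theorem noumiBulk_of_le (h : ExchangeReflection p Ψ) {i j : Fin N} (hij : (i : ℕ) + 1 = j)
    {w : Config N} (hw : w j ≤ w i) (y : ℂ) :
    ∃ y' : ℂ, noumiBulk p i j (y • Ψ w) = y' • Ψ (swapAt i j w) := by
  rw [(h.smul y).noumiBulk_eq hij w]
  rcases hw.eq_or_lt with hw | hw
  · refine ⟨p.t * y, ?_⟩
    have hs := swapAt_eq_self hw.symm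
    simp [bulkLaurent, hs, hw, rate, smul_smul]
  · refine ⟨y, ?_⟩
    simp [bulkLaurent, rate, hw, hw.not_gt]

/-- The inverse operator, which moves letters in the opposite order. -/
theorem noumiBulk_sub_of_le (h : ExchangeReflection p Ψ) {i j : Fin N} (hij : (i : ℕ) + 1 = j)
    {w : Config N} (hw : w i ≤ w j) (y : ℂ) :
    ∃ y' : ℂ, noumiBulk p i j (y • Ψ w) - ((p.t : ℂ) - 1) • (y • Ψ w) =
      y' • Ψ (swapAt i j w) := by
  rcases hw.eq_or_lt with hw | hw
  · have hs := swapAt_eq_self hw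
    obtain ⟨y', hy⟩ := h.noumiBulk_of_le hij hw.ge y
    exact ⟨y' - (p.t - 1) * y, by rw [hy, hs]; module⟩
  · refine ⟨p.t * y, ?_⟩
    rw [(h.smul y).noumiBulk_eq hij w]
    simp [bulkLaurent, rate, hw, hw.not_gt, smul_smul]
    module

theorem noumiLeft_neg_one (h : ExchangeReflection p Ψ) {i : Fin N} (hi : (i : ℕ) = 0)
    {w : Config N} (hw : w i = -1) (y : ℂ) :
    noumiLeft p i (y • Ψ w) = y • Ψ (Function.update w i 1) := by
  rw [(h.smul y).noumiLeft_eq hi w, bdryLaurent, if_pos hw]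
  module

theorem noumiLeft_zero (h : ExchangeReflection p Ψ) {i : Fin N} (hi : (i : ℕ) = 0)
    {w : Config N} (hw : w i = 0) (y : ℂ) :
    noumiLeft p i (y • Ψ w) = (-(p.a * p.b) * y : ℂ) • Ψ w := by
  rw [(h.smul y).noumiLeft_eq hi w, bdryLaurent, if_neg (by rw [hw]; decide),
    if_neg (by rw [hw]; decide), add_zero, smul_smul]

theorem noumiRight_one (h : ExchangeReflection p Ψ) {i : Fin N} (hi : (i : ℕ) + 1 = N)
    {w : Config N} (hw : w i = 1) (y : ℂ) :
    noumiRight p i (y • Ψ w) = y • Ψ (Function.update w i (-1)) := by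
  rw [(h.smul y).noumiRight_eq hi w, bdryLaurent, if_neg (by rw [hw]; decide), if_pos hw]
  module

theorem noumiRight_zero (h : ExchangeReflection p Ψ) {i : Fin N} (hi : (i : ℕ) + 1 = N)
    {w : Config N} (hw : w i = 0) (y : ℂ) :
    noumiRight p i (y • Ψ w) = (-(p.c * p.d) * y : ℂ) • Ψ w := by
  rw [(h.smul y).noumiRight_eq hi w, bdryLaurent, if_neg (by rw [hw]; decide),
    if_neg (by rw [hw]; decide), add_zero, smul_smul]

end ExchangeReflection

/-! ### Eigenvectors of the operators `Y_i` -/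

/-- The configuration obtained from `∘^r ∗^(N-1-r)` by inserting the letter `x` at the site `s`. -/
def insertLetter (N r s : ℕ) (x : SignType) : Config N := fun i =>
  if (i : ℕ) = s then x else if (if (i : ℕ) < s then (i : ℕ) else i - 1) < r then -1 else 0

theorem swapAt_insertLetter {N r s : ℕ} (hs : s + 1 < N) (x : SignType) :
    swapAt ⟨s, by omega⟩ ⟨s + 1, hs⟩ (insertLetter N r (s + 1) x) = insertLetter N r s x := by
  funext k
  simp only [swapAt]
  by_cases h1 : k = ⟨s, by omega⟩
  · subst h1; simp [insertLetter]
  · by_cases h2 : k = ⟨s + 1, hs⟩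
    · subst h2; simp [insertLetter]
    · rw [Equiv.swap_apply_of_ne_of_ne h1 h2]
      rw [Fin.ext_iff] at h1 h2
      simp only at h1 h2
      have h3 : ((k : ℕ) < s + 1) ↔ ((k : ℕ) < s) := by omega
      simp [insertLetter, h1, h2, h3]

theorem update_insertLetter {N r s : ℕ} (hs : s < N) (x y : SignType) :
    Function.update (insertLetter N r s x) ⟨s, hs⟩ y = insertLetter N r s y := by
  funext k
  by_cases h1 : k = ⟨s, hs⟩
  · subst h1; simp [insertLetter]
  · rw [Function.update_of_ne h1]
    rw [Fin.ext_iff] at h1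
    simp only at h1
    simp [insertLetter, h1]

theorem insertLetter_self {N r s : ℕ} (hs : s < N) (x : SignType) :
    insertLetter N r s x ⟨s, hs⟩ = x := by simp [insertLetter]

theorem foldr_range'_smul {N : ℕ} (op : ℕ → Laurent N → Laurent N) (G : ℕ → Laurent N) (a n : ℕ)
    (h : ∀ j, a ≤ j → j < a + n → ∀ y : ℂ, ∃ y' : ℂ, op j (y • G (j + 1)) = y' • G j) (y : ℂ) :
    ∃ y' : ℂ, (List.range' a n).foldr op (y • G (a + n)) = y' • G a := by
  induction n generalizing a with
  | zero => exact ⟨y, by simp⟩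
  | succ n ih =>
    obtain ⟨y₁, h₁⟩ := ih (a + 1) (fun j h1 h2 => h j (by omega) (by omega))
    obtain ⟨y₂, h₂⟩ := h a le_rfl (by omega) y₁
    refine ⟨y₂, ?_⟩
    rw [List.range'_succ, List.foldr_cons, ← h₂, ← h₁, add_assoc, add_comm 1 n]

theorem foldr_reverse_range_smul {N : ℕ} (op : ℕ → Laurent N → Laurent N) (H : ℕ → Laurent N)
    (n : ℕ) (h : ∀ j, j < n → ∀ y : ℂ, ∃ y' : ℂ, op j (y • H j) = y' • H (j + 1)) (y : ℂ) :
    ∃ y' : ℂ, (List.range n).reverse.foldr op (y • H 0) = y' • H n := by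
  induction n with
  | zero => exact ⟨y, by simp⟩
  | succ n ih =>
    obtain ⟨y₁, h₁⟩ := ih (fun j hj => h j (by omega))
    obtain ⟨y₂, h₂⟩ := h n (by omega) y₁
    refine ⟨y₂, ?_⟩
    rw [List.range_succ, List.reverse_append, List.reverse_singleton, List.singleton_append,
      List.foldr_cons, h₁, h₂]

namespace ExchangeReflection

variable {p : Params} {N : ℕ} {Ψ : Config N → Laurent N}

theorem noumi_down (h : ExchangeReflection p Ψ) {r s : ℕ} (hs : s + 1 < N) {x : SignType}
    (hx : x ≤ if s < r then -1 else 0) (y : ℂ) :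
    ∃ y' : ℂ, noumi p N (s + 1) (y • Ψ (insertLetter N r (s + 1) x)) =
      y' • Ψ (insertLetter N r s x) := by
  rw [noumi, dif_pos ⟨by omega, hs⟩, ← swapAt_insertLetter hs x]
  refine h.noumiBulk_of_le (by simp) ?_ y
  simpa [insertLetter] using hx

theorem noumiInv_down (h : ExchangeReflection p Ψ) {r s : ℕ} (hs : s + 1 < N) {x : SignType}
    (hx : (if s < r then -1 else 0) ≤ x) (y : ℂ) :
    ∃ y' : ℂ, noumiInv p N (s + 1) (y • Ψ (insertLetter N r (s + 1) x)) =
      y' • Ψ (insertLetter N r s x) := by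
  rw [noumiInv, noumi, dif_pos ⟨by omega, hs⟩, ← swapAt_insertLetter hs x]
  refine h.noumiBulk_sub_of_le (by simp) ?_ y
  simpa [insertLetter] using hx

theorem noumi_up (h : ExchangeReflection p Ψ) {r s : ℕ} (hs : s + 1 < N) {x : SignType}
    (hx : 0 ≤ x) (y : ℂ) :
    ∃ y' : ℂ, noumi p N (s + 1) (y • Ψ (insertLetter N r s x)) =
      y' • Ψ (insertLetter N r (s + 1) x) := by
  rw [noumi, dif_pos ⟨by omega, hs⟩]
  have := swapAt_swapAt ⟨s, by omega⟩ ⟨s + 1, hs⟩ (insertLetter N r (s + 1) x)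
  rw [swapAt_insertLetter hs x] at this
  rw [← this]
  refine h.noumiBulk_of_le (by simp) ?_ y
  simp only [insertLetter]
  simp
  split_ifs
  · exact le_trans (by decide) hx
  · exact hx

/-- Moving a letter once around the system. -/
theorem lusztigY_insertLetter (h : ExchangeReflection p Ψ) {r i : ℕ} (hi : 1 ≤ i) (hiN : i ≤ N)
    {x₀ x₁ : SignType} (hx : x₀ = -1 ∧ x₁ = 1 ∧ i ≤ r + 1 ∨ x₀ = 0 ∧ x₁ = 0 ∧ r < i) :
    ∃ y : ℂ, lusztigY p N i (Ψ (insertLetter N r (i - 1) x₀)) =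
      y • Ψ (insertLetter N r (i - 1) x₀) := by
  -- `G j` has the travelling letter at site `j`, counted from 1. `H j` is the component that the
  -- factor `T_j` acts on: the letter is reflected from `x₀` to `x₁` by `T_0`, moves right as `x₁`,
  -- and is reflected back by `T_N`. A ∘ returns as • and can pass every letter to its right; a ∗
  -- starting among the stars meets other stars on the last stretch.
  let G : ℕ → Laurent N := fun j => Ψ (insertLetter N r (j - 1) x₀)
  let H : ℕ → Laurent N := fun j =>
    if j = 0 then Ψ (insertLetter N r 0 x₀)
    else if j ≤ N then Ψ (insertLetter N r (j - 1) x₁)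
    else Ψ (insertLetter N r (N - 1) x₀)
  obtain ⟨y₁, h₁⟩ := foldr_range'_smul (noumiInv p N) G 1 (i - 1) (fun j h1 h2 y => by
    obtain ⟨s, rfl⟩ : ∃ s, j = s + 1 := ⟨j - 1, by omega⟩
    refine h.noumiInv_down (by omega) ?_ y
    rcases hx with ⟨rfl, -, hr⟩ | ⟨rfl, -, -⟩
    · rw [if_pos (by omega)]
    · split_ifs <;> decide) 1
  obtain ⟨y₂, h₂⟩ := foldr_reverse_range_smul (noumi p N) H (N + 1) (fun j hj y => by
    rcases Nat.eq_zero_or_pos j with rfl | hj0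
    · have hH : H (0 + 1) = Ψ (insertLetter N r 0 x₁) := by
        simp only [H]; rw [if_neg (by omega), if_pos (by omega)]
      rw [hH, noumi, dif_neg (by omega), dif_pos ⟨rfl, by omega⟩]
      rcases hx with ⟨rfl, rfl, -⟩ | ⟨rfl, rfl, -⟩
      · exact ⟨y, by
          rw [← update_insertLetter (show 0 < N by omega) (-1) 1]
          exact h.noumiLeft_neg_one rfl (insertLetter_self _ _) y⟩
      · exact ⟨_, h.noumiLeft_zero rfl (insertLetter_self _ _) y⟩
    · rcases (show j < N ∨ j = N by omega) with hj' | rfl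
      · obtain ⟨s, rfl⟩ : ∃ s, j = s + 1 := ⟨j - 1, by omega⟩
        have h1 : H (s + 1) = Ψ (insertLetter N r s x₁) := by
          simp only [H]; rw [if_neg (by omega), if_pos (by omega)]; rfl
        have h2 : H (s + 1 + 1) = Ψ (insertLetter N r (s + 1) x₁) := by
          simp only [H]; rw [if_neg (by omega), if_pos (by omega)]; rfl
        rw [h1, h2]
        refine h.noumi_up hj' ?_ y
        rcases hx with ⟨-, rfl, -⟩ | ⟨-, rfl, -⟩ <;> decide
      · have h1 : H j = Ψ (insertLetter j r (j - 1) x₁) := by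
          simp only [H]; rw [if_neg (by omega), if_pos (by omega)]
        have h2 : H (j + 1) = Ψ (insertLetter j r (j - 1) x₀) := by
          simp only [H]; rw [if_neg (by omega), if_neg (by omega)]
        rw [h1, h2, noumi, dif_neg (by omega), dif_neg (by omega), dif_pos ⟨rfl, hj0⟩]
        have hlast : j - 1 + 1 = j := by omega
        rcases hx with ⟨rfl, rfl, -⟩ | ⟨rfl, rfl, -⟩
        · exact ⟨y, by
            rw [← update_insertLetter (show j - 1 < j by omega) 1 (-1)]
            exact h.noumiRight_one hlast (insertLetter_self _ _) y⟩
        · exact ⟨_, h.noumiRight_zero hlast (insertLetter_self _ _) y⟩) y₁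
  obtain ⟨y₃, h₃⟩ := foldr_range'_smul (noumi p N) G i (N - i) (fun j h1 h2 y => by
    obtain ⟨s, rfl⟩ : ∃ s, j = s + 1 := ⟨j - 1, by omega⟩
    refine h.noumi_down (by omega) ?_ y
    rcases hx with ⟨rfl, -, -⟩ | ⟨rfl, -, hr⟩
    · split_ifs <;> decide
    · rw [if_neg (by omega)]) y₂
  refine ⟨y₃, ?_⟩
  have e1 : G (1 + (i - 1)) = Ψ (insertLetter N r (i - 1) x₀) := by
    simp only [G]; congr 2; omega
  have e2 : H 0 = G 1 := by simp [H, G]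
  have e3 : H (N + 1) = G (i + (N - i)) := by
    simp only [H, G]
    rw [if_neg (by omega), if_neg (by omega)]
    congr 2; omega
  rw [e1, one_smul] at h₁
  rw [e2, e3] at h₂
  simp only [lusztigY]
  rw [h₁, h₂, h₃]

theorem exists_lusztigY_eq (h : ExchangeReflection p Ψ) {m : ℕ} (hm : m ≤ N) {i : ℕ} (hi : 1 ≤ i)
    (hiN : i ≤ N) :
    ∃ y : ℂ, lusztigY p N i (Ψ (refConfig N m)) = y • Ψ (refConfig N m) := by
  rcases Nat.lt_or_ge (N - m) i with hk | hk
  · have := h.lusztigY_insertLetter (r := N - m) (x₀ := 0) (x₁ := 0) hi hiN (Or.inr ⟨rfl, rfl, hk⟩)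
    have he : insertLetter N (N - m) (i - 1) 0 = refConfig N m := by
      funext k
      simp only [insertLetter, refConfig]
      split_ifs <;> first | rfl | omega
    rwa [he] at this
  · have := h.lusztigY_insertLetter (r := N - m - 1) (x₀ := -1) (x₁ := 1) hi hiN
      (Or.inl ⟨rfl, rfl, by omega⟩)
    have he : insertLetter N (N - m - 1) (i - 1) (-1) = refConfig N m := by
      funext k
      simp only [insertLetter, refConfig]
      split_ifs <;> first | rfl | omega
    rwa [he] at this

end ExchangeReflection

/-! ### The triangularity condition -/

/-- The exponents with entries in `{-1, 0, 1}` and fewer than `k` nonzero entries. -/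
def InBox {N : ℕ} (k : ℕ) (β : Fin N → ℤ) : Prop := (∀ i, |β i| ≤ 1) ∧ ∑ i, |β i| < k

theorem refConfig_cast {N m : ℕ} (i : Fin N) :
    ((refConfig N m i : SignType) : ℤ) = if (i : ℕ) < N - m then -1 else 0 := by
  unfold refConfig
  split_ifs <;> rfl

theorem sum_ite_lt {N k : ℕ} (hk : k ≤ N) : ∑ i : Fin N, (if (i : ℕ) < k then (1 : ℤ) else 0) = k := by
  rw [Fin.sum_univ_eq_sum_range (fun i => if i < k then (1 : ℤ) else 0) N, ← Finset.sum_filter]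
  have : (Finset.range N).filter (fun i => i < k) = Finset.range k := by
    ext i; simp; omega
  rw [this]; simp

theorem plusPart_refConfig {N m : ℕ} (i : Fin N) :
    plusPart (fun i => ((refConfig N m i : SignType) : ℤ)) i =
      if (i : ℕ) < N - m then 1 else 0 := by
  have hs : Tuple.sort (fun k : Fin N => -|((refConfig N m k : SignType) : ℤ)|) =
      Equiv.refl (Fin N) := by
    rw [Tuple.sort_eq_refl_iff_monotone]
    intro i j hij
    have : (i : ℕ) ≤ j := hij
    simp only [refConfig_cast]
    split_ifs <;> first | omega | simp
  rw [plusPart, hs, Equiv.refl_apply, refConfig_cast]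
  split_ifs <;> simp

theorem plusPart_antitone {N : ℕ} (β : Fin N → ℤ) : Antitone (plusPart β) := by
  intro i j hij
  have := Tuple.monotone_sort (fun k => -|β k|) hij
  simpa [plusPart] using this

theorem sum_plusPart {N : ℕ} (β : Fin N → ℤ) : ∑ i, plusPart β i = ∑ i, |β i| :=
  Equiv.sum_comp (Tuple.sort fun k => -|β k|) (fun i => |β i|)

theorem plusPart_nonneg {N : ℕ} (β : Fin N → ℤ) (i : Fin N) : 0 ≤ plusPart β i := abs_nonneg _

theorem abs_le_of_plusPart_le {N : ℕ} {β : Fin N → ℤ} {r : ℤ} (h : ∀ i, plusPart β i ≤ r)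
    (i : Fin N) : |β i| ≤ r := by
  have := h ((Tuple.sort fun k => -|β k|).symm i)
  simpa [plusPart] using this

theorem InBox.below {N m : ℕ} {β : Fin N → ℤ} (h : InBox (N - m) β) :
    Below β (fun i => ((refConfig N m i : SignType) : ℤ)) := by
  have h1 : ∀ i, plusPart β i ≤ 1 := fun i => h.1 _
  have h2 : ∑ i, plusPart β i < ((N - m : ℕ) : ℤ) := by rw [sum_plusPart]; exact h.2
  have h3 := sum_ite_lt (Nat.sub_le N m)
  refine Or.inl ⟨fun j => ?_, fun he => ?_⟩
  · simp only [plusPart_refConfig]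
    rcases Nat.lt_or_ge j (N - m) with hj | hj
    · refine Finset.sum_le_sum fun i hi => ?_
      have : i ≤ j := Finset.mem_Iic.1 hi
      have : (i : ℕ) ≤ j := this
      rw [if_pos (by omega)]
      exact h1 i
    · have h4 : ∑ i ∈ Finset.Iic j, (if (i : ℕ) < N - m then (1 : ℤ) else 0) =
          ((N - m : ℕ) : ℤ) := by
        rw [← h3]
        refine Finset.sum_subset (Finset.subset_univ _) fun i _ hi => ?_
        have : ¬ i ≤ j := fun h => hi (Finset.mem_Iic.2 h)
        have : (j : ℕ) < i := not_le.1 this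
        rw [if_neg (by omega)]
      rw [h4]
      refine le_trans ?_ h2.le
      exact Finset.sum_le_sum_of_subset_of_nonneg (Finset.subset_univ _)
        fun i _ _ => plusPart_nonneg β i
  · rw [he] at h2
    simp only [plusPart_refConfig, h3, lt_self_iff_false] at h2

/-- The reference exponent has the smallest partial sums in its orbit, so nothing of equal
`plusPart` lies strictly below it. Otherwise the sorted entries are at most 1 with sum at most `N -
m`, and equality of the sums would force equality of the partitions. -/
theorem InBox.of_below {N m : ℕ} {β : Fin N → ℤ}
    (h : Below β (fun i => ((refConfig N m i : SignType) : ℤ))) : InBox (N - m) β := by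
  have h3 := sum_ite_lt (Nat.sub_le N m)
  rcases h with ⟨hd, hne⟩ | ⟨he, hd, hne⟩
  · rcases N with _ | n
    · exact absurd (Subsingleton.elim _ _) hne
    have h0 : ∀ i, plusPart β i ≤ 1 := by
      intro i
      refine (plusPart_antitone β (Fin.zero_le i)).trans ?_
      have := hd 0
      have hI : Finset.Iic (0 : Fin (n + 1)) = {0} := by ext i; simp
      rw [hI, Finset.sum_singleton, Finset.sum_singleton, plusPart_refConfig] at this
      refine this.trans ?_
      split_ifs <;> simp
    have hI : Finset.Iic (Fin.last n) = Finset.univ := by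
      ext i; simp [Fin.le_last]
    have hl := hd (Fin.last n)
    simp only [hI, plusPart_refConfig, h3] at hl
    refine ⟨abs_le_of_plusPart_le h0, ?_⟩
    rw [← sum_plusPart]
    refine lt_of_le_of_ne hl fun hs => hne ?_
    have hle : ∀ i : Fin (n + 1), plusPart β i ≤ if (i : ℕ) < n + 1 - m then 1 else 0 := by
      intro i
      split_ifs with hi
      · exact h0 i
      -- A nonzero entry beyond the first `n + 1 - m` would, by monotonicity, make all of those at
      -- least 1, and the sum would be too large.
      · by_contra hc
        have hc' : 1 ≤ plusPart β i := by omega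
        have : ∑ l : Fin (n + 1), (if (l : ℕ) < n + 1 - m then (1 : ℤ) else 0) <
            ∑ l, plusPart β l := by
          refine Finset.sum_lt_sum (fun l _ => ?_) ⟨i, Finset.mem_univ _, ?_⟩
          · split_ifs with hl
            · exact hc'.trans (plusPart_antitone β (by rw [Fin.le_def]; omega))
            · exact plusPart_nonneg β l
          · rw [if_neg hi]; omega
        omega
    have heq := (Finset.sum_eq_sum_iff_of_le fun i _ => hle i).1 (hs.trans h3.symm)
    funext i
    rw [plusPart_refConfig]
    exact heq i (Finset.mem_univ i)
  · exfalso
    apply hne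
    have h1 : ∀ i, |β i| ≤ 1 := abs_le_of_plusPart_le fun i => by
      rw [he, plusPart_refConfig]; split_ifs <;> simp
    have h2 : ∑ i, |β i| = ((N - m : ℕ) : ℤ) := by
      rw [← sum_plusPart, he]; simp only [plusPart_refConfig, h3]
    have hneg : ∀ i : Fin N, (i : ℕ) < N - m → β i = -1 := by
      intro i hi
      have hj : N - m - 1 < N := by omega
      have hs := hd ⟨N - m - 1, hj⟩
      have hle : ∀ l ∈ Finset.Iic (⟨N - m - 1, hj⟩ : Fin N),
          ((refConfig N m l : SignType) : ℤ) ≤ β l := by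
        intro l hl
        have : l ≤ ⟨N - m - 1, hj⟩ := Finset.mem_Iic.1 hl
        have : (l : ℕ) ≤ N - m - 1 := this
        rw [refConfig_cast, if_pos (by omega)]
        exact (abs_le.1 (h1 l)).1
      have := (Finset.sum_eq_sum_iff_of_le hle).1 (le_antisymm (Finset.sum_le_sum hle) hs) i
        (Finset.mem_Iic.2 (by rw [Fin.le_def]; simp only; omega))
      rw [refConfig_cast, if_pos hi] at this
      exact this.symm
    have hle : ∀ i : Fin N, (if (i : ℕ) < N - m then (1 : ℤ) else 0) ≤ |β i| := by
      intro i
      split_ifs with hi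
      · rw [hneg i hi]; simp
      · exact abs_nonneg _
    have heq := (Finset.sum_eq_sum_iff_of_le fun i _ => hle i).1 (h3.trans h2.symm)
    funext i
    rw [refConfig_cast]
    split_ifs with hi
    · exact hneg i hi
    · have := heq i (Finset.mem_univ i)
      rw [if_neg hi] at this
      exact abs_eq_zero.1 this.symm

/-! ### The reference component of the matrix product -/

open Polynomial in
theorem aeval_opE {R : Type} [CommRing R] (a : R) (n : ℕ) (f : ℕ → ℕ → R) (m j : ℕ) :
    aeval (opE : Module.End R (ℕ → ℕ → R)) (C a * Polynomial.X ^ n : R[X]) f m j = a * f m (j + n) := by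
  rw [map_mul, aeval_C, map_pow, aeval_X, Module.End.mul_apply]
  change a * ((opE : Module.End R (ℕ → ℕ → R)) ^ n) f m j = _
  congr 1
  induction n generalizing j with
  | zero => simp
  | succ n ih =>
    rw [pow_succ', Module.End.mul_apply]
    change ((opE : Module.End R (ℕ → ℕ → R)) ^ n) f m (j + 1) = _
    rw [ih, add_assoc, add_comm 1 n]

section Reference

variable {R : Type} [CommRing R] [Algebra ℂ R]

open Polynomial in
-- All ∘ matrices are polynomials in the single operator `𝐞`, so their product can be expanded over
-- subsets in a commutative ring.
theorem matProd_refConfig (p : Params) {N m : ℕ} (hm : m ≤ N) (z : Fin N → Rˣ) (V : ℕ → ℕ → R) :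
    matProd p (refConfig N m) z V =
      aeval (opE : Module.End R (ℕ → ℕ → R))
        (∏ i : Fin N, if (i : ℕ) < N - m then (C ((z i)⁻¹ : Rˣ).val + Polynomial.X : R[X]) else 1)
        ((opA p)^[m] V) := by
  induction N generalizing m with
  | zero =>
    obtain rfl : m = 0 := by omega
    simp [matProd]
  | succ N ih =>
    rcases Nat.lt_or_ge N m with hN | hN
    · obtain rfl : m = N + 1 := by omega
      have h0 : refConfig (N + 1) (N + 1) 0 = 0 := by simp [refConfig]
      have ht : Fin.tail (refConfig (N + 1) (N + 1)) = refConfig N N := by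
        funext i; simp [refConfig, Fin.tail]
      rw [matProd, h0, ht, ih le_rfl, letterOp_zero']
      simp only [Nat.sub_self, Nat.not_lt_zero, if_false, Finset.prod_const_one, map_one,
        Module.End.one_apply]
      rw [Function.iterate_succ_apply']
    · have h0 : refConfig (N + 1) m 0 = -1 := by
        simp only [refConfig]; rw [if_pos (by simp; omega)]
      have ht : Fin.tail (refConfig (N + 1) m) = refConfig N m := by
        funext i
        simp only [refConfig, Fin.tail, Fin.val_succ]
        split_ifs <;> first | rfl | omega
      rw [matProd, h0, ht, ih hN, Fin.prod_univ_succ, if_pos (by simp; omega), map_mul,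
        Module.End.mul_apply]
      have hp : ∀ i : Fin N, (if ((i.succ : Fin (N + 1)) : ℕ) < N + 1 - m then
          (C ((z i.succ)⁻¹ : Rˣ).val + Polynomial.X : R[X]) else 1) =
          if (i : ℕ) < N - m then (C ((Fin.tail z i)⁻¹ : Rˣ).val + Polynomial.X : R[X]) else 1 := by
        intro i
        simp only [Fin.val_succ, Fin.tail]
        split_ifs <;> first | rfl | omega
      simp only [hp]
      rw [map_add, aeval_C, aeval_X]
      rfl

theorem iterate_opA (p : Params) (k : ℕ) (V : ℕ → ℕ → R) (m j : ℕ) :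
    (opA p)^[k] V m j = algebraMap ℂ R ((p.t ^ j : ℂ) ^ k) * V (m + k) j := by
  induction k generalizing m with
  | zero => simp
  | succ k ih =>
    rw [Function.iterate_succ_apply']
    change algebraMap ℂ R (p.t ^ j) * (opA p)^[k] V (m + 1) j = _
    rw [ih, ← mul_assoc, ← map_mul, ← pow_succ', add_assoc, add_comm 1 k]

open Polynomial in
theorem matProd_refConfig_eq_sum (p : Params) {N m : ℕ} (hm : m ≤ N) (z : Fin N → Rˣ)
    (V : ℕ → ℕ → R) :
    matProd p (refConfig N m) z V 0 0 =
      ∑ S ∈ (Finset.univ.filter fun i : Fin N => (i : ℕ) < N - m).powerset,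
        (∏ i ∈ S, ((z i)⁻¹ : Rˣ).val) *
          (opA p)^[m] V 0 (((Finset.univ.filter fun i : Fin N => (i : ℕ) < N - m) \ S).card) := by
  rw [matProd_refConfig p hm, ← Finset.prod_filter, Finset.prod_add, map_sum, LinearMap.sum_apply,
    Finset.sum_apply, Finset.sum_apply]
  refine Finset.sum_congr rfl fun S _ => ?_
  rw [Finset.prod_const, ← map_prod, aeval_opE, zero_add]

end Reference

theorem prod_Xinv {N : ℕ} (S : Finset (Fin N)) :
    ∏ i ∈ S, Xinv i = AddMonoidAlgebra.single (fun i => if i ∈ S then (-1 : ℤ) else 0) 1 := by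
  simp only [Xinv]
  rw [AddMonoidAlgebra.prod_single, Finset.prod_const_one]
  congr 1
  funext i
  rw [Finset.sum_apply]
  simp [Pi.single_apply]

theorem ansatz_refConfig (p : Params) {N m : ℕ} (hm : m ≤ N) (β : Fin N → ℤ) :
    (matProd p (refConfig N m) unitX
        (fun m j => algebraMap ℂ (Laurent N) (vacuum p m j)) 0 0).coeff β =
      ∑ S ∈ (Finset.univ.filter fun i : Fin N => (i : ℕ) < N - m).powerset,
        if (fun i => if i ∈ S then (-1 : ℤ) else 0) = β then
          ((p.t : ℂ) ^ (((Finset.univ.filter fun i : Fin N => (i : ℕ) < N - m) \ S).card)) ^ m *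
            vacuum p m (((Finset.univ.filter fun i : Fin N => (i : ℕ) < N - m) \ S).card)
        else 0 := by
  rw [matProd_refConfig_eq_sum p hm, AddMonoidAlgebra.coeff_sum, Finsupp.finsetSum_apply]
  refine Finset.sum_congr rfl fun S _ => ?_
  have h1 : ∏ i ∈ S, ((unitX i)⁻¹ : (Laurent N)ˣ).val = ∏ i ∈ S, Xinv i := rfl
  rw [iterate_opA, zero_add, h1, prod_Xinv, ← map_mul, mul_comm, ← Algebra.smul_def,
    AddMonoidAlgebra.smul_single, AddMonoidAlgebra.coeff_single, Finsupp.single_apply, smul_eq_mul,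
    mul_one]

theorem stars_refConfig {N m : ℕ} (hm : m ≤ N) : stars (refConfig N m) = m := by
  have h1 : ((stars (refConfig N m) : ℕ) : ℤ) + ((N - m : ℕ) : ℤ) = N := by
    rw [← sum_ite_lt (Nat.sub_le N m), stars, Finset.card_filter, Nat.cast_sum,
      ← Finset.sum_add_distrib]
    have : ∀ i : Fin N, (((if refConfig N m i = 0 then 1 else 0 : ℕ) : ℤ) +
        if (i : ℕ) < N - m then (1 : ℤ) else 0) = 1 := by
      intro i
      simp only [refConfig]
      split_ifs <;> simp_all
    exact (Finset.sum_congr rfl fun i _ => this i).trans (by simp)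
  omega

theorem isKoornwinder_ansatz {p : Params} (hp : Generic p) {N m : ℕ} (hm : m ≤ N) :
    IsKoornwinder p (fun i => ((refConfig N m i : SignType) : ℤ))
      (ansatz p m (refConfig N m) : Laurent N) := by
  set K := Finset.univ.filter fun i : Fin N => (i : ℕ) < N - m with hK
  have hKm : (fun i : Fin N => if i ∈ K then (-1 : ℤ) else 0) =
      fun i => ((refConfig N m i : SignType) : ℤ) := by
    funext i; rw [refConfig_cast]; simp [hK]
  have hE : (ansatz p m (refConfig N m) : Laurent N) = matProd p (refConfig N m) unitX
      (fun m j => algebraMap ℂ (Laurent N) (vacuum p m j)) 0 0 := by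
    rw [ansatz, if_pos (stars_refConfig hm)]
  refine ⟨?_, ?_, fun i hi hiN => (exchangeReflection_ansatz hp N m).exists_lusztigY_eq hm hi hiN⟩
  · rw [hE, ansatz_refConfig p hm, Finset.sum_eq_single K]
    · rw [if_pos hKm, ← hK, Finset.sdiff_self, Finset.card_empty]
      simp [vacuum]
    · intro S hS hSK
      rw [if_neg]
      intro h
      rw [← hKm] at h
      apply hSK
      ext i
      have := congrFun h i
      by_cases h1 : i ∈ S <;> by_cases h2 : i ∈ K <;> simp [h1, h2] at this ⊢
    · intro h
      exact absurd (Finset.mem_powerset_self K) h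
  · intro β hβ hc
    rw [hE, ansatz_refConfig p hm] at hc
    obtain ⟨S, hS, hne⟩ := Finset.exists_ne_zero_of_sum_ne_zero hc
    have hSβ : (fun i => if i ∈ S then (-1 : ℤ) else 0) = β := by
      by_contra h; rw [if_neg h] at hne; exact hne rfl
    rw [← hK, Finset.mem_powerset] at hS
    refine InBox.below ⟨fun i => ?_, ?_⟩
    · rw [← hSβ]; simp only; split_ifs <;> simp
    · have hlt : S ⊂ K := by
        refine hS.ssubset_of_ne fun h => hβ ?_
        rw [← hSβ, h, hKm]
      have h1 : ∑ i, |β i| = (S.card : ℤ) := by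
        rw [← hSβ, Finset.card_eq_sum_ones, Nat.cast_sum, ← Finset.sum_subset (Finset.subset_univ S)]
        · exact Finset.sum_congr rfl fun i hi => by simp [hi]
        · intro i _ hi; simp [hi]
      have h2 : (K.card : ℤ) = ((N - m : ℕ) : ℤ) := by
        rw [← sum_ite_lt (Nat.sub_le N m), hK, Finset.card_filter]
        simp
      rw [h1, ← h2]
      exact_mod_cast Finset.card_lt_card hlt

theorem isStationary_ansatz {p : Params} (hp : Generic p) {N m : ℕ} (hm : m ≤ N) :
    IsStationary p m (ansatz p m : Config N → Laurent N) where
  sector w hw := by rw [ansatz, if_neg hw]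
  exchange := exchangeReflection_ansatz hp N m
  reference := isKoornwinder_ansatz hp hm

/-! ### Propagation of supports -/

/-- The exponents of `f` lie in the box of `InBox k`. -/
def SuppInBox {N : ℕ} (k : ℕ) (f : Laurent N) : Prop := ∀ β, ¬InBox k β → f.coeff β = 0

theorem InBox.swapAt {N k : ℕ} {β : Fin N → ℤ} (i j : Fin N) (h : InBox k β) :
    InBox k (swapAt i j β) :=
  ⟨fun _ => h.1 _, (Equiv.sum_comp (Equiv.swap i j) fun l => |β l|).trans_lt h.2⟩

theorem abs_update_neg {N : ℕ} (β : Fin N → ℤ) (i l : Fin N) :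
    |Function.update β i (-β i) l| = |β l| := by
  by_cases h : l = i
  · subst h; simp
  · rw [Function.update_of_ne h]

theorem InBox.update_neg {N k : ℕ} {β : Fin N → ℤ} (i : Fin N) (h : InBox k β) :
    InBox k (Function.update β i (-β i)) := by
  constructor
  · intro l
    rw [abs_update_neg]
    exact h.1 l
  · simp only [abs_update_neg]
    exact h.2

/-- The box is convex. -/
theorem InBox.of_line {N k : ℕ} {β v : Fin N → ℤ} {n₁ n₂ : ℕ} (h₁ : InBox k (β + (n₁ : ℤ) • v))
    (h₂ : InBox k (β - (n₂ : ℤ) • v)) : InBox k β := by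
  rcases Nat.eq_zero_or_pos (n₁ + n₂) with h0 | h0
  · obtain ⟨rfl, rfl⟩ : n₁ = 0 ∧ n₂ = 0 := by omega
    simpa using h₁
  have hpos : (0 : ℤ) < n₁ + n₂ := by exact_mod_cast h0
  have key : ∀ i, ((n₁ : ℤ) + n₂) * |β i| ≤
      n₂ * |(β + (n₁ : ℤ) • v) i| + n₁ * |(β - (n₂ : ℤ) • v) i| := by
    intro i
    have e : ((n₁ : ℤ) + n₂) * β i =
        n₂ * (β + (n₁ : ℤ) • v) i + n₁ * (β - (n₂ : ℤ) • v) i := by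
      simp only [Pi.add_apply, Pi.sub_apply, Pi.smul_apply, smul_eq_mul]; ring
    calc ((n₁ : ℤ) + n₂) * |β i| = |((n₁ : ℤ) + n₂) * β i| := by
          rw [abs_mul, abs_of_pos hpos]
      _ ≤ _ := by
          rw [e]
          refine (abs_add_le _ _).trans ?_
          rw [abs_mul, abs_mul, Nat.abs_cast, Nat.abs_cast]
  refine ⟨fun i => ?_, ?_⟩
  · have h3 := h₁.1 i
    have h4 := h₂.1 i
    have h5 := key i
    by_contra hc
    have hc' : 2 ≤ |β i| := by omega
    have hn1 : (0 : ℤ) ≤ n₁ := Nat.cast_nonneg _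
    have hn2 : (0 : ℤ) ≤ n₂ := Nat.cast_nonneg _
    nlinarith
  · have h5 : ((n₁ : ℤ) + n₂) * ∑ i, |β i| ≤
        n₂ * ∑ i, |(β + (n₁ : ℤ) • v) i| + n₁ * ∑ i, |(β - (n₂ : ℤ) • v) i| := by
      rw [Finset.mul_sum, Finset.mul_sum, Finset.mul_sum, ← Finset.sum_add_distrib]
      exact Finset.sum_le_sum fun i _ => key i
    have h3 := h₁.2
    have h4 := h₂.2
    have hn1 : (0 : ℤ) ≤ n₁ := Nat.cast_nonneg _
    have hn2 : (0 : ℤ) ≤ n₂ := Nat.cast_nonneg _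
    by_contra hc
    have hc' : (k : ℤ) ≤ ∑ i, |β i| := not_lt.1 hc
    have h6 : (n₂ : ℤ) * ∑ i, |(β + (n₁ : ℤ) • v) i| ≤ n₂ * (k - 1) :=
      mul_le_mul_of_nonneg_left (by omega) hn2
    have h7 : (n₁ : ℤ) * ∑ i, |(β - (n₂ : ℤ) • v) i| ≤ n₁ * (k - 1) :=
      mul_le_mul_of_nonneg_left (by omega) hn1
    have h8 : ((n₁ : ℤ) + n₂) * k ≤ ((n₁ : ℤ) + n₂) * ∑ i, |β i| :=
      mul_le_mul_of_nonneg_left hc' hpos.le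
    linarith

/-- By convexity, a line through an outside point cannot meet the box on both sides of it. -/
theorem not_inBox_line {N k : ℕ} {β : Fin N → ℤ} (v : Fin N → ℤ) (h : ¬InBox k β) :
    (∀ n : ℕ, ¬InBox k (β + (n : ℤ) • v)) ∨ ∀ n : ℕ, ¬InBox k (β - (n : ℤ) • v) := by
  by_contra! hc
  obtain ⟨⟨n₁, h₁⟩, n₂, h₂⟩ := hc
  exact h (h₁.of_line h₂)

/-- A finitely supported function that is constant along a ray vanishes on it. -/
theorem coeff_eq_zero_of_line {N : ℕ} (f : Laurent N) {β v : Fin N → ℤ} (hv : v ≠ 0)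
    (h : ∀ n : ℕ, f.coeff (β + (n : ℤ) • v) = f.coeff (β + ((n + 1 : ℕ) : ℤ) • v)) :
    f.coeff β = 0 := by
  by_contra hne
  have hc : ∀ n : ℕ, f.coeff (β + (n : ℤ) • v) = f.coeff β := by
    intro n
    induction n with
    | zero => simp
    | succ n ih => rw [← h, ih]
  obtain ⟨l, hl⟩ : ∃ l, v l ≠ 0 := Function.ne_iff.1 hv
  have hinj : Function.Injective fun n : ℕ => (⟨β + (n : ℤ) • v, by
      rw [Finset.mem_coe, Finsupp.mem_support_iff, hc]; exact hne⟩ :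
        (f.coeff.support : Set (Fin N → ℤ))) := by
    intro n₁ n₂ h12
    have := congrFun (Subtype.ext_iff.1 h12) l
    simp only [Pi.add_apply, Pi.smul_apply, smul_eq_mul, add_right_inj] at this
    exact_mod_cast mul_right_cancel₀ hl this
  exact not_injective_infinite_finite _ hinj

section Coefficients

variable {N : ℕ}

theorem coeff_bulk {t : ℂ} {i j : Fin N} {f g : Laurent N}
    (h : (t • X i - X j) * (swapVar i j f - f) = (X i - X j) * g) (β : Fin N → ℤ) :
    t * (f.coeff (swapAt i j β) - f.coeff β) -
        (f.coeff (swapAt i j (β + (Pi.single i 1 - Pi.single j 1))) -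
          f.coeff (β + (Pi.single i 1 - Pi.single j 1))) =
      g.coeff β - g.coeff (β + (Pi.single i 1 - Pi.single j 1)) := by
  have h1 := congrArg (fun q : Laurent N => q.coeff (β + Pi.single i 1)) h
  have e : β + Pi.single i 1 - Pi.single j 1 = β + (Pi.single i 1 - Pi.single j 1) := by
    rw [add_sub_assoc]
  simpa [sub_mul, coeff_X_mul, coeff_swapVar, e, smul_mul_assoc] using h1

theorem coeff_bdry {r s u : ℂ} {i : Fin N} {f g : Laurent N}
    (h : r • (X i * (X i * (invVar i f - f))) + s • (X i * (invVar i f - f)) +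
      u • (invVar i f - f) = X i * (X i * g) - g) (β : Fin N → ℤ) :
    r * (f.coeff (Function.update β i (-β i)) - f.coeff β) +
      s * ((invVar i f).coeff (β + Pi.single i 1) - f.coeff (β + Pi.single i 1)) +
      u * ((invVar i f).coeff (β + (2 : ℤ) • Pi.single i 1) -
        f.coeff (β + (2 : ℤ) • Pi.single i 1)) =
      g.coeff β - g.coeff (β + (2 : ℤ) • Pi.single i 1) := by
  have h1 := congrArg (fun q : Laurent N => q.coeff (β + (2 : ℤ) • Pi.single i 1)) h
  have e1 : β + (2 : ℤ) • Pi.single i 1 - Pi.single i 1 = β + Pi.single i 1 := by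
    rw [two_smul]; abel
  have e2 : β + Pi.single i 1 - Pi.single i 1 = β := add_sub_cancel_right _ _
  simp only [AddMonoidAlgebra.coeff_add, AddMonoidAlgebra.coeff_sub, AddMonoidAlgebra.coeff_smul,
    Finsupp.coe_add, Finsupp.coe_sub, Finsupp.coe_smul, Pi.add_apply, Pi.sub_apply, Pi.smul_apply,
    smul_eq_mul, coeff_X_mul, e1, e2] at h1
  rw [← coeff_invVar]
  exact h1

theorem single_ne_zero_int (i : Fin N) : (Pi.single i 1 : Fin N → ℤ) ≠ 0 := by
  intro h
  have := congrFun h i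
  simp at this

theorem single_sub_single_ne_zero {i j : Fin N} (hij : i ≠ j) :
    (Pi.single i 1 - Pi.single j 1 : Fin N → ℤ) ≠ 0 := by
  intro h
  have := congrFun h i
  simp [Pi.single_eq_of_ne hij] at this

theorem SuppInBox.sub_swap {k : ℕ} {f : Laurent N} (hf : SuppInBox k f) (i j : Fin N)
    {β : Fin N → ℤ} (hβ : ¬InBox k β) : f.coeff (swapAt i j β) - f.coeff β = 0 := by
  rw [hf β hβ, hf _ fun h => hβ (by simpa [swapAt_swapAt] using h.swapAt i j), sub_zero]

theorem SuppInBox.invVar_sub {k : ℕ} {f : Laurent N} (hf : SuppInBox k f) (i : Fin N)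
    {β : Fin N → ℤ} (hβ : ¬InBox k β) : (invVar i f).coeff β - f.coeff β = 0 := by
  rw [coeff_invVar, hf β hβ, hf _ fun h => hβ (by simpa using h.update_neg i), sub_zero]

/-- Outside the box the left side contributes nothing, so the coefficients of `g` are constant along
the direction `e_i - e_j`. One of the two rays from `β` avoids the box, and finiteness of the
support makes this constant 0. -/
theorem SuppInBox.of_bulk {k : ℕ} {t : ℂ} {i j : Fin N} (hij : i ≠ j) {f g : Laurent N}
    (hf : SuppInBox k f)
    (h : (t • X i - X j) * (swapVar i j f - f) = (X i - X j) * g) : SuppInBox k g := by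
  intro β hβ
  set v : Fin N → ℤ := Pi.single i 1 - Pi.single j 1 with hv
  have hv0 : v ≠ 0 := single_sub_single_ne_zero hij
  rcases not_inBox_line v hβ with hl | hl
  · refine coeff_eq_zero_of_line g hv0 fun n => ?_
    have h1 := coeff_bulk h (β + (n : ℤ) • v)
    have e : β + (n : ℤ) • v + (Pi.single i 1 - Pi.single j 1) = β + ((n + 1 : ℕ) : ℤ) • v := by
      rw [← hv]; push_cast; rw [add_smul, one_smul, add_assoc]
    rw [e, hf.sub_swap i j (hl n), hf.sub_swap i j (hl (n + 1))] at h1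
    linear_combination -h1
  · refine coeff_eq_zero_of_line g (neg_ne_zero.2 hv0) fun n => ?_
    have h1 := coeff_bulk h (β - ((n + 1 : ℕ) : ℤ) • v)
    have e : β - ((n + 1 : ℕ) : ℤ) • v + (Pi.single i 1 - Pi.single j 1) = β - (n : ℤ) • v := by
      rw [← hv]; push_cast; rw [add_smul, one_smul]; abel
    rw [e, hf.sub_swap i j (hl n), hf.sub_swap i j (hl (n + 1))] at h1
    rw [smul_neg, smul_neg, ← sub_eq_add_neg, ← sub_eq_add_neg]
    linear_combination h1

theorem SuppInBox.of_bdry {k : ℕ} {r s u : ℂ} {i : Fin N} {f g : Laurent N}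
    (hf : SuppInBox k f)
    (h : r • (X i * (X i * (invVar i f - f))) + s • (X i * (invVar i f - f)) +
      u • (invVar i f - f) = X i * (X i * g) - g) : SuppInBox k g := by
  intro β hβ
  set e : Fin N → ℤ := Pi.single i 1 with he
  have he0 : (2 : ℤ) • e ≠ 0 := smul_ne_zero two_ne_zero (single_ne_zero_int i)
  -- The recursion for `g` advances by `2e`, but the relation also involves `f` at the intermediate
  -- points. The ray therefore has direction `e`.
  rcases not_inBox_line e hβ with hl | hl
  · refine coeff_eq_zero_of_line g he0 fun n => ?_
    have h1 := coeff_bdry h (β + (n : ℤ) • (2 : ℤ) • e)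
    rw [← coeff_invVar] at h1
    have e0 : β + (n : ℤ) • (2 : ℤ) • e = β + ((2 * n : ℕ) : ℤ) • e := by
      push_cast; rw [smul_smul]; congr 2; ring
    have e1 : β + (n : ℤ) • (2 : ℤ) • e + Pi.single i 1 = β + ((2 * n + 1 : ℕ) : ℤ) • e := by
      rw [e0, ← he]; push_cast; rw [add_smul _ (1 : ℤ), one_smul, add_assoc]
    have e2 : β + (n : ℤ) • (2 : ℤ) • e + (2 : ℤ) • Pi.single i 1 =
        β + ((2 * n + 2 : ℕ) : ℤ) • e := by
      rw [e0, ← he]; push_cast; rw [add_smul _ (2 : ℤ), add_assoc]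
    have e3 : β + ((n + 1 : ℕ) : ℤ) • (2 : ℤ) • e = β + ((2 * n + 2 : ℕ) : ℤ) • e := by
      push_cast; rw [smul_smul]; congr 2; ring
    rw [e1, e2, e0, hf.invVar_sub i (hl _), hf.invVar_sub i (hl _), hf.invVar_sub i (hl _)] at h1
    rw [e0, e3]
    linear_combination -h1
  · refine coeff_eq_zero_of_line g (neg_ne_zero.2 he0) fun n => ?_
    have h1 := coeff_bdry h (β - ((n + 1 : ℕ) : ℤ) • (2 : ℤ) • e)
    rw [← coeff_invVar] at h1
    have e0 : β - ((n + 1 : ℕ) : ℤ) • (2 : ℤ) • e = β - ((2 * n + 2 : ℕ) : ℤ) • e := by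
      push_cast; rw [smul_smul]; congr 2; ring
    have e1 : β - ((n + 1 : ℕ) : ℤ) • (2 : ℤ) • e + Pi.single i 1 =
        β - ((2 * n + 1 : ℕ) : ℤ) • e := by
      rw [e0, ← he]; push_cast; rw [add_smul _ (2 : ℤ), add_smul _ (1 : ℤ), two_smul, one_smul]; abel
    have e2 : β - ((n + 1 : ℕ) : ℤ) • (2 : ℤ) • e + (2 : ℤ) • Pi.single i 1 =
        β - ((2 * n : ℕ) : ℤ) • e := by
      rw [e0, ← he]; push_cast; rw [add_smul _ (2 : ℤ)]; abel
    have e3 : β - (n : ℤ) • (2 : ℤ) • e = β - ((2 * n : ℕ) : ℤ) • e := by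
      push_cast; rw [smul_smul]; congr 2; ring
    rw [e1, e2, e0, hf.invVar_sub i (hl _), hf.invVar_sub i (hl _), hf.invVar_sub i (hl _)] at h1
    rw [smul_neg, smul_neg, ← sub_eq_add_neg, ← sub_eq_add_neg, e0, e3]
    linear_combination h1

end Coefficients

namespace ExchangeReflection

variable {p : Params} {N : ℕ} {Ψ : Config N → Laurent N}

theorem left_identity' (h : ExchangeReflection p Ψ) {i : Fin N} (hi : (i : ℕ) = 0) (w : Config N) :
    (1 : ℂ) • (X i * (X i * (invVar i (Ψ w) - Ψ w))) +
      (-(p.a + p.b) : ℂ) • (X i * (invVar i (Ψ w) - Ψ w)) +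
      (p.a * p.b : ℂ) • (invVar i (Ψ w) - Ψ w) =
      X i * (X i * bdryLaurent 1 (-(p.a * p.b)) i Ψ w) - bdryLaurent 1 (-(p.a * p.b)) i Ψ w := by
  have h1 := h.left_identity hi w
  simp only [Algebra.smul_def, mul_one, map_one, map_neg, map_add, map_mul] at h1 ⊢
  linear_combination h1

theorem right_identity' (h : ExchangeReflection p Ψ) {i : Fin N} (hi : (i : ℕ) + 1 = N)
    (w : Config N) :
    (-(p.c * p.d) : ℂ) • (X i * (X i * (invVar i (Ψ w) - Ψ w))) +
      (p.c + p.d : ℂ) • (X i * (invVar i (Ψ w) - Ψ w)) +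
      (-1 : ℂ) • (invVar i (Ψ w) - Ψ w) =
      X i * (X i * bdryLaurent (-(p.c * p.d)) 1 i Ψ w) - bdryLaurent (-(p.c * p.d)) 1 i Ψ w := by
  have h1 := h.right_identity hi w
  simp only [Algebra.smul_def, map_one, map_neg, map_add, map_mul] at h1 ⊢
  linear_combination -h1

theorem suppInBox_swapAt (h : ExchangeReflection p Ψ) {k : ℕ} {i j : Fin N}
    (hij : (i : ℕ) + 1 = j) {w : Config N} (hw : SuppInBox k (Ψ w)) :
    SuppInBox k (Ψ (swapAt i j w)) := by
  have hne : i ≠ j := fun h => by rw [h] at hij; omega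
  have h1 := hw.of_bulk hne (h.bulk_identity hij w)
  intro β hβ
  have h2 := h1 β hβ
  simp only [bulkLaurent, AddMonoidAlgebra.coeff_sub, AddMonoidAlgebra.coeff_smul,
    Finsupp.coe_sub, Finsupp.coe_smul, Pi.sub_apply, Pi.smul_apply, smul_eq_mul, hw β hβ,
    mul_zero, sub_zero] at h2
  refine (mul_eq_zero.1 h2).resolve_left ?_
  unfold rate
  split_ifs
  · exact p.t.ne_zero
  · exact one_ne_zero

theorem suppInBox_update (h : ExchangeReflection p Ψ) {k : ℕ} {i : Fin N}
    (hi : (i : ℕ) + 1 = N) {w : Config N} (hw : SuppInBox k (Ψ w)) (hw0 : w i ≠ 0) {x : SignType}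
    (hx : x ≠ 0) : SuppInBox k (Ψ (Function.update w i x)) := by
  have h1 := hw.of_bdry (h.right_identity' hi w)
  by_cases hxw : x = w i
  · rw [hxw, Function.update_eq_self]; exact hw
  intro β hβ
  have h2 := h1 β hβ
  have hcd : (p.c * p.d : ℂ) ≠ 0 := mul_ne_zero p.c.ne_zero p.d.ne_zero
  rcases hwi : w i
  · exact absurd hwi hw0
  · have hx1 : x = 1 := by
      rw [hwi] at hxw; revert hxw hx; cases x <;> decide
    rw [bdryLaurent, if_pos (show w i = -1 from hwi)] at h2
    simpa [hw β hβ, hx1] using h2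
  · have hx1 : x = -1 := by
      rw [hwi] at hxw; revert hxw hx; cases x <;> decide
    rw [bdryLaurent, if_neg (by rw [hwi]; decide), if_pos (show w i = 1 from hwi)] at h2
    simpa [hw β hβ, hx1] using h2

end ExchangeReflection

theorem comp_perm_of_swapAt {N : ℕ} {P : Config N → Prop}
    (hs : ∀ (i j : Fin N), (i : ℕ) + 1 = j → ∀ w, P w → P (swapAt i j w))
    (σ : Equiv.Perm (Fin N)) (w : Config N) (hw : P w) : P (w ∘ σ) := by
  rcases N with _ | n
  · rwa [Subsingleton.elim (w ∘ σ) w]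
  have hσ : σ ∈ Submonoid.closure (Set.range fun i : Fin n => Equiv.swap i.castSucc i.succ) := by
    rw [Equiv.Perm.mclosure_swap_castSucc_succ]; trivial
  induction hσ using Submonoid.closure_induction generalizing w with
  | mem σ h =>
    obtain ⟨i, rfl⟩ := h
    exact hs i.castSucc i.succ (by simp) w hw
  | one => exact hw
  | mul σ τ _ _ h1 h2 => exact h2 _ (h1 w hw)

/-- The configurations in a sector are connected by the moves of the open exclusion process. -/
theorem forall_of_refConfig {N m : ℕ} (hm : m ≤ N) {P : Config N → Prop}
    (hs : ∀ (i j : Fin N), (i : ℕ) + 1 = j → ∀ w, P w → P (swapAt i j w))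
    (hu : ∀ (i : Fin N), (i : ℕ) + 1 = N → ∀ w, P w → w i ≠ 0 → ∀ x : SignType, x ≠ 0 →
      P (Function.update w i x))
    (h0 : P (refConfig N m)) (w : Config N) (hw : stars w = m) : P w := by
  have hσ := fun σ w => comp_perm_of_swapAt hs σ w
  have hu' : ∀ (i : Fin N) (w : Config N), P w → w i ≠ 0 → ∀ x : SignType, x ≠ 0 →
      P (Function.update w i x) := by
    intro i w hw hi x hx
    obtain ⟨n, rfl⟩ : ∃ n, N = n + 1 := ⟨N - 1, by have := i.2; omega⟩
    -- To change the letter at `i`, transport it to the last site, change it there and transport it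
    -- back.
    have h1 := hu (Fin.last n) (by simp) _ (hσ (Equiv.swap i (Fin.last n)) w hw) (by simpa using hi)
      x hx
    have h2 := hσ (Equiv.swap i (Fin.last n)) _ h1
    have he : Function.update (w ∘ Equiv.swap i (Fin.last n)) (Fin.last n) x ∘
        Equiv.swap i (Fin.last n) = Function.update w i x := by
      funext l
      by_cases hl : l = i
      · subst hl; simp
      · have : Equiv.swap i (Fin.last n) l ≠ Fin.last n := by
          rw [Ne, Equiv.swap_apply_eq_iff]; simpa using hl
        simp [Function.update_of_ne hl, Function.update_of_ne this]
    rwa [he] at h2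
  obtain ⟨σ, hσw⟩ : ∃ σ : Equiv.Perm (Fin N), ∀ i, w i = 0 ↔ refConfig N m (σ i) = 0 := by
    have hc : Fintype.card {i // w i = 0} = Fintype.card {i // refConfig N m i = 0} := by
      rw [Fintype.card_subtype, Fintype.card_subtype]
      exact hw.trans (stars_refConfig hm).symm
    let e := Fintype.equivOfCardEq hc
    refine ⟨e.extendSubtype, fun i => ⟨fun h => e.extendSubtype_mem i h, fun h => ?_⟩⟩
    by_contra hne
    exact e.extendSubtype_not_mem i hne h
  -- After the permutation `σ` the stars are in place; the remaining letters are corrected one site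
  -- at a time.
  have key : ∀ S : Finset (Fin N),
      P (fun i => if i ∈ S then w i else refConfig N m (σ i)) := by
    intro S
    induction S using Finset.induction_on with
    | empty => simpa [Function.comp_def] using hσ σ _ h0
    | insert a S ha ih =>
      have he : (fun i => if i ∈ insert a S then w i else refConfig N m (σ i)) =
          Function.update (fun i => if i ∈ S then w i else refConfig N m (σ i)) a (w a) := by
        funext i
        by_cases hi : i = a
        · subst hi; simp
        · simp [hi]
      rw [he]
      by_cases hwa : w a = 0
      · have : (fun i => if i ∈ S then w i else refConfig N m (σ i)) a = w a := by
          simp only [if_neg ha, hwa, (hσw a).1 hwa]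
        rw [← this, Function.update_eq_self]
        exact ih
      · exact hu' a _ ih (by simp only [if_neg ha]; exact fun h => hwa ((hσw a).2 h)) _ hwa
  simpa using key Finset.univ

theorem ExchangeReflection.suppInBox_of_refConfig {p : Params} {N m k : ℕ} (hm : m ≤ N)
    {Ψ : Config N → Laurent N} (h : ExchangeReflection p Ψ)
    (h0 : SuppInBox k (Ψ (refConfig N m))) (w : Config N) (hw : stars w = m) :
    SuppInBox k (Ψ w) :=
  forall_of_refConfig (P := fun w => SuppInBox k (Ψ w)) hm
    (fun _ _ hij _ hw => h.suppInBox_swapAt hij hw)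
    (fun _ hi _ hw hw0 _ hx => h.suppInBox_update hi hw hw0 hx) h0 w hw

/-! ### Top coefficients -/

/-- The exponents with entries in `{-1, 0, 1}` and exactly `k` nonzero entries. -/
def IsTop {N : ℕ} (k : ℕ) (β : Fin N → ℤ) : Prop := (∀ i, |β i| ≤ 1) ∧ ∑ i, |β i| = k

theorem IsTop.swapAt {N k : ℕ} {β : Fin N → ℤ} (i j : Fin N) (h : IsTop k β) :
    IsTop k (swapAt i j β) :=
  ⟨fun _ => h.1 _, (Equiv.sum_comp (Equiv.swap i j) fun l => |β l|).trans h.2⟩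

theorem IsTop.update_neg {N k : ℕ} {β : Fin N → ℤ} (i : Fin N) (h : IsTop k β) :
    IsTop k (Function.update β i (-β i)) := by
  constructor
  · intro l
    rw [abs_update_neg]
    exact h.1 l
  · simp only [abs_update_neg]
    exact h.2

/-- Either an entry leaves `{-1, 0, 1}`, or both entries were 0 and two new nonzero ones appear. -/
theorem IsTop.not_inBox_add_sub {N k : ℕ} {β : Fin N → ℤ} (h : IsTop k β) {i j : Fin N}
    (hij : i ≠ j) (hle : β j ≤ β i) :
    ¬InBox (k + 1) (β + (Pi.single i 1 - Pi.single j 1)) := by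
  intro hb
  have hi := hb.1 i
  have hj := hb.1 j
  simp only [Pi.add_apply, Pi.sub_apply, Pi.single_eq_same, Pi.single_eq_of_ne hij,
    Pi.single_eq_of_ne hij.symm] at hi hj
  rw [abs_le] at hi hj
  have hi0 : β i = 0 := by omega
  have hj0 : β j = 0 := by omega
  have key : ∀ l, |(β + (Pi.single i 1 - Pi.single j 1) : Fin N → ℤ) l| =
      |β l| + ((Pi.single i 1 : Fin N → ℤ) l + (Pi.single j 1 : Fin N → ℤ) l) := by
    intro l
    by_cases h1 : l = i
    · subst h1; simp [hi0, Pi.single_eq_of_ne hij]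
    · by_cases h2 : l = j
      · subst h2; simp [hj0, Pi.single_eq_of_ne h1]
      · simp [Pi.single_eq_of_ne h1, Pi.single_eq_of_ne h2]
  have hs := hb.2
  rw [Finset.sum_congr rfl fun l _ => key l, Finset.sum_add_distrib, Finset.sum_add_distrib, h.2,
    Finset.sum_pi_single', Finset.sum_pi_single'] at hs
  simp at hs

theorem IsTop.not_inBox_add {N k : ℕ} {β : Fin N → ℤ} (h : IsTop k β) {i : Fin N} (hi : 0 ≤ β i)
    {n : ℤ} (hn : 0 < n) : ¬InBox (k + 1) (β + n • Pi.single i 1) := by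
  intro hb
  have h1 := hb.1 i
  simp only [Pi.add_apply, Pi.smul_apply, Pi.single_eq_same, smul_eq_mul, mul_one] at h1
  rw [abs_le] at h1
  have hi0 : β i = 0 := by omega
  obtain rfl : n = 1 := by omega
  have key : ∀ l, |(β + (1 : ℤ) • Pi.single i 1 : Fin N → ℤ) l| = |β l| + (Pi.single i 1 : Fin N → ℤ) l := by
    intro l
    by_cases h1 : l = i
    · subst h1; simp [hi0]
    · simp [Pi.single_eq_of_ne h1]
  have hs := hb.2
  rw [Finset.sum_congr rfl fun l _ => key l, Finset.sum_add_distrib, h.2,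
    Finset.sum_pi_single'] at hs
  simp at hs

theorem IsTop.not_inBox_sub {N k : ℕ} {β : Fin N → ℤ} (h : IsTop k β) {i : Fin N} (hi : β i ≤ 0)
    {n : ℤ} (hn : 0 < n) : ¬InBox (k + 1) (β - n • Pi.single i 1) := by
  have h' : IsTop k (-β) := ⟨fun l => by simpa using h.1 l, by simpa using h.2⟩
  intro hb
  refine h'.not_inBox_add (i := i) (by simpa using hi) hn ?_
  have e : -β + n • Pi.single i 1 = -(β - n • Pi.single i 1) := by abel
  rw [e]
  exact ⟨fun l => by simpa only [Pi.neg_apply, abs_neg] using hb.1 l,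
    by simpa only [Pi.neg_apply, abs_neg] using hb.2⟩

namespace ExchangeReflection

variable {p : Params} {N k m : ℕ} {Ψ : Config N → Laurent N}

theorem top_eq_of_eq (h : ExchangeReflection p Ψ) {i j : Fin N} (hij : (i : ℕ) + 1 = j)
    {w : Config N} (hw : w i = w j) (β : Fin N → ℤ) :
    (Ψ w).coeff (swapAt i j β) = (Ψ w).coeff β := by
  have hne : i ≠ j := fun h => by rw [h] at hij; omega
  have h1 := h.bulk_identity hij w
  have h2 : bulkLaurent p i j Ψ w = 0 := by
    simp [bulkLaurent, swapAt_eq_self hw, hw, rate]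
  rw [h2, mul_zero] at h1
  have h3 := sub_eq_zero.1 ((mul_eq_zero.1 h1).resolve_left (smul_X_sub_X_ne_zero hne p.t))
  rw [← coeff_swapVar, h3]

theorem coeff_bulkLaurent_of_gt {i j : Fin N} {w : Config N} (hw : w j < w i) (β : Fin N → ℤ) :
    (bulkLaurent p i j Ψ w).coeff β = (Ψ (swapAt i j w)).coeff β - p.t * (Ψ w).coeff β := by
  simp [bulkLaurent, rate, hw, hw.not_gt]

variable (h : ExchangeReflection p Ψ) (hS : ∀ w, stars w = m → SuppInBox (k + 1) (Ψ w))

include h hS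

/-- Of the two exponents related by `coeff_bulk`, the one shifted by `e_i - e_j` lies outside the
box, leaving a relation between top coefficients alone. -/
theorem top_exchange_of_le {i j : Fin N} (hij : (i : ℕ) + 1 = j) {w : Config N} (hm : stars w = m)
    (hw : w j < w i) {β : Fin N → ℤ} (hβ : IsTop k β) (hle : β i ≤ β j) :
    (Ψ (swapAt i j w)).coeff (swapAt i j β) = p.t * (Ψ w).coeff β := by
  have hne : i ≠ j := fun h => by rw [h] at hij; omega
  have h1 := h.bulk_identity hij w
  have h2 := coeff_bulk h1 (swapAt i j β)
  have h3 := (hS w hm).of_bulk hne h1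
  have h4 : ¬InBox (k + 1) (swapAt i j β + (Pi.single i 1 - Pi.single j 1)) :=
    (hβ.swapAt i j).not_inBox_add_sub hne (by simpa [swapAt] using hle)
  rw [h3 _ h4, (hS w hm).sub_swap i j h4, swapAt_swapAt, coeff_bulkLaurent_of_gt hw] at h2
  linear_combination -h2

/-- Here the exponent shifted by `-(e_i - e_j)` is the one outside the box, and a second top
coefficient survives. -/
theorem top_exchange_of_gt {i j : Fin N} (hij : (i : ℕ) + 1 = j) {w : Config N} (hm : stars w = m)
    (hw : w j < w i) {β : Fin N → ℤ} (hβ : IsTop k β) (hgt : β j < β i) :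
    (Ψ (swapAt i j w)).coeff (swapAt i j β) =
      (Ψ w).coeff β + (p.t - 1) * (Ψ w).coeff (swapAt i j β) := by
  have hne : i ≠ j := fun h => by rw [h] at hij; omega
  have h1 := h.bulk_identity hij w
  have h2 := coeff_bulk h1 (swapAt i j β - (Pi.single i 1 - Pi.single j 1))
  have h3 := (hS w hm).of_bulk hne h1
  have h4 : ¬InBox (k + 1) (swapAt i j β - (Pi.single i 1 - Pi.single j 1)) := by
    intro hb
    have h5 := hb.swapAt i j
    have e : swapAt i j (swapAt i j β - (Pi.single i 1 - Pi.single j 1)) =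
        β + (Pi.single i 1 - Pi.single j 1) := by
      funext l
      by_cases h1 : l = i
      · subst h1; simp [swapAt, Pi.single_eq_of_ne hne, Pi.single_eq_of_ne hne.symm]
      · by_cases h2 : l = j
        · subst h2; simp [swapAt, Pi.single_eq_of_ne hne, Pi.single_eq_of_ne hne.symm]; rfl
        · simp [swapAt, Equiv.swap_apply_of_ne_of_ne h1 h2, Pi.single_eq_of_ne h1,
            Pi.single_eq_of_ne h2]
    rw [e] at h5
    exact hβ.not_inBox_add_sub hne hgt.le h5
  rw [sub_add_cancel, h3 _ h4, (hS w hm).sub_swap i j h4, swapAt_swapAt,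
    coeff_bulkLaurent_of_gt hw] at h2
  linear_combination h2

theorem top_left {i : Fin N} (hi : (i : ℕ) = 0) {w : Config N} (hm : stars w = m) (hw : w i = -1)
    {β : Fin N → ℤ} (hβ : IsTop k β) (hle : 0 ≤ β i) :
    (Ψ (Function.update w i 1)).coeff (Function.update β i (-β i)) =
      -(p.a * p.b) * (Ψ w).coeff β := by
  have h1 := h.left_identity' hi w
  have h3 := (hS w hm).of_bdry h1
  set γ := Function.update β i (-β i) with hγ
  have hγt : IsTop k γ := hβ.update_neg i
  have hγi : γ i ≤ 0 := by rw [hγ, Function.update_self]; omega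
  have h2 := coeff_bdry h1 (γ - (2 : ℤ) • Pi.single i 1)
  have e1 : γ - (2 : ℤ) • Pi.single i 1 + Pi.single i 1 = γ - (1 : ℤ) • Pi.single i 1 := by
    rw [two_smul, one_smul]; abel
  have h4 := hγt.not_inBox_sub hγi (n := 2) (by norm_num)
  have h5 := hγt.not_inBox_sub hγi (n := 1) (by norm_num)
  have e2 : Function.update γ i (-γ i) = β := by simp [hγ]
  rw [← coeff_invVar, sub_add_cancel, e1, (hS w hm).invVar_sub i h4, (hS w hm).invVar_sub i h5,
    h3 _ h4, coeff_invVar, e2, bdryLaurent, if_pos hw] at h2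
  simp only [AddMonoidAlgebra.coeff_sub, AddMonoidAlgebra.coeff_smul, Finsupp.coe_sub,
    Finsupp.coe_smul, Pi.sub_apply, Pi.smul_apply, smul_eq_mul] at h2
  linear_combination h2

theorem top_right {i : Fin N} (hi : (i : ℕ) + 1 = N) {w : Config N} (hm : stars w = m)
    (hw : w i = 1) {β : Fin N → ℤ} (hβ : IsTop k β) (hle : β i ≤ 0) :
    (Ψ (Function.update w i (-1))).coeff (Function.update β i (-β i)) =
      -(p.c * p.d) * (Ψ w).coeff β := by
  have h1 := h.right_identity' hi w
  have h3 := (hS w hm).of_bdry h1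
  set γ := Function.update β i (-β i) with hγ
  have hγt : IsTop k γ := hβ.update_neg i
  have hγi : 0 ≤ γ i := by rw [hγ, Function.update_self]; omega
  have h2 := coeff_bdry h1 γ
  have h4 := hγt.not_inBox_add hγi (n := 2) (by norm_num)
  have h5 := hγt.not_inBox_add hγi (n := 1) (by norm_num)
  rw [one_smul] at h5
  have e2 : Function.update γ i (-γ i) = β := by simp [hγ]
  rw [(hS w hm).invVar_sub i h4, (hS w hm).invVar_sub i h5,
    h3 _ h4, e2, bdryLaurent, if_neg (by rw [hw]; decide), if_pos hw] at h2
  simp only [AddMonoidAlgebra.coeff_sub, AddMonoidAlgebra.coeff_smul, Finsupp.coe_sub,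
    Finsupp.coe_smul, Pi.sub_apply, Pi.smul_apply, smul_eq_mul] at h2
  linear_combination -h2

end ExchangeReflection

/-! ### Moving a letter around the system -/

/-- The sequence with `x` inserted at the position `q`. -/
def insertAt {n : ℕ} {Y : Type} (q : Fin (n + 1)) (x : Y) (u : Fin n → Y) : Fin (n + 1) → Y :=
  Fin.insertNth (α := fun _ => Y) q x u

section InsertAt

variable {n : ℕ} {Y : Type}

theorem insertAt_same (q : Fin (n + 1)) (x : Y) (u : Fin n → Y) : insertAt q x u q = x :=
  Fin.insertNth_apply_same (α := fun _ => Y) q x u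

theorem insertAt_succAbove (q : Fin (n + 1)) (x : Y) (u : Fin n → Y) (l : Fin n) :
    insertAt q x u (q.succAbove l) = u l :=
  Fin.insertNth_apply_succAbove (α := fun _ => Y) q x u l

theorem insertAt_castSucc_succ (q : Fin n) (x : Y) (u : Fin n → Y) :
    insertAt q.castSucc x u q.succ = u q := by
  have := insertAt_succAbove q.castSucc x u q
  rwa [Fin.succAbove_castSucc_self] at this

theorem insertAt_succ_castSucc (q : Fin n) (x : Y) (u : Fin n → Y) :
    insertAt q.succ x u q.castSucc = u q := by
  have := insertAt_succAbove q.succ x u q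
  rwa [Fin.succAbove_succ_self] at this

theorem succ_succAbove_of_ne {q l : Fin n} (h : l ≠ q) :
    q.succ.succAbove l = q.castSucc.succAbove l := by
  have : (l : ℕ) ≠ q := fun h' => h (Fin.ext h')
  simp only [Fin.succAbove, Fin.lt_def, Fin.val_castSucc, Fin.val_succ]
  split_ifs <;> first | rfl | omega

theorem swapAt_insertAt (q : Fin n) (x : Y) (u : Fin n → Y) :
    swapAt q.castSucc q.succ (insertAt q.castSucc x u) = insertAt q.succ x u := by
  funext k
  revert k
  rw [Fin.forall_iff_succAbove q.succ]
  refine ⟨?_, fun l => ?_⟩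
  · simp [swapAt, insertAt_same]
  · rw [insertAt_succAbove]
    by_cases hl : l = q
    · subst hl
      rw [Fin.succAbove_succ_self, swapAt, Equiv.swap_apply_left, insertAt_castSucc_succ]
    · have h1 : q.succ.succAbove l ≠ q.succ := Fin.succAbove_ne _ _
      have h2 : q.succ.succAbove l ≠ q.castSucc := by
        rw [succ_succAbove_of_ne hl]; exact Fin.succAbove_ne _ _
      rw [swapAt, Equiv.swap_apply_of_ne_of_ne h2 h1, succ_succAbove_of_ne hl, insertAt_succAbove]

theorem swapAt_insertAt_succ (q : Fin n) (x : Y) (u : Fin n → Y) :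
    swapAt q.castSucc q.succ (insertAt q.succ x u) = insertAt q.castSucc x u := by
  rw [← swapAt_insertAt, swapAt_swapAt]

theorem insertAt_succ_eq (q : Fin n) (x : Y) (u : Fin n → Y) :
    insertAt q.succ x u = insertAt q.castSucc (u q) (Function.update u q x) := by
  funext k
  revert k
  rw [Fin.forall_iff_succAbove q.succ]
  refine ⟨?_, fun l => ?_⟩
  · rw [insertAt_same, insertAt_castSucc_succ, Function.update_self]
  · rw [insertAt_succAbove]
    by_cases hl : l = q
    · subst hl
      rw [Fin.succAbove_succ_self, insertAt_same]
    · rw [succ_succAbove_of_ne hl, insertAt_succAbove, Function.update_of_ne hl]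

theorem insertAt_castSucc_eq (q : Fin n) (x : Y) (u : Fin n → Y) :
    insertAt q.castSucc x u = insertAt q.succ (u q) (Function.update u q x) := by
  rw [insertAt_succ_eq]
  simp

theorem update_insertAt (q : Fin (n + 1)) (x y : Y) (u : Fin n → Y) :
    Function.update (insertAt q x u) q y = insertAt q y u :=
  Fin.update_insertNth (α := fun _ => Y) q x y u

theorem exists_eq_insertAt (q : Fin (n + 1)) (w : Fin (n + 1) → Y) :
    w = insertAt q (w q) (fun l => w (q.succAbove l)) :=
  (Fin.insertNth_self_removeNth (α := fun _ => Y) q w).symm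

theorem stars_insertAt (q : Fin (n + 1)) {x : SignType} (hx : x ≠ 0) (u : Config n) :
    stars (insertAt q x u) = stars u := by
  simp only [stars, Finset.card_filter, Fin.sum_univ_succAbove _ q, insertAt_same,
    insertAt_succAbove, if_neg hx, zero_add]

theorem isTop_insertAt {k : ℕ} {q : Fin (n + 1)} {y : ℤ} {γ : Fin n → ℤ} :
    IsTop k (insertAt q y γ) ↔ |y| ≤ 1 ∧ (∀ l, |γ l| ≤ 1) ∧ |y| + ∑ l, |γ l| = k := by
  rw [IsTop, Fin.forall_iff_succAbove q, Fin.sum_univ_succAbove _ q]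
  simp only [insertAt_same, insertAt_succAbove, and_assoc]

end InsertAt

/-- If each step around the system multiplies by a power of `t`, the total factor
`a b c d t^e ≠ 1` forces everything to vanish. -/
theorem eq_zero_of_loop {p : Params} (hp : Generic p) {n : ℕ} {F G : Fin (n + 1) → ℂ}
    (hF : ∀ q : Fin n, ∃ e : ℕ, F q.succ = p.t ^ e * F q.castSucc)
    (hG : ∀ q : Fin n, ∃ e : ℕ, G q.castSucc = p.t ^ e * G q.succ)
    (hl : F 0 = -(p.a * p.b) * G 0) (hr : G (Fin.last n) = -(p.c * p.d) * F (Fin.last n))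
    (q : Fin (n + 1)) : F q = 0 ∧ G q = 0 := by
  have hF' : ∀ q, ∃ e : ℕ, F q = p.t ^ e * F 0 := by
    intro q
    induction q using Fin.induction with
    | zero => exact ⟨0, by simp⟩
    | succ q ih =>
      obtain ⟨e, he⟩ := ih
      obtain ⟨e', he'⟩ := hF q
      exact ⟨e' + e, by rw [he', he, pow_add, mul_assoc]⟩
  have hG' : ∀ q, ∃ e : ℕ, G 0 = p.t ^ e * G q := by
    intro q
    induction q using Fin.induction with
    | zero => exact ⟨0, by simp⟩
    | succ q ih =>
      obtain ⟨e, he⟩ := ih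
      obtain ⟨e', he'⟩ := hG q
      exact ⟨e + e', by rw [he, he', pow_add, mul_assoc]⟩
  have ht : (p.t : ℂ) ≠ 0 := p.t.ne_zero
  have h0 : G 0 = 0 := by
    obtain ⟨e, he⟩ := hF' (Fin.last n)
    obtain ⟨e', he'⟩ := hG' (Fin.last n)
    -- A full turn gives `G 0 = (-ab)(-cd) t^(e'+e) G 0`.
    have h1 : G 0 * (1 - p.a * p.b * p.c * p.d * p.t ^ (e' + e)) = 0 := by
      rw [hr, he, hl] at he'
      rw [pow_add]
      linear_combination he'
    exact (mul_eq_zero.1 h1).resolve_right (hp.sub_ne_zero _)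
  constructor
  · obtain ⟨e, he⟩ := hF' q
    rw [he, hl, h0]; ring
  · obtain ⟨e, he⟩ := hG' q
    rw [h0] at he
    exact (mul_eq_zero.1 he.symm).resolve_left (pow_ne_zero _ ht)

namespace ExchangeReflection

variable {p : Params} {n k m : ℕ} {Ψ : Config (n + 1) → Laurent (n + 1)}

/-- The exponent -1 on • and +1 on ∘ is extremal, so every exchange of unequal letters falls under
`top_exchange_of_le` and each step of the loop is a pure power of `t`. -/
theorem top_insertAt_one (hp : Generic p) (h : ExchangeReflection p Ψ)
    (hS : ∀ w, stars w = m → SuppInBox (k + 1) (Ψ w)) {u : Config n} (hu : ∀ l, u l ≠ 1)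
    (hm : stars u = m) {γ : Fin n → ℤ} (hγ : ∀ l, |γ l| ≤ 1) (hs : 1 + ∑ l, |γ l| = k)
    (q : Fin (n + 1)) :
    (Ψ (insertAt q 1 u)).coeff (insertAt q (-1) γ) = 0 ∧
      (Ψ (insertAt q (-1) u)).coeff (insertAt q 1 γ) = 0 := by
  have hm1 : ∀ q, stars (insertAt q 1 u) = m := fun q => (stars_insertAt q (by decide) u).trans hm
  have hm2 : ∀ q, stars (insertAt q (-1) u) = m :=
    fun q => (stars_insertAt q (by decide) u).trans hm
  have ht1 : ∀ q, IsTop k (insertAt q (-1) γ) := fun q =>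
    isTop_insertAt.2 ⟨by simp, hγ, by simpa using hs⟩
  have ht2 : ∀ q, IsTop k (insertAt q 1 γ) := fun q =>
    isTop_insertAt.2 ⟨by simp, hγ, by simpa using hs⟩
  refine eq_zero_of_loop hp (F := fun q => (Ψ (insertAt q 1 u)).coeff (insertAt q (-1) γ))
    (G := fun q => (Ψ (insertAt q (-1) u)).coeff (insertAt q 1 γ)) (fun q => ⟨1, ?_⟩) (fun q => ?_)
    ?_ ?_ q
  · rw [pow_one, ← swapAt_insertAt, ← swapAt_insertAt]
    refine h.top_exchange_of_le hS (by simp) (hm1 _) ?_ (ht1 _) ?_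
    · rw [insertAt_same, insertAt_castSucc_succ]
      have := hu q
      revert this; cases u q <;> decide
    · rw [insertAt_same, insertAt_castSucc_succ]
      exact (abs_le.1 (hγ q)).1
  · rw [← swapAt_insertAt_succ q 1 γ]
    rcases hq : u q
    · refine ⟨1, ?_⟩
      rw [pow_one, ← swapAt_insertAt_succ]
      refine h.top_exchange_of_le hS (by simp) (hm2 _) ?_ (ht2 _) ?_
      · rw [insertAt_same, insertAt_succ_castSucc, hq]; decide
      · rw [insertAt_same, insertAt_succ_castSucc]
        exact (abs_le.1 (hγ q)).2
    · refine ⟨0, ?_⟩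
      have he : insertAt q.succ (-1) u q.castSucc = insertAt q.succ (-1) u q.succ := by
        rw [insertAt_same, insertAt_succ_castSucc, hq]; rfl
      rw [pow_zero, one_mul, ← swapAt_insertAt_succ, swapAt_eq_self he]
      exact h.top_eq_of_eq (by simp) he _
    · exact absurd hq (hu q)
  · have := h.top_left hS (i := 0) rfl (hm2 0) (insertAt_same _ _ _) (ht2 0)
      (by rw [insertAt_same]; norm_num)
    rwa [insertAt_same, update_insertAt, update_insertAt] at this
  · have := h.top_right hS (i := Fin.last n) (by simp) (hm1 _) (insertAt_same _ _ _) (ht1 _)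
      (by rw [insertAt_same]; norm_num)
    rwa [insertAt_same, update_insertAt, update_insertAt, neg_neg] at this

/-- With exponent 0 an exchange may fall under `top_exchange_of_gt`. In its extra term the
travelling letter carries the extremal exponent, so that term vanishes by `top_insertAt_one` and the
loop argument applies again. -/
theorem top_insertAt_zero (hp : Generic p) (h : ExchangeReflection p Ψ)
    (hS : ∀ w, stars w = m → SuppInBox (k + 1) (Ψ w)) {u : Config n} (hu : ∀ l, u l ≠ 1)
    (hm : stars u = m) {γ : Fin n → ℤ} (hγ : ∀ l, |γ l| ≤ 1) (hs : ∑ l, |γ l| = k)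
    (q : Fin (n + 1)) :
    (Ψ (insertAt q (-1) u)).coeff (insertAt q 0 γ) = 0 := by
  have hm1 : ∀ q, stars (insertAt q 1 u) = m := fun q => (stars_insertAt q (by decide) u).trans hm
  have hm2 : ∀ q, stars (insertAt q (-1) u) = m :=
    fun q => (stars_insertAt q (by decide) u).trans hm
  have ht : ∀ q, IsTop k (insertAt q 0 γ) := fun q =>
    isTop_insertAt.2 ⟨by simp, hγ, by simpa using hs⟩
  have hγ' : ∀ (q l : Fin n), |Function.update γ q 0 l| ≤ 1 := by
    intro q l
    by_cases hl : l = q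
    · subst hl; simp
    · rw [Function.update_of_ne hl]; exact hγ l
  have hs' : ∀ q : Fin n, |γ q| = 1 → 1 + ∑ l, |Function.update γ q 0 l| = k := by
    intro q hq
    rw [← hs, ← Finset.add_sum_erase Finset.univ (fun l => |Function.update γ q 0 l|)
        (Finset.mem_univ q),
      ← Finset.add_sum_erase Finset.univ (fun l => |γ l|) (Finset.mem_univ q), hq,
      Function.update_self, abs_zero, zero_add]
    congr 1
    exact Finset.sum_congr rfl fun l hl => by
      rw [Function.update_of_ne (Finset.ne_of_mem_erase hl)]
  refine (eq_zero_of_loop hp (F := fun q => (Ψ (insertAt q 1 u)).coeff (insertAt q 0 γ))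
    (G := fun q => (Ψ (insertAt q (-1) u)).coeff (insertAt q 0 γ)) (fun q => ?_) (fun q => ?_)
    ?_ ?_ q).2
  · have hlt : insertAt q.castSucc 1 u q.succ < insertAt q.castSucc 1 u q.castSucc := by
      rw [insertAt_same, insertAt_castSucc_succ]
      have := hu q
      revert this; cases u q <;> decide
    rw [← swapAt_insertAt, ← swapAt_insertAt]
    rcases le_or_gt 0 (γ q) with hq | hq
    · refine ⟨1, ?_⟩
      rw [pow_one]
      refine h.top_exchange_of_le hS (by simp) (hm1 _) hlt (ht _) ?_
      rwa [insertAt_same, insertAt_castSucc_succ]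
    · refine ⟨0, ?_⟩
      -- In the extra term only the exponents have been exchanged: the • at `q.castSucc` now carries
      -- -1, and the 0 has taken its place in `γ`.
      have hq1 : γ q = -1 := by have := abs_le.1 (hγ q); omega
      rw [h.top_exchange_of_gt hS (by simp) (hm1 _) hlt (ht _)
        (by rwa [insertAt_same, insertAt_castSucc_succ]), swapAt_insertAt, insertAt_succ_eq, hq1,
        (h.top_insertAt_one hp hS hu hm (hγ' q) (hs' q (by simp [hq1])) _).1]
      ring
  · rw [← swapAt_insertAt_succ q 0 γ]
    rcases hq : u q
    · have hlt : insertAt q.succ (-1) u q.succ < insertAt q.succ (-1) u q.castSucc := by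
        rw [insertAt_same, insertAt_succ_castSucc, hq]; decide
      rw [← swapAt_insertAt_succ q (-1) u]
      rcases le_or_gt (γ q) 0 with hγq | hγq
      · refine ⟨1, ?_⟩
        rw [pow_one]
        refine h.top_exchange_of_le hS (by simp) (hm2 _) hlt (ht _) ?_
        rwa [insertAt_same, insertAt_succ_castSucc]
      · refine ⟨0, ?_⟩
        have hq1 : γ q = 1 := by have := abs_le.1 (hγ q); omega
        rw [h.top_exchange_of_gt hS (by simp) (hm2 _) hlt (ht _)
          (by rwa [insertAt_same, insertAt_succ_castSucc]), swapAt_insertAt_succ,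
          insertAt_castSucc_eq, hq1,
          (h.top_insertAt_one hp hS hu hm (hγ' q) (hs' q (by simp [hq1])) _).2]
        ring
    · refine ⟨0, ?_⟩
      have he : insertAt q.succ (-1) u q.castSucc = insertAt q.succ (-1) u q.succ := by
        rw [insertAt_same, insertAt_succ_castSucc, hq]; rfl
      rw [pow_zero, one_mul, ← swapAt_insertAt_succ, swapAt_eq_self he]
      exact h.top_eq_of_eq (by simp) he _
    · exact absurd hq (hu q)
  · have := h.top_left hS (i := 0) rfl (hm2 0) (insertAt_same _ _ _) (ht 0)
      (by rw [insertAt_same])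
    rwa [insertAt_same, update_insertAt, update_insertAt, neg_zero] at this
  · have := h.top_right hS (i := Fin.last n) (by simp) (hm1 _) (insertAt_same _ _ _) (ht _)
      (by rw [insertAt_same])
    rwa [insertAt_same, update_insertAt, update_insertAt, neg_zero] at this

end ExchangeReflection

/-! ### Uniqueness -/

/-- Pigeonhole: `k` nonzero exponents cannot cover the `N - m > k` sites with letter ∘, so some ∘
carries exponent 0 and `top_insertAt_zero` applies to it. -/
theorem ExchangeReflection.suppInBox_pred {p : Params} (hp : Generic p) {N k m : ℕ} (hm : m ≤ N)
    (hk : k < N - m) {Ψ : Config N → Laurent N} (h : ExchangeReflection p Ψ)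
    (h0 : SuppInBox (k + 1) (Ψ (refConfig N m))) : SuppInBox k (Ψ (refConfig N m)) := by
  intro β hβ
  by_cases hb : InBox (k + 1) β
  swap
  · exact h0 β hb
  obtain ⟨n, rfl⟩ : ∃ n, N = n + 1 := ⟨N - 1, by omega⟩
  have hsum : ∑ i, |β i| = k := by
    have h1 := hb.2
    have h2 : ¬∑ i, |β i| < k := fun h => hβ ⟨hb.1, h⟩
    push_cast at h1
    omega
  obtain ⟨q, hq, hq0⟩ : ∃ q : Fin (n + 1), (q : ℕ) < n + 1 - m ∧ β q = 0 := by
    by_contra! hc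
    have h1 : ∑ i : Fin (n + 1), (if (i : ℕ) < n + 1 - m then (1 : ℤ) else 0) ≤ ∑ i, |β i| := by
      refine Finset.sum_le_sum fun i _ => ?_
      split_ifs with hi
      · exact Int.one_le_abs (hc i hi)
      · exact abs_nonneg _
    rw [sum_ite_lt (Nat.sub_le _ m), hsum] at h1
    have : n + 1 - m ≤ k := by exact_mod_cast h1
    omega
  have hw : refConfig (n + 1) m q = -1 := by rw [refConfig, if_pos hq]
  have h1 := exists_eq_insertAt q (refConfig (n + 1) m)
  have h2 := exists_eq_insertAt q β
  rw [hw] at h1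
  rw [hq0] at h2
  have h3 : IsTop k β := ⟨hb.1, hsum⟩
  rw [h2, isTop_insertAt] at h3
  have h4 : stars (fun l => refConfig (n + 1) m (q.succAbove l)) = m := by
    rw [← stars_insertAt q (x := -1) (by decide), ← h1, stars_refConfig hm]
  rw [h1, h2]
  refine h.top_insertAt_zero hp (h.suppInBox_of_refConfig hm h0) (fun l => ?_) h4 h3.2.1
    (by simpa using h3.2.2) q
  simp only [refConfig]
  split_ifs <;> decide

/-- Shrinking the box `N - m` times leads to `InBox 0`, which is empty. -/
theorem ExchangeReflection.eq_zero {p : Params} (hp : Generic p) {N m : ℕ} (hm : m ≤ N)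
    {Ψ : Config N → Laurent N} (h : ExchangeReflection p Ψ)
    (h0 : SuppInBox (N - m) (Ψ (refConfig N m))) (w : Config N) (hw : stars w = m) : Ψ w = 0 := by
  have key : ∀ l, l ≤ N - m → SuppInBox (N - m - l) (Ψ (refConfig N m)) := by
    intro l
    induction l with
    | zero => intro _; exact h0
    | succ l ih =>
      intro hl
      refine h.suppInBox_pred hp hm (by omega) ?_
      have := ih (by omega)
      rwa [show N - m - l = N - m - (l + 1) + 1 by omega] at this
  have h1 := key (N - m) le_rfl
  rw [Nat.sub_self] at h1
  have h2 := h.suppInBox_of_refConfig hm h1 w hw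
  rw [← AddMonoidAlgebra.coeff_eq_zero]
  ext β
  refine h2 β fun hb => ?_
  have h3 := hb.2
  have h4 : 0 ≤ ∑ i, |β i| := Finset.sum_nonneg fun i _ => abs_nonneg _
  simp only [Nat.cast_zero] at h3
  omega

/-- The leading coefficients of the two reference components cancel, and triangularity puts the rest
of the difference into the box. -/
theorem IsStationary.eq {p : Params} (hp : Generic p) {N m : ℕ} (hm : m ≤ N)
    {Ψ Φ : Config N → Laurent N} (hΨ : IsStationary p m Ψ) (hΦ : IsStationary p m Φ) : Ψ = Φ := by
  have h0 : SuppInBox (N - m) ((Ψ - Φ) (refConfig N m)) := by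
    intro β hβ
    rw [Pi.sub_apply, AddMonoidAlgebra.coeff_sub, Finsupp.coe_sub, Pi.sub_apply]
    by_cases hμ : β = fun i => ((refConfig N m i : SignType) : ℤ)
    · rw [hμ, hΨ.reference.monic, hΦ.reference.monic, sub_self]
    · have h1 : (Ψ (refConfig N m)).coeff β = 0 := by
        by_contra hne
        exact hβ (InBox.of_below (hΨ.reference.triangular β hμ hne))
      have h2 : (Φ (refConfig N m)).coeff β = 0 := by
        by_contra hne
        exact hβ (InBox.of_below (hΦ.reference.triangular β hμ hne))
      rw [h1, h2, sub_self]
  funext w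
  by_cases hw : stars w = m
  · exact sub_eq_zero.1 ((hΨ.exchange.sub hΦ.exchange).eq_zero hp hm h0 w hw)
  · rw [hΨ.sector w hw, hΦ.sector w hw]

theorem existsUnique_isStationary {p : Params} (hp : Generic p) {N m : ℕ} (hm : m ≤ N) :
    ∃! Ψ : Config N → Laurent N, IsStationary p m Ψ :=
  ⟨ansatz p m, isStationary_ansatz hp hm, fun _ hΨ => hΨ.eq hp hm (isStationary_ansatz hp hm)⟩

theorem psi_eq_ansatzVal {p : Params} (hp : Generic p) {N : ℕ} (w : Config N) (z : Fin N → ℂˣ) :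
    psi p w z = ansatzVal p w z := by
  have hm : stars w ≤ N := by
    simpa [stars] using Finset.card_filter_le (Finset.univ : Finset (Fin N)) fun i => w i = 0
  have h : ∃ Ψ : Config N → Laurent N, IsStationary p (stars w) Ψ := ⟨_, isStationary_ansatz hp hm⟩
  have hs : stationary p N (stars w) = ansatz p (stars w) := by
    rw [stationary, dif_pos h]
    exact h.choose_spec.eq hp hm (isStationary_ansatz hp hm)
  rw [psi, hs, eval_ansatz, if_pos rfl]

end

end OpenASEP

theorem mainTheorem5 (a b c d t : ℂˣ) (ht : ∀ n : ℕ, 0 < n → t ^ n ≠ 1)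
    (hgen : ∀ n : ℕ, a * b * c * d * t ^ n ≠ 1) :
    -- the normalized solutions exist and are unique, so that the components are well defined
    (∀ N m : ℕ, m ≤ N → ∃! Ψ : OpenASEP.Config N → OpenASEP.Laurent N,
      OpenASEP.IsStationary ⟨a, b, c, d, t⟩ m Ψ) ∧
    ∀ (N : ℕ) (w : OpenASEP.Config N) (z : Fin N → ℂˣ),
      -- removal of a second class particle at the boundary
      (∀ x : ℂˣ, OpenASEP.psi ⟨a, b, c, d, t⟩ (OpenASEP.addRight w 0) (OpenASEP.addRight z x) =
        OpenASEP.psi ⟨a, b, t * c, t * d, t⟩ w z) ∧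
      (∀ x : ℂˣ, OpenASEP.psi ⟨a, b, c, d, t⟩ (OpenASEP.addLeft 0 w) (OpenASEP.addLeft x z) =
        OpenASEP.psi ⟨t * a, t * b, c, d, t⟩ w z) ∧
      -- linear combinations of the two other boundary components
      (∀ x : ℂˣ,
        OpenASEP.psi ⟨a, b, c, d, t⟩ (OpenASEP.addRight w (-1)) (OpenASEP.addRight z x) +
          c * d * OpenASEP.psi ⟨a, b, c, d, t⟩ (OpenASEP.addRight w 1) (OpenASEP.addRight z x) =
        (1 - c * x) * (1 - d * x) / x * OpenASEP.psi ⟨a, b, c, d, t⟩ w z) ∧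
      (∀ x : ℂˣ,
        a * b * OpenASEP.psi ⟨a, b, c, d, t⟩ (OpenASEP.addLeft (-1) w) (OpenASEP.addLeft x z) +
          OpenASEP.psi ⟨a, b, c, d, t⟩ (OpenASEP.addLeft 1 w) (OpenASEP.addLeft x z) =
        (a - x) * (b - x) / x * OpenASEP.psi ⟨a, b, c, d, t⟩ w z) ∧
      -- specializations of the last variable
      OpenASEP.psi ⟨a, b, c, d, t⟩ (OpenASEP.addRight w (-1)) (OpenASEP.addRight z c⁻¹) =
        OpenASEP.constR ⟨a, b, c, d, t⟩ (OpenASEP.stars w) c *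
          OpenASEP.psi ⟨a, b, t * c, d, t⟩ w z ∧
      OpenASEP.psi ⟨a, b, c, d, t⟩ (OpenASEP.addRight w (-1)) (OpenASEP.addRight z d⁻¹) =
        OpenASEP.constR ⟨a, b, c, d, t⟩ (OpenASEP.stars w) d *
          OpenASEP.psi ⟨a, b, c, t * d, t⟩ w z ∧
      OpenASEP.psi ⟨a, b, c, d, t⟩ (OpenASEP.addRight w 1) (OpenASEP.addRight z c⁻¹) =
        -((c : ℂ)⁻¹ * (d : ℂ)⁻¹) * OpenASEP.constR ⟨a, b, c, d, t⟩ (OpenASEP.stars w) c *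
          OpenASEP.psi ⟨a, b, t * c, d, t⟩ w z ∧
      OpenASEP.psi ⟨a, b, c, d, t⟩ (OpenASEP.addRight w 1) (OpenASEP.addRight z d⁻¹) =
        -((c : ℂ)⁻¹ * (d : ℂ)⁻¹) * OpenASEP.constR ⟨a, b, c, d, t⟩ (OpenASEP.stars w) d *
          OpenASEP.psi ⟨a, b, c, t * d, t⟩ w z ∧
      -- specializations of the first variable
      OpenASEP.psi ⟨a, b, c, d, t⟩ (OpenASEP.addLeft (-1) w) (OpenASEP.addLeft a z) =
        OpenASEP.constL ⟨a, b, c, d, t⟩ (OpenASEP.stars w) a *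
          OpenASEP.psi ⟨t * a, b, c, d, t⟩ w z ∧
      OpenASEP.psi ⟨a, b, c, d, t⟩ (OpenASEP.addLeft (-1) w) (OpenASEP.addLeft b z) =
        OpenASEP.constL ⟨a, b, c, d, t⟩ (OpenASEP.stars w) b *
          OpenASEP.psi ⟨a, t * b, c, d, t⟩ w z ∧
      OpenASEP.psi ⟨a, b, c, d, t⟩ (OpenASEP.addLeft 1 w) (OpenASEP.addLeft a z) =
        -(a * b : ℂ) * OpenASEP.constL ⟨a, b, c, d, t⟩ (OpenASEP.stars w) a *
          OpenASEP.psi ⟨t * a, b, c, d, t⟩ w z ∧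
      OpenASEP.psi ⟨a, b, c, d, t⟩ (OpenASEP.addLeft 1 w) (OpenASEP.addLeft b z) =
        -(a * b : ℂ) * OpenASEP.constL ⟨a, b, c, d, t⟩ (OpenASEP.stars w) b *
          OpenASEP.psi ⟨a, t * b, c, d, t⟩ w z := by
  have hp : OpenASEP.Generic ⟨a, b, c, d, t⟩ := hgen
  refine ⟨fun N m hm => OpenASEP.existsUnique_isStationary hp hm, fun N w z => ?_⟩
  have hc := c.ne_zero
  have hd := d.ne_zero
  have e0 : ∀ {M : ℕ} (v : OpenASEP.Config M) (y : Fin M → ℂˣ), _ :=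
    OpenASEP.psi_eq_ansatzVal hp
  have ec := OpenASEP.psi_eq_ansatzVal hp.mul_c w z
  have ed := OpenASEP.psi_eq_ansatzVal hp.mul_d w z
  have ecd := OpenASEP.psi_eq_ansatzVal hp.mul_cd w z
  have ea := OpenASEP.psi_eq_ansatzVal hp.mul_a w z
  have eb := OpenASEP.psi_eq_ansatzVal hp.mul_b w z
  have eab := OpenASEP.psi_eq_ansatzVal hp.mul_ab w z
  have hR := OpenASEP.ansatzVal_right_combination hp w z
  have hL := OpenASEP.ansatzVal_left_combination ⟨a, b, c, d, t⟩ w z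
  have vc := OpenASEP.ansatzVal_inv_c hp w z
  have vd := OpenASEP.ansatzVal_inv_d hp w z
  have va := OpenASEP.ansatzVal_a hp w z
  have vb := OpenASEP.ansatzVal_b hp w z
  simp only at ec ed ecd ea eb eab hR hL vc vd va vb
  simp only [e0, ec, ed, ecd, ea, eb, eab]
  refine ⟨OpenASEP.ansatzVal_addRight_zero hp w z, OpenASEP.ansatzVal_addLeft_zero hp w z, hR, hL,
    vc, vd, ?_, ?_, va, vb, ?_, ?_⟩
  -- At `z_N = c⁻¹` the right side of the linear combination vanishes, so the • component is
  -- `-1/(cd)` times the ∘ component. The other three cases are analogous.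
  · have h := hR c⁻¹
    rw [vc, Units.val_inv_eq_inv_val, mul_inv_cancel₀ hc, sub_self, zero_mul, zero_div,
      zero_mul] at h
    field_simp
    linear_combination h
  · have h := hR d⁻¹
    rw [vd, Units.val_inv_eq_inv_val, mul_inv_cancel₀ hd, sub_self, mul_zero, zero_div,
      zero_mul] at h
    field_simp
    linear_combination h
  · have h := hL a
    rw [va, sub_self, zero_mul, zero_div, zero_mul] at h
    linear_combination h
  · have h := hL b
    rw [vb, sub_self, mul_zero, zero_div, zero_mul] at h
    linear_combination h
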